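/- Let $T$ be a nonempty string of length $n$ over the integer alphabet $\Sigma=\{0,\dots,\sigma-1\}$, and let $r_0r_1\cdots r_{m-1}$ be its run-length encoding, i.e. its decomposition into $m$ maximal runs $c^e$ of equal characters. A minimal absent word of $T$ is a nonempty string over $\Sigma$ that does not occur in $T$ as a (contiguous) substring while all its proper substrings do; let $\mathsf{MAW}(T)$ be the set of these. A string is reported by a tuple $(a,k,p,r,i,\ell)$ of six words, which stands for $a^k$ followed by the $r$ runs $r_p,\dots,r_{p+r-1}$, where $r_p$ is given the exponent $i$, $r_{p+r-1}$ is given the exponent $\ell$ if $r\ge 2$, and the runs strictly between keep their exponents. Then there are a constant $C$ and a single word-RAM query program, neither depending on $T$ or $\sigma$, such that every such $T$ has a data structure $\mathsf{D}$ of at most $Cm$ words, which stores the run-length encoding of $T$ explicitly, and from which the program reports all minimal absent words of $T$, each exactly once, in at most $C\,|\mathsf{MAW}(T)|$ steps, using $Cm$ words of (uninitialized) working memory and without modifying $\mathsf{D}$. This holds on word RAMs of every word size $w$ with $2^w\ge C(n+\sigma)$. In short: there is a data structure of $O(m)$ words which outputs all minimal absent words of $T$ in $O(|\mathsf{MAW}(T)|)$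 time. -/

import Mathlib

/-! ### Strings, run-length encoding, minimal absent words -/

/-- The run-length encoding of a string: its maximal runs `a ^ p`, from left to right, each given
as the pair `(a, p)`. -/
def rle {α : Type*} [DecidableEq α] : List α → List (α × ℕ)
  | [] => []
  | a :: t =>
    match rle t with
    | [] => [(a, 1)]
    | (b, k) :: rest => if a = b then (b, k + 1) :: rest else (a, 1) :: (b, k) :: rest

/-- The size of the run-length encoding: the number of maximal runs. -/
def rleSize {α : Type*} [DecidableEq α] (T : List α) : ℕ := (rle T).length

/-- The string spelled by a list of runs. -/
def expandRuns {α : Type*} (R : List (α × ℕ)) : List α :=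
  R.flatMap fun x => List.replicate x.2 x.1

/-- The set of minimal absent words of `T`: nonempty strings that do not occur in `T` and all of
whose proper substrings occur in `T`. (`v <:+: T` says that `v` is a contiguous substring.) -/
def MAW {α : Type*} (T : List α) : Set (List α) :=
  {w | w ≠ [] ∧ ¬ w <:+: T ∧ ∀ v, v <:+: w → v ≠ w → v <:+: T}

/-! ### Descriptors of constant size -/

/-- A descriptor of a string relative to the run-length encoding `r₀ r₁ ⋯` of a text over the
alphabet `{0, …, σ - 1}`. It describes `a ^ k` followed by the `r` consecutive runs starting at
index `p`, where the first of these runs is given the exponent `i`, the last one (if `r ≥ 2`) the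
exponent `l`, and the runs strictly between keep their exponents. -/
structure Descriptor (σ : ℕ) where
  a : Fin σ
  k : ℕ
  p : ℕ
  r : ℕ
  i : ℕ
  l : ℕ

namespace Descriptor

/-- The six machine words by which a descriptor is written. -/
def toWords {σ : ℕ} (d : Descriptor σ) : List ℕ := [d.a.val, d.k, d.p, d.r, d.i, d.l]

/-- The string that a descriptor describes relative to the run-length encoding `R`
(`none` if it refers to a run that does not exist). -/
def decode {σ : ℕ} (R : List (Fin σ × ℕ)) (d : Descriptor σ) : Option (List (Fin σ)) :=
  match d.r with
  | 0 => some (List.replicate d.k d.a)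
  | 1 =>
    match R[d.p]? with
    | some x => some (List.replicate d.k d.a ++ List.replicate d.i x.1)
    | none => none
  | s + 2 =>
    match R[d.p]?, R[d.p + s + 1]? with
    | some x, some y =>
      some (List.replicate d.k d.a ++ List.replicate d.i x.1 ++
        expandRuns ((R.drop (d.p + 1)).take s) ++ List.replicate d.l y.1)
    | _, _ => none

end Descriptor

/-- The words that store the run-length encoding of `T` explicitly: the number of runs, followed by
the character and the exponent of each run. -/
def rleWords {σ : ℕ} (T : List (Fin σ)) : List ℕ :=
  rleSize T :: (rle T).flatMap fun x => [x.1.val, x.2]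

/-- The word sequence `out` consists of descriptors of the minimal absent words of `T`, every
minimal absent word being reported exactly once. -/
def ReportsMAW {σ : ℕ} (T : List (Fin σ)) (out : List ℕ) : Prop :=
  ∃ (L : List (Descriptor σ)) (W : List (List (Fin σ))),
    out = L.flatMap Descriptor.toWords ∧
    L.map (Descriptor.decode (rle T)) = W.map some ∧
    W.Nodup ∧ ∀ v, v ∈ W ↔ v ∈ MAW T

/-! ### The word RAM

A random access machine with words of `w` bits, a read-only memory that holds the data structure, a
read-write working memory of fixed size, registers, and an output tape that can only be appended to.
Programs are while-programs; each use of a constant, a register, a memory cell, an arithmetic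
operation or a comparison is charged one step, and so is each executed instruction. Of the
arithmetic of a word RAM only addition modulo `2 ^ w`, truncated subtraction and comparisons are
provided. -/

namespace WordRAM

/-- Expressions. `data e` and `work e` read the cell with address `e`. -/
inductive Expr where
  | const (c : ℕ)
  | reg (x : ℕ)
  | data (e : Expr)
  | work (e : Expr)
  | add (e f : Expr)
  | sub (e f : Expr)
  | lt (e f : Expr)
  | eq (e f : Expr)

/-- Programs. A condition holds if its value is not `0`. -/
inductive Prog where
  | skip
  | assign (x : ℕ) (e : Expr)
  | store (addr e : Expr)
  | emit (e : Expr)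
  | seq (P Q : Prog)
  | ite (c : Expr) (P Q : Prog)
  | loop (c : Expr) (P : Prog)

/-- The changing part of a configuration: registers, working memory, output written so far. -/
structure State where
  reg : ℕ → ℕ
  mem : List ℕ
  out : List ℕ

/-- The start of a run: registers `0`, working memory as found, no output. -/
def State.init (mem : List ℕ) : State := ⟨fun _ => 0, mem, []⟩

/-- The value of an expression, with word size `w` and read-only memory `D`. Reading outside of a
memory yields `0`. -/
def Expr.eval (w : ℕ) (D : List ℕ) (s : State) : Expr → ℕ
  | const c => c % 2 ^ w
  | reg x => s.reg x
  | data e => D.getD (e.eval w D s) 0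
  | work e => s.mem.getD (e.eval w D s) 0
  | add e f => (e.eval w D s + f.eval w D s) % 2 ^ w
  | sub e f => e.eval w D s - f.eval w D s
  | lt e f => if e.eval w D s < f.eval w D s then 1 % 2 ^ w else 0
  | eq e f => if e.eval w D s = f.eval w D s then 1 % 2 ^ w else 0

/-- The number of steps that the evaluation of an expression takes. -/
def Expr.cost : Expr → ℕ
  | const _ => 1
  | reg _ => 1
  | data e => e.cost + 1
  | work e => e.cost + 1
  | add e f => e.cost + f.cost + 1
  | sub e f => e.cost + f.cost + 1
  | lt e f => e.cost + f.cost + 1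
  | eq e f => e.cost + f.cost + 1

/-- `Exec w D P s t s'`: with word size `w` and read-only memory `D`, the program `P` started in
state `s` halts after `t` steps in state `s'`. The size of the working memory never changes: writing
outside of it has no effect. -/
inductive Exec (w : ℕ) (D : List ℕ) : Prog → State → ℕ → State → Prop
  | skip (s : State) : Exec w D .skip s 1 s
  | assign (x : ℕ) (e : Expr) (s : State) :
      Exec w D (.assign x e) s (e.cost + 1)
        { s with reg := Function.update s.reg x (e.eval w D s) }
  | store (addr e : Expr) (s : State) :
      Exec w D (.store addr e) s (addr.cost + e.cost + 1)
        { s with mem := s.mem.set (addr.eval w D s) (e.eval w D s) }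
  | emit (e : Expr) (s : State) :
      Exec w D (.emit e) s (e.cost + 1) { s with out := s.out ++ [e.eval w D s] }
  | seq {P Q : Prog} {s s' s'' : State} {t t' : ℕ} :
      Exec w D P s t s' → Exec w D Q s' t' s'' → Exec w D (.seq P Q) s (t + t') s''
  | ite_true {c : Expr} {P Q : Prog} {s s' : State} {t : ℕ} :
      c.eval w D s ≠ 0 → Exec w D P s t s' → Exec w D (.ite c P Q) s (c.cost + 1 + t) s'
  | ite_false {c : Expr} {P Q : Prog} {s s' : State} {t : ℕ} :
      c.eval w D s = 0 → Exec w D Q s t s' → Exec w D (.ite c P Q) s (c.cost + 1 + t) s'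
  | loop_done {c : Expr} {P : Prog} {s : State} :
      c.eval w D s = 0 → Exec w D (.loop c P) s (c.cost + 1) s
  | loop_step {c : Expr} {P : Prog} {s s' s'' : State} {t t' : ℕ} :
      c.eval w D s ≠ 0 → Exec w D P s t s' → Exec w D (.loop c P) s' t' s'' →
      Exec w D (.loop c P) s (c.cost + 1 + t + t') s''

end WordRAM

/-!
A minimal absent word `w` of a text `T` is determined by how its runs fit to the runs of `T`: a
string with at least two runs occurs in `T` exactly if its inner runs are complete runs of `T`
between two outer runs that are at least as long as its own (`expandRuns_infix_iff`), and `w` is a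
minimal absent word if it does not occur, but does so without its first and without its last
character (`mem_MAW_iff`). This splits the minimal absent words into five classes
(`MAW_eq_union`): those whose first or last run has an exponent of at least `2`, and, with both of
these exponents equal to `1`, those of one, two, three, and at least four runs.

Let `m` be the number of runs of `T`. The first class has at most `9 * m` elements
(`longEndMAW_ncard_le`), which can be stored explicitly. The other classes may be far larger than
`m`, but each of them is a *join* of `O(m)` left parts and `O(m)` right parts (`Family`). For words
`a c^i V d^l b`, a left part is `a` and `i`, and a right part is `l` and `b`, in the same context
`c`, `V`, `d`; if `A` is the largest exponent of `d` after the left part and `B` the largest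
exponent of `c` before the right part, the word is a minimal absent word exactly if `l ≤ A`,
`i ≤ B`, and the word does not occur. The words `a c^k b` are obtained in the same way with `k`
running from `1` to the smaller one of two bounds. All bounds of the form `O(m)` come from a single
count: in a tree with `m` leaves there are at most `2 * m` edges from vertices with several
children (`branchingEdges_ncard_le`). It is applied to the tree of the contexts in `T`, as both
parts of a minimal absent word are branching continuations of their context. It also bounds the
number of exceptions, that is, of pairs of parts that occur together (`jointParts_ncard_le`).

The pairs with `l ≤ A` and `i ≤ B` are enumerated by a sweep over the left parts in the order of
decreasing `i` (`Family.exists_records`). The right parts with `B ≥ i` form a linked list in the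
working memory, sorted by context and `l`, so that the right parts that belong to a left part are
consecutive in it. Only insertions are needed, and their places are known beforehand, so the data
structure contains the writes that have to be made (`exists_writes`). The exceptions cut the
part of the list that belongs to a left part into gaps, and the data structure contains one record
for each nonempty gap, telling where it starts and how long it is. Right parts without any output
are left out. So there are `O(m)` records, but also at most three times as many as there are words
to report, and the query program (`WordRAM.queryProg`) spends constant time per record and per
reported word.
-/

/-! ### Run lists -/

/-- A run-length encoding: exponents are positive and neighbouring runs have different
characters. -/
def RunList {α : Type*} (R : List (α × ℕ)) : Prop :=
  (∀ x ∈ R, 0 < x.2) ∧ R.IsChain fun x y => x.1 ≠ y.1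

section Runs

variable {α : Type*}

@[simp] theorem expandRuns_nil : expandRuns ([] : List (α × ℕ)) = [] := rfl

@[simp] theorem expandRuns_cons (x : α × ℕ) (R : List (α × ℕ)) :
    expandRuns (x :: R) = List.replicate x.2 x.1 ++ expandRuns R := rfl

@[simp] theorem expandRuns_append (R S : List (α × ℕ)) :
    expandRuns (R ++ S) = expandRuns R ++ expandRuns S := by
  simp [expandRuns]

theorem expandRuns_reverse (R : List (α × ℕ)) :
    expandRuns R.reverse = (expandRuns R).reverse := by
  induction R with
  | nil => rfl
  | cons x R ih => simp [ih]

theorem runList_nil : RunList ([] : List (α × ℕ)) := ⟨by simp, by simp⟩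

theorem RunList.infix {R S : List (α × ℕ)} (h : RunList R) (hS : S <:+: R) : RunList S :=
  ⟨fun x hx => h.1 x (hS.subset hx), h.2.infix hS⟩

theorem RunList.reverse {R : List (α × ℕ)} (h : RunList R) : RunList R.reverse := by
  refine ⟨by simpa using h.1, ?_⟩
  rw [List.isChain_reverse]
  exact h.2.imp fun _ _ h => Ne.symm h

theorem RunList.tail {x : α × ℕ} {R : List (α × ℕ)} (h : RunList (x :: R)) : RunList R :=
  h.infix (List.suffix_cons x R).isInfix

theorem RunList.head_pos {x : α × ℕ} {R : List (α × ℕ)} (h : RunList (x :: R)) : 0 < x.2 :=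
  h.1 x (by simp)

theorem runList_cons_cons {x y : α × ℕ} {R : List (α × ℕ)} :
    RunList (x :: y :: R) ↔ 0 < x.2 ∧ x.1 ≠ y.1 ∧ RunList (y :: R) := by
  simp only [RunList, List.isChain_cons_cons, List.forall_mem_cons]
  tauto

theorem runList_singleton {x : α × ℕ} : RunList [x] ↔ 0 < x.2 := by
  simp [RunList]

/-- Only the character of the first run matters for being a run list. -/
theorem RunList.change_head {a : α} {x y : ℕ} {R : List (α × ℕ)} (h : RunList ((a, x) :: R))
    (hy : 0 < y) : RunList ((a, y) :: R) := by
  cases R with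
  | nil => exact runList_singleton.2 hy
  | cons r R => rw [runList_cons_cons] at h ⊢; exact ⟨hy, h.2⟩

theorem RunList.change_last {b : α} {x y : ℕ} {R : List (α × ℕ)} (h : RunList (R ++ [(b, x)]))
    (hy : 0 < y) : RunList (R ++ [(b, y)]) := by
  have h1 := h.reverse
  simp only [List.reverse_append, List.reverse_singleton, List.singleton_append] at h1
  simpa using (h1.change_head hy).reverse

theorem expandRuns_head? {x : α × ℕ} {R : List (α × ℕ)} (hx : 0 < x.2) :
    ∃ t, expandRuns (x :: R) = x.1 :: t := by
  obtain ⟨k, hk⟩ := Nat.exists_eq_succ_of_ne_zero hx.ne'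
  exact ⟨List.replicate k x.1 ++ expandRuns R, by simp [hk, List.replicate_succ]⟩

theorem expandRuns_ne_nil {R : List (α × ℕ)} (h : RunList R) (hR : R ≠ []) :
    expandRuns R ≠ [] := by
  obtain ⟨x, R, rfl⟩ := List.exists_cons_of_ne_nil hR
  obtain ⟨t, ht⟩ := expandRuns_head? (R := R) h.head_pos
  simp [ht]

/-- A nonempty power of `a` followed by anything is not a prefix of a string of runs whose first
run has another character. -/
theorem not_replicate_prefix {a : α} {k : ℕ} (hk : 0 < k) {z : α × ℕ} {R : List (α × ℕ)}
    (h : RunList (z :: R)) (hz : a ≠ z.1) (X : List α) :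
    ¬ List.replicate k a ++ X <+: expandRuns (z :: R) := by
  obtain ⟨t, ht⟩ := expandRuns_head? (R := R) h.head_pos
  obtain ⟨k, rfl⟩ := Nat.exists_eq_succ_of_ne_zero hk.ne'
  rw [ht, List.replicate_succ, List.cons_append, List.cons_prefix_cons]
  exact fun h => hz h.1

/-- If one string of runs is a prefix of another one, then the first runs have the same character,
and they agree unless the first string has only one run. -/
theorem head_of_expandRuns_prefix {x y : α × ℕ} {S R : List (α × ℕ)} (hS : RunList (x :: S))
    (hR : RunList (y :: R)) (h : expandRuns (x :: S) <+: expandRuns (y :: R)) :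
    x.1 = y.1 ∧ x.2 ≤ y.2 ∧ (S ≠ [] → x.2 = y.2 ∧ expandRuns S <+: expandRuns R) := by
  have hxy : x.1 = y.1 := by
    by_contra hne
    exact not_replicate_prefix hS.head_pos hR hne _ h
  obtain ⟨a, e⟩ := x
  obtain ⟨c, f⟩ := y
  obtain rfl : a = c := hxy
  simp only [expandRuns_cons] at h
  have hle : e ≤ f := by
    by_contra hlt
    push Not at hlt
    obtain ⟨d, rfl⟩ := Nat.exists_eq_add_of_lt hlt
    rw [show f + d + 1 = f + (d + 1) by omega, List.replicate_add, List.append_assoc,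
      List.prefix_append_right_inj] at h
    cases R with
    | nil => simp at h
    | cons z R =>
      exact not_replicate_prefix (Nat.succ_pos d) hR.tail (runList_cons_cons.1 hR).2.1 _ h
  refine ⟨rfl, hle, fun hne => ?_⟩
  obtain ⟨d, rfl⟩ := Nat.exists_eq_add_of_le hle
  rw [List.replicate_add, List.append_assoc, List.prefix_append_right_inj] at h
  cases d with
  | zero => exact ⟨by simp, by simpa using h⟩
  | succ d =>
    obtain ⟨z, S, rfl⟩ := List.exists_cons_of_ne_nil hne
    obtain ⟨t, ht⟩ := expandRuns_head? (R := S) hS.tail.head_pos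
    rw [ht, List.replicate_succ, List.cons_append, List.cons_prefix_cons] at h
    exact absurd h.1.symm (runList_cons_cons.1 hS).2.1

theorem expandRuns_mono_last (V : List (α × ℕ)) (b : α) {l y : ℕ} (h : l ≤ y) :
    expandRuns (V ++ [(b, l)]) <+: expandRuns (V ++ [(b, y)]) := by
  obtain ⟨d, rfl⟩ := Nat.exists_eq_add_of_le h
  exact ⟨List.replicate d b, by simp⟩

theorem expandRuns_mono_head (V : List (α × ℕ)) (a : α) {i x : ℕ} (h : i ≤ x) :
    expandRuns ((a, i) :: V) <:+ expandRuns ((a, x) :: V) := by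
  obtain ⟨d, rfl⟩ := Nat.exists_eq_add_of_le' h
  exact ⟨List.replicate d a, by simp [← List.append_assoc]⟩

theorem expandRuns_prefix_of_prefix {R S : List (α × ℕ)} (h : S <+: R) :
    expandRuns S <+: expandRuns R := by
  obtain ⟨t, rfl⟩ := h
  simp

theorem expandRuns_infix_of_infix {R S : List (α × ℕ)} (h : S <:+: R) :
    expandRuns S <:+: expandRuns R := by
  obtain ⟨s, t, rfl⟩ := h
  exact ⟨expandRuns s, expandRuns t, by simp⟩

/-- A string of runs begins where a run of the text begins. -/
theorem expandRuns_prefix_iff {V R : List (α × ℕ)} {b : α} {l : ℕ}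
    (hV : RunList (V ++ [(b, l)])) (hR : RunList R) :
    expandRuns (V ++ [(b, l)]) <+: expandRuns R ↔ ∃ y, l ≤ y ∧ V ++ [(b, y)] <+: R := by
  constructor
  · intro h
    induction V generalizing R with
    | nil =>
      cases R with
      | nil =>
        have := hV.head_pos
        simp at h this
        omega
      | cons y R =>
        obtain ⟨h1, h2, -⟩ := head_of_expandRuns_prefix hV hR h
        refine ⟨y.2, h2, ?_⟩
        obtain ⟨c, f⟩ := y
        obtain rfl : b = c := h1
        simp
    | cons v V ih =>
      cases R with
      | nil => exact absurd (List.prefix_nil.1 h) (expandRuns_ne_nil hV (by simp))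
      | cons y R =>
        obtain ⟨h1, -, h3⟩ := head_of_expandRuns_prefix hV hR h
        obtain ⟨h3, h4⟩ := h3 (by simp)
        obtain ⟨z, hz, hp⟩ := ih hV.tail hR.tail h4
        refine ⟨z, hz, ?_⟩
        rw [Prod.ext h1 h3]
        simpa using hp
  · rintro ⟨y, hy, h⟩
    exact (expandRuns_mono_last V b hy).trans (expandRuns_prefix_of_prefix h)

/-- A nonempty substring begins inside some run of the text. -/
theorem infix_expandRuns {w : List α} (hw : w ≠ []) {R : List (α × ℕ)}
    (h : w <:+: expandRuns R) :
    ∃ c e S o, (c, e) :: S <:+ R ∧ o < e ∧ w <+: expandRuns ((c, e - o) :: S) := by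
  induction R with
  | nil => exact absurd (List.infix_nil.1 h) hw
  | cons x R ih =>
    obtain ⟨s, t, hst⟩ := h
    by_cases hs : s.length < x.2
    · refine ⟨x.1, x.2, R, s.length, by simp, hs, ⟨t, ?_⟩⟩
      have := congrArg (List.drop s.length) hst
      rw [List.append_assoc, List.drop_left, expandRuns_cons,
        List.drop_append_of_le_length (by simpa using hs.le)] at this
      simpa using this
    · have := congrArg (List.drop x.2) hst
      rw [List.append_assoc, List.drop_append_of_le_length (by omega), expandRuns_cons,
        List.drop_left' (by simp), ← List.append_assoc] at this
      obtain ⟨c, e, S, o, h1, h2⟩ := ih ⟨_, _, this⟩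
      exact ⟨c, e, S, o, h1.trans (List.suffix_cons x R), h2⟩

theorem singleton_infix {x : α} {R : List α} (h : x ∈ R) : [x] <:+: R := by
  obtain ⟨s, t, rfl⟩ := List.append_of_mem h
  exact ⟨s, t, by simp⟩

/-- Occurrences of a power of a character. -/
theorem replicate_infix_iff {R : List (α × ℕ)} (hR : RunList R) {a : α} {k : ℕ} (hk : 0 < k) :
    List.replicate k a <:+: expandRuns R ↔ ∃ x, k ≤ x ∧ (a, x) ∈ R := by
  constructor
  · intro h
    obtain ⟨c, e, S, o, h1, h2, h3⟩ := infix_expandRuns (by simp; omega) h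
    have hS := (hR.infix h1.isInfix).change_head (y := e - o) (by omega)
    have hW : RunList [(a, k)] := runList_singleton.2 hk
    obtain ⟨h4, h5, -⟩ := head_of_expandRuns_prefix hW hS (by simpa using h3)
    obtain rfl : a = c := h4
    simp only at h5
    exact ⟨e, by omega, h1.subset (by simp)⟩
  · rintro ⟨x, hx, h⟩
    have h1 := expandRuns_infix_of_infix (singleton_infix h)
    have h2 := (expandRuns_mono_head [] a hx).isInfix.trans h1
    simpa using h2

/-- Occurrences of a string with at least two runs in a text: the inner runs are runs of the text,
the outer ones are parts of runs of the text. -/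
theorem expandRuns_infix_iff {R V : List (α × ℕ)} (hR : RunList R) {a b : α} {i l : ℕ}
    (hV : RunList ((a, i) :: V ++ [(b, l)])) :
    expandRuns ((a, i) :: V ++ [(b, l)]) <:+: expandRuns R ↔
      ∃ x y, i ≤ x ∧ l ≤ y ∧ (a, x) :: V ++ [(b, y)] <:+: R := by
  constructor
  · intro h
    obtain ⟨c, e, S, o, h1, h2, h3⟩ := infix_expandRuns (expandRuns_ne_nil hV (by simp)) h
    have hS := (hR.infix h1.isInfix).change_head (y := e - o) (by omega)
    rw [expandRuns_prefix_iff hV hS] at h3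
    obtain ⟨y, hy, h4⟩ := h3
    rw [List.cons_append, List.cons_prefix_cons, Prod.mk.injEq] at h4
    obtain ⟨⟨rfl, rfl⟩, h5⟩ := h4
    refine ⟨e, y, by omega, hy, List.IsPrefix.isInfix ?_ |>.trans h1.isInfix⟩
    simpa using h5
  · rintro ⟨x, y, hx, hy, h⟩
    have h1 := expandRuns_mono_last ((a, i) :: V) b hy
    have h2 := expandRuns_mono_head (V ++ [(b, y)]) a hx
    exact h1.isInfix.trans (h2.isInfix.trans (expandRuns_infix_of_infix h))

section RLE

variable [DecidableEq α]

theorem rle_cons (a : α) (t : List α) : rle (a :: t) =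
    match rle t with
    | [] => [(a, 1)]
    | (b, k) :: rest => if a = b then (b, k + 1) :: rest else (a, 1) :: (b, k) :: rest := rfl

theorem expandRuns_rle (T : List α) : expandRuns (rle T) = T := by
  induction T with
  | nil => rfl
  | cons a T ih =>
    rw [rle_cons]
    split
    · next h => rw [h] at ih; simp [← ih]
    · next b k rest h =>
      rw [h] at ih
      split
      · next hab => subst hab; rw [← ih]; simp [List.replicate_succ]
      · rw [← ih]; simp

theorem runList_rle (T : List α) : RunList (rle T) := by
  induction T with
  | nil => exact runList_nil
  | cons a T ih =>
    rw [rle_cons]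
    split
    · exact runList_singleton.2 one_pos
    · next b k rest h =>
      rw [h] at ih
      split
      · exact ih.change_head (Nat.succ_pos k)
      · next hab => exact runList_cons_cons.2 ⟨one_pos, hab, ih⟩

theorem rle_expandRuns {R : List (α × ℕ)} (h : RunList R) : rle (expandRuns R) = R := by
  induction R with
  | nil => rfl
  | cons x R ih =>
    have ih := ih h.tail
    obtain ⟨a, e⟩ := x
    have he := h.head_pos
    obtain ⟨k, rfl⟩ := Nat.exists_eq_succ_of_ne_zero he.ne'
    clear he
    induction k with
    | zero =>
      rw [expandRuns_cons]
      simp only [Nat.succ_eq_add_one, zero_add, List.replicate_one, List.singleton_append]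
      rw [rle_cons, ih]
      cases R with
      | nil => rfl
      | cons y R => simp [(runList_cons_cons.1 h).2.1]
    | succ k ihk =>
      have := ihk (h.change_head (Nat.succ_pos k))
      rw [expandRuns_cons, List.replicate_succ, List.cons_append, rle_cons]
      rw [expandRuns_cons] at this
      simp only [this]
      simp

/-- A string has only one run-length encoding. -/
theorem expandRuns_injOn {R S : List (α × ℕ)} (hR : RunList R) (hS : RunList S)
    (h : expandRuns R = expandRuns S) : R = S := by
  rw [← rle_expandRuns hR, h, rle_expandRuns hS]

end RLE

theorem length_le_expandRuns {R : List (α × ℕ)} (h : RunList R) :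
    R.length ≤ (expandRuns R).length := by
  induction R with
  | nil => simp
  | cons x R ih =>
    have := ih h.tail
    have := h.head_pos
    simp only [expandRuns_cons, List.length_cons, List.length_append, List.length_replicate]
    omega

theorem exp_le_length {R : List (α × ℕ)} {x : α × ℕ} (h : x ∈ R) :
    x.2 ≤ (expandRuns R).length := by
  obtain ⟨s, t, rfl⟩ := List.append_of_mem h
  simp only [expandRuns_append, expandRuns_cons, List.length_append, List.length_replicate]
  omega

end Runs

/-! ### Minimal absent words in terms of runs -/

section MinimalAbsentWords

variable {α : Type*}

/-- It suffices that the two maximal proper substrings occur. -/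
theorem mem_MAW_iff {T w : List α} (hw : w ≠ []) :
    w ∈ MAW T ↔ ¬ w <:+: T ∧ w.tail <:+: T ∧ w.dropLast <:+: T := by
  constructor
  · rintro ⟨-, h1, h2⟩
    refine ⟨h1, h2 _ (List.tail_suffix w).isInfix fun h => ?_,
      h2 _ (List.dropLast_prefix w).isInfix fun h => ?_⟩
    · have := congrArg List.length h
      have := List.length_pos_iff.2 hw
      simp at *
      omega
    · have := congrArg List.length h
      have := List.length_pos_iff.2 hw
      simp at *
      omega
  · rintro ⟨h1, h2, h3⟩
    refine ⟨hw, h1, ?_⟩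
    rintro v ⟨s, t, rfl⟩ hne
    cases s with
    | cons c s => exact List.IsInfix.trans ⟨s, t, by simp⟩ h2
    | nil =>
      obtain rfl | ht := eq_or_ne t []
      · simp at hne
      · refine List.IsInfix.trans ⟨[], t.dropLast, ?_⟩ h3
        rw [List.dropLast_append_of_ne_nil ht]

theorem reverse_mem_MAW {T w : List α} (h : w ∈ MAW T) : w.reverse ∈ MAW T.reverse := by
  have hw : w ≠ [] := h.1
  rw [mem_MAW_iff hw] at h
  rw [mem_MAW_iff (by simpa using hw), List.tail_reverse, List.dropLast_reverse]
  simp only [List.reverse_infix]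
  exact ⟨h.1, h.2.2, h.2.1⟩

theorem length_le_of_mem_MAW {T w : List α} (h : w ∈ MAW T) : w.length ≤ T.length + 1 := by
  have := ((mem_MAW_iff h.1).1 h).2.1.length_le
  simp at this
  omega

theorem tail_expandRuns_one (a : α) (V : List (α × ℕ)) :
    (expandRuns ((a, 1) :: V)).tail = expandRuns V := by
  simp

theorem tail_expandRuns_succ (a : α) {i : ℕ} (hi : 2 ≤ i) (V : List (α × ℕ)) :
    (expandRuns ((a, i) :: V)).tail = expandRuns ((a, i - 1) :: V) := by
  obtain ⟨i, rfl⟩ := Nat.exists_eq_add_of_le' hi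
  simp [List.replicate_succ]

theorem dropLast_expandRuns_one (b : α) (V : List (α × ℕ)) :
    (expandRuns (V ++ [(b, 1)])).dropLast = expandRuns V := by
  simp

theorem dropLast_expandRuns_succ (b : α) {l : ℕ} (hl : 2 ≤ l) (V : List (α × ℕ)) :
    (expandRuns (V ++ [(b, l)])).dropLast = expandRuns (V ++ [(b, l - 1)]) := by
  obtain ⟨l, rfl⟩ := Nat.exists_eq_add_of_le' hl
  simp [List.replicate_succ', ← List.append_assoc, -List.replicate_append_replicate]

theorem RunList.pos_of_infix {R S : List (α × ℕ)} (hR : RunList R) (hS : S <:+: R) {x : α × ℕ}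
    (hx : x ∈ S) : 0 < x.2 :=
  hR.1 x (hS.subset hx)

theorem replicate_mem_MAW_iff {R : List (α × ℕ)} (hR : RunList R) {a : α} {k : ℕ} (hk : 0 < k) :
    List.replicate k a ∈ MAW (expandRuns R) ↔
      (¬ ∃ x, k ≤ x ∧ (a, x) ∈ R) ∧ (2 ≤ k → ∃ x, k - 1 ≤ x ∧ (a, x) ∈ R) := by
  rw [mem_MAW_iff (by simp; omega), replicate_infix_iff hR hk]
  simp only [List.tail_replicate, List.dropLast_replicate, and_self]
  refine and_congr_right fun _ => ?_
  by_cases h : 2 ≤ k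
  · rw [replicate_infix_iff hR (by omega)]
    simp [h]
  · obtain rfl : k = 1 := by omega
    simp

theorem not_infix_of_mem_MAW {R V : List (α × ℕ)} (hR : RunList R) {a b : α} {i l : ℕ}
    (hV : RunList ((a, i) :: V ++ [(b, l)]))
    (h : expandRuns ((a, i) :: V ++ [(b, l)]) ∈ MAW (expandRuns R)) {x y : ℕ} (hx : i ≤ x)
    (hy : l ≤ y) : ¬ (a, x) :: V ++ [(b, y)] <:+: R := fun hxy =>
  h.2.1 ((expandRuns_infix_iff hR hV).2 ⟨x, y, hx, hy, hxy⟩)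

theorem tail_infix_of_mem_MAW {R V : List (α × ℕ)} (hR : RunList R) {a b : α} {i l : ℕ}
    (hV : RunList ((a, i) :: V ++ [(b, l)]))
    (h : expandRuns ((a, i) :: V ++ [(b, l)]) ∈ MAW (expandRuns R)) (hi : 2 ≤ i) :
    ∃ x y, i - 1 ≤ x ∧ l ≤ y ∧ (a, x) :: V ++ [(b, y)] <:+: R := by
  have h1 := ((mem_MAW_iff h.1).1 h).2.1
  rw [List.cons_append, tail_expandRuns_succ a hi] at h1
  refine (expandRuns_infix_iff hR ?_).1 h1
  exact RunList.change_head hV (by omega)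

theorem dropLast_infix_of_mem_MAW {R V : List (α × ℕ)} (hR : RunList R) {a b : α} {i l : ℕ}
    (hV : RunList ((a, i) :: V ++ [(b, l)]))
    (h : expandRuns ((a, i) :: V ++ [(b, l)]) ∈ MAW (expandRuns R)) (hl : 2 ≤ l) :
    ∃ x y, i ≤ x ∧ l - 1 ≤ y ∧ (a, x) :: V ++ [(b, y)] <:+: R := by
  have h1 := ((mem_MAW_iff h.1).1 h).2.2
  rw [dropLast_expandRuns_succ b hl] at h1
  refine (expandRuns_infix_iff hR ?_).1 h1
  exact RunList.change_last hV (by omega)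

/-- Everything after the first run of a minimal absent word occurs. -/
theorem inner_infix_of_mem_MAW {R V : List (α × ℕ)} {a b : α} {i l : ℕ}
    (hV : RunList ((a, i) :: V ++ [(b, l)]))
    (h : expandRuns ((a, i) :: V ++ [(b, l)]) ∈ MAW (expandRuns R)) :
    expandRuns (V ++ [(b, l)]) <:+: expandRuns R := by
  have h1 := ((mem_MAW_iff h.1).1 h).2.1
  by_cases hi : 2 ≤ i
  · rw [List.cons_append, tail_expandRuns_succ a hi, expandRuns_cons] at h1
    exact (List.suffix_append _ _).isInfix.trans h1
  · obtain rfl : i = 1 := by have := hV.head_pos; simp only at this; omega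
    rwa [List.cons_append, tail_expandRuns_one] at h1

/-- A string `a U b` whose first and last run have exponent `1`. -/
theorem unit_mem_MAW_iff {R V : List (α × ℕ)} (hR : RunList R) {a b : α}
    (hV : RunList ((a, 1) :: V ++ [(b, 1)])) :
    expandRuns ((a, 1) :: V ++ [(b, 1)]) ∈ MAW (expandRuns R) ↔
      (¬ ∃ x y, (a, x) :: V ++ [(b, y)] <:+: R) ∧
        expandRuns (V ++ [(b, 1)]) <:+: expandRuns R ∧
        expandRuns ((a, 1) :: V) <:+: expandRuns R := by
  rw [mem_MAW_iff (expandRuns_ne_nil hV (by simp)), dropLast_expandRuns_one,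
    expandRuns_infix_iff hR hV, List.cons_append, tail_expandRuns_one]
  refine and_congr_left fun _ => not_congr ⟨?_, ?_⟩
  · rintro ⟨x, y, -, -, h⟩
    exact ⟨x, y, h⟩
  · rintro ⟨x, y, h⟩
    exact ⟨x, y, hR.pos_of_infix h (x := (a, x)) (by simp),
      hR.pos_of_infix h (x := (b, y)) (by simp), h⟩

/-- The case of two runs: `a` and `b` occur, but never next to each other. -/
theorem pair_mem_MAW_iff {R : List (α × ℕ)} (hR : RunList R) {a b : α} (hab : a ≠ b) :
    expandRuns [(a, 1), (b, 1)] ∈ MAW (expandRuns R) ↔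
      (¬ ∃ x y, [(a, x), (b, y)] <:+: R) ∧ (∃ y, (b, y) ∈ R) ∧ ∃ x, (a, x) ∈ R := by
  have hV : RunList ((a, 1) :: [] ++ [(b, 1)]) := by
    simp [runList_cons_cons, runList_singleton, hab]
  have key (c : α) : expandRuns [(c, 1)] <:+: expandRuns R ↔ ∃ y, (c, y) ∈ R := by
    have := replicate_infix_iff hR (a := c) one_pos
    simp only [expandRuns_cons, expandRuns_nil, List.append_nil]
    rw [this]
    exact ⟨fun ⟨x, _, h⟩ => ⟨x, h⟩, fun ⟨x, h⟩ => ⟨x, hR.1 _ h, h⟩⟩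
  have := unit_mem_MAW_iff hR hV
  simp only [List.cons_append, List.nil_append] at this
  rw [this, key, key]

/-- The case of three runs: runs of `c` after `a` and runs of `c` before `b` may be longer than
`c ^ k`. -/
theorem triple_mem_MAW_iff {R : List (α × ℕ)} (hR : RunList R) {a b c : α} {k : ℕ} (hk : 0 < k)
    (hac : a ≠ c) (hcb : c ≠ b) :
    expandRuns [(a, 1), (c, k), (b, 1)] ∈ MAW (expandRuns R) ↔
      (¬ ∃ x y, [(a, x), (c, k), (b, y)] <:+: R) ∧
        (∃ x, k ≤ x ∧ ∃ y, [(c, x), (b, y)] <:+: R) ∧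
        ∃ x, k ≤ x ∧ ∃ y, [(a, y), (c, x)] <:+: R := by
  have hV : RunList ((a, 1) :: [(c, k)] ++ [(b, 1)]) := by
    simp [runList_cons_cons, runList_singleton, hac, hcb, hk]
  have h1 : RunList ((c, k) :: [] ++ [(b, 1)]) := by
    simp [runList_cons_cons, runList_singleton, hcb, hk]
  have h2 : RunList ((a, 1) :: [] ++ [(c, k)]) := by
    simp [runList_cons_cons, runList_singleton, hac, hk]
  have := unit_mem_MAW_iff hR hV
  have e1 := expandRuns_infix_iff hR h1
  have e2 := expandRuns_infix_iff hR h2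
  simp only [List.cons_append, List.nil_append] at this e1 e2
  rw [this, e1, e2]
  refine and_congr_right fun _ => and_congr ⟨?_, ?_⟩ ⟨?_, ?_⟩
  · rintro ⟨x, y, h1, -, h⟩
    exact ⟨x, h1, y, h⟩
  · rintro ⟨x, h1, y, h⟩
    exact ⟨x, y, h1, hR.pos_of_infix h (x := (b, y)) (by simp), h⟩
  · rintro ⟨x, y, -, h1, h⟩
    exact ⟨y, h1, x, h⟩
  · rintro ⟨x, h1, y, h⟩
    exact ⟨y, x, hR.pos_of_infix h (x := (a, y)) (by simp), h1, h⟩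

/-- The case of at least four runs: one occurrence may have a longer second run, the other one a
longer last but one run. -/
theorem long_mem_MAW_iff {R V : List (α × ℕ)} (hR : RunList R) {a b c d : α} {i l : ℕ}
    (hV : RunList ((a, 1) :: (c, i) :: V ++ [(d, l), (b, 1)])) :
    expandRuns ((a, 1) :: (c, i) :: V ++ [(d, l), (b, 1)]) ∈ MAW (expandRuns R) ↔
      (¬ ∃ x y, (a, x) :: (c, i) :: V ++ [(d, l), (b, y)] <:+: R) ∧
        (∃ x, i ≤ x ∧ ∃ y, (c, x) :: V ++ [(d, l), (b, y)] <:+: R) ∧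
        ∃ y, l ≤ y ∧ ∃ x, (a, x) :: (c, i) :: V ++ [(d, y)] <:+: R := by
  have e (z : α × ℕ) : V ++ [(d, l), z] = V ++ [(d, l)] ++ [z] := by simp
  simp only [List.cons_append, e] at hV ⊢
  have h1 : RunList ((c, i) :: (V ++ [(d, l)]) ++ [(b, 1)]) := hV.tail
  have h2 : RunList ((a, 1) :: ((c, i) :: V) ++ [(d, l)]) :=
    hV.infix (List.IsPrefix.isInfix ⟨[(b, 1)], by simp⟩)
  have := unit_mem_MAW_iff (V := (c, i) :: (V ++ [(d, l)])) hR (by simpa using hV)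
  have e1 := expandRuns_infix_iff hR h1
  have e2 := expandRuns_infix_iff hR h2
  simp only [List.cons_append] at this e1 e2
  rw [this, e1, e2]
  refine and_congr_right fun _ => and_congr ⟨?_, ?_⟩ ⟨?_, ?_⟩
  · rintro ⟨x, y, h1, -, h⟩
    exact ⟨x, h1, y, h⟩
  · rintro ⟨x, h1, y, h⟩
    exact ⟨x, y, h1, hR.pos_of_infix h (x := (b, y)) (by simp), h⟩
  · rintro ⟨x, y, -, h1, h⟩
    exact ⟨y, h1, x, h⟩
  · rintro ⟨x, h1, y, h⟩
    exact ⟨y, x, hR.pos_of_infix h (x := (a, y)) (by simp), h1, h⟩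

end MinimalAbsentWords

/-! ### Counting branching contexts -/

section Counting

/-- Counting along a relation whose fibres over the right-hand side have at most one element. -/
theorem ncard_le_of_rel {X Y : Type*} {A : Set X} {S : Finset Y} (r : X → Y → Prop)
    (h1 : ∀ e ∈ A, ∃ p ∈ S, r e p)
    (h2 : ∀ e ∈ A, ∀ e' ∈ A, ∀ p, r e p → r e' p → e = e') : A.Finite ∧ A.ncard ≤ S.card := by
  rcases A.eq_empty_or_nonempty with rfl | ⟨e0, he0⟩
  · simp
  have : Nonempty Y := ⟨(h1 e0 he0).choose⟩
  choose! g hg1 hg2 using h1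
  have hinj : Set.InjOn g A := fun e he e' he' h =>
    h2 e he e' he' (g e) (hg2 e he) (h ▸ hg2 e' he')
  have hmaps : Set.MapsTo g A (S : Set Y) := fun e he => hg1 e he
  refine ⟨Set.Finite.of_injOn hmaps hinj S.finite_toSet, ?_⟩
  have := Set.ncard_le_ncard_of_injOn g hmaps hinj S.finite_toSet
  rwa [Set.ncard_coe_finset] at this

/-- A tree whose leaves are the elements of `S` is given by the vertex `f t p` that the leaf `p` has
above it at each depth `t`. Its branching edges are those that lead from a vertex with at least two
children to one of these children, and they are named by the depth of the upper end and by the lower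
end. -/
def branchingEdges {X : Type*} (f : ℕ → ℕ → X) (S : Finset ℕ) : Set (ℕ × X) :=
  {e | ∃ p ∈ S, f (e.1 + 1) p = e.2 ∧ ∃ q ∈ S, f e.1 q = f e.1 p ∧ f (e.1 + 1) q ≠ e.2}

/-- A tree with `s` leaves has at most `2 * s` branching edges. An edge to a child that is not the
earliest one of its parent is charged to the first leaf below the child; an edge to the earliest
child is charged to the first leaf below the parent that is not below this child. -/
theorem branchingEdges_ncard_le {X : Type*} (f : ℕ → ℕ → X) (S : Finset ℕ)
    (hf : ∀ t p q, f (t + 1) p = f (t + 1) q → f t p = f t q) :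
    (branchingEdges f S).Finite ∧ (branchingEdges f S).ncard ≤ 2 * S.card := by
  classical
  have hle : ∀ t t' p q, t ≤ t' → f t' p = f t' q → f t p = f t q := by
    intro t t' p q h
    induction t', h using Nat.le_induction with
    | base => exact id
    | succ n _ ih => exact fun h => ih (hf _ _ _ h)
  let E := branchingEdges f S
  let E1 : Set (ℕ × X) := {e ∈ E | ∃ p ∈ S, f (e.1 + 1) p = e.2 ∧
    (∀ q ∈ S, f (e.1 + 1) q = e.2 → p ≤ q) ∧ ∃ q ∈ S, q < p ∧ f e.1 q = f e.1 p}
  let E2 : Set (ℕ × X) := {e ∈ E | ∃ p ∈ S, f (e.1 + 1) p = e.2 ∧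
    (∀ q ∈ S, f e.1 q = f e.1 p → p ≤ q)}
  have hE : E ⊆ E1 ∪ E2 := by
    rintro ⟨t, v⟩ he
    obtain ⟨p, hp, hpv, -⟩ := id he
    have hne : (S.filter fun q => f (t + 1) q = v).Nonempty := ⟨p, by simpa using ⟨hp, hpv⟩⟩
    obtain ⟨p0, hp0, hmin⟩ := Finset.exists_min_image _ id hne
    simp only [Finset.mem_filter, id] at hp0 hmin
    by_cases h : ∃ q ∈ S, q < p0 ∧ f t q = f t p0
    · exact Or.inl ⟨he, p0, hp0.1, hp0.2, fun q hq h => hmin q ⟨hq, h⟩, h⟩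
    · push Not at h
      exact Or.inr ⟨he, p0, hp0.1, hp0.2, fun q hq h' => by
        by_contra hlt; exact h q hq (by omega) h'⟩
  have h1 : E1.Finite ∧ E1.ncard ≤ S.card := by
    refine ncard_le_of_rel (fun e p => f (e.1 + 1) p = e.2 ∧
      (∀ q ∈ S, f (e.1 + 1) q = e.2 → p ≤ q) ∧ ∃ q ∈ S, q < p ∧ f e.1 q = f e.1 p)
      (fun e he => he.2) ?_
    have key : ∀ t v t' p, t < t' → f (t + 1) p = v →
        (∀ q ∈ S, f (t + 1) q = v → p ≤ q) → (∃ q ∈ S, q < p ∧ f t' q = f t' p) → False := by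
      rintro t v t' p htt rfl hmin ⟨q, hq, hlt, hqp⟩
      have := hmin q hq (hle _ _ _ _ htt hqp)
      omega
    rintro ⟨t, v⟩ - ⟨t', v'⟩ - p ⟨a1, a2, a3⟩ ⟨b1, b2, b3⟩
    rcases lt_trichotomy t t' with h | h | h
    · exact (key t v t' p h a1 a2 b3).elim
    · subst h; simp only at a1 b1; rw [← a1, ← b1]
    · exact (key t' v' t p h b1 b2 a3).elim
  have h2 : E2.Finite ∧ E2.ncard ≤ S.card := by
    refine ncard_le_of_rel (fun e p => p ∈ S ∧ ∃ p0 ∈ S, f (e.1 + 1) p0 = e.2 ∧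
      (∀ q ∈ S, f e.1 q = f e.1 p0 → p0 ≤ q) ∧ f e.1 p = f e.1 p0 ∧ f (e.1 + 1) p ≠ e.2 ∧
      ∀ q ∈ S, f e.1 q = f e.1 p0 → f (e.1 + 1) q ≠ e.2 → p ≤ q) ?_ ?_
    · rintro ⟨t, v⟩ ⟨⟨p', hp', hp'v, q', hq', hq'p, hq'v⟩, p, hp, hpv, hmin⟩
      simp only at *
      have hpp' : f t p' = f t p := hf _ _ _ (hp'v.trans hpv.symm)
      have hne : (S.filter fun q => f t q = f t p ∧ f (t + 1) q ≠ v).Nonempty :=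
        ⟨q', by simpa using ⟨hq', hq'p.trans hpp', hq'v⟩⟩
      obtain ⟨p0, hp0, hmin0⟩ := Finset.exists_min_image _ id hne
      simp only [Finset.mem_filter, id] at hp0 hmin0
      exact ⟨p0, hp0.1, hp0.1, p, hp, hpv, hmin, hp0.2.1, hp0.2.2, fun q hq h1 h2 =>
        hmin0 q ⟨hq, h1, h2⟩⟩
    · have key : ∀ t v t' v' p, t < t' → p ∈ S →
          (∃ p0 ∈ S, f (t + 1) p0 = v ∧
            (∀ q ∈ S, f t q = f t p0 → p0 ≤ q) ∧ f t p = f t p0 ∧ f (t + 1) p ≠ v ∧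
            ∀ q ∈ S, f t q = f t p0 → f (t + 1) q ≠ v → p ≤ q) →
          (∃ p0 ∈ S, f (t' + 1) p0 = v' ∧
            (∀ q ∈ S, f t' q = f t' p0 → p0 ≤ q) ∧ f t' p = f t' p0 ∧ f (t' + 1) p ≠ v' ∧
            ∀ q ∈ S, f t' q = f t' p0 → f (t' + 1) q ≠ v' → p ≤ q) → False := by
        rintro t v t' v' p htt hpS ⟨p0, hp0, a1, a2, a3, a4, a5⟩ ⟨p1, hp1, b1, b2, b3, b4, -⟩
        have e1 : f (t + 1) p1 = f (t + 1) p := hle _ _ _ _ htt b3.symm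
        have := a5 p1 hp1 ((hf _ _ _ e1).trans a3) (e1 ▸ a4)
        have := b2 p hpS b3
        obtain rfl : p = p1 := by omega
        exact b4 b1
      rintro ⟨t, v⟩ - ⟨t', v'⟩ - p ⟨hp, a⟩ ⟨-, b⟩
      rcases lt_trichotomy t t' with h | h | h
      · exact (key t v t' v' p h hp a b).elim
      · subst h
        obtain ⟨p0, hp0, a1, a2, a3, -⟩ := a
        obtain ⟨p1, hp1, b1, b2, b3, -⟩ := b
        simp only at *
        have := a2 p1 hp1 (b3.symm.trans a3)
        have := b2 p0 hp0 (a3.symm.trans b3)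
        obtain rfl : p0 = p1 := by omega
        rw [← a1, ← b1]
      · exact (key t' v' t v p h hp b a).elim
  have hcard := Set.ncard_le_ncard hE (h1.1.union h2.1)
  have := Set.ncard_union_le E1 E2
  exact ⟨(h1.1.union h2.1).subset hE, by simp only [E] at hcard; omega⟩

variable {α : Type*}

/-- In the text with the runs `R`, a run of the character `c` is followed by the runs `V`, by the
run `d ^ l`, and then by a run of the character `b` (by the end of the text for `b = none`). -/
def RightItem (R : List (α × ℕ)) (c : α) (V : List (α × ℕ)) (d : α) (l : ℕ) (b : Option α) :
    Prop :=
  ∃ x Z, (c, x) :: V ++ (d, l) :: Z <:+ R ∧ Z.head?.map Prod.fst = b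

/-- The continuations `d ^ l`, `b` of contexts `c`, `V`, `d` that have another continuation in the
text as well. -/
def rightBranching (R : List (α × ℕ)) : Set (α × List (α × ℕ) × α × ℕ × Option α) :=
  {e | RightItem R e.1 e.2.1 e.2.2.1 e.2.2.2.1 e.2.2.2.2 ∧
    ∃ l b, (l, b) ≠ (e.2.2.2.1, e.2.2.2.2) ∧ RightItem R e.1 e.2.1 e.2.2.1 l b}

theorem rightItem_of_infix {R V : List (α × ℕ)} {c d b : α} {x l y : ℕ}
    (h : (c, x) :: V ++ [(d, l), (b, y)] <:+: R) : RightItem R c V d l (some b) := by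
  obtain ⟨s, t, rfl⟩ := h
  exact ⟨x, (b, y) :: t, ⟨s, by simp⟩, rfl⟩

theorem exists_rightItem_of_infix {R V : List (α × ℕ)} {c d : α} {x l : ℕ}
    (h : (c, x) :: V ++ [(d, l)] <:+: R) : ∃ b, RightItem R c V d l b := by
  obtain ⟨s, t, rfl⟩ := h
  exact ⟨_, x, t, ⟨s, by simp⟩, rfl⟩

/-- A continuation `d ^ l`, `b` is branching if some occurrence of the context, extended to the left
by `Y`, is never continued in this way. -/
theorem mem_rightBranching {R V Y : List (α × ℕ)} {c d b : α} {x l y x' y' : ℕ}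
    (h1 : (c, x) :: V ++ [(d, l), (b, y)] <:+: R) (h2 : Y ++ (c, x') :: V ++ [(d, y')] <:+: R)
    (h3 : ∀ z, ¬ Y ++ (c, x') :: V ++ [(d, l), (b, z)] <:+: R) :
    (c, V, d, l, some b) ∈ rightBranching R := by
  obtain ⟨s, t, hst⟩ := h2
  refine ⟨rightItem_of_infix h1, y', t.head?.map Prod.fst, ?_, x', t, ⟨s ++ Y, ?_⟩, rfl⟩
  · intro heq
    simp only [Prod.mk.injEq] at heq
    obtain ⟨rfl, heq⟩ := heq
    cases t with
    | nil => simp at heq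
    | cons z t =>
      obtain ⟨z, y⟩ := z
      obtain rfl : z = b := by simpa using heq
      exact h3 y ⟨s, t, by simpa using hst⟩
  · simpa using hst

/-- The context of depth `t` that starts with the run with index `p`: the character of this run, the
next `t` runs, and the character of the run after these. -/
def contextAt (R : List (α × ℕ)) (t p : ℕ) : Option α × List (α × ℕ) × Option α :=
  ((R.drop p).head?.map Prod.fst, (R.drop p).tail.take t,
    ((R.drop p).tail.drop t).head?.map Prod.fst)

/-- The contexts of increasing depth form a tree whose leaves are the runs of the text. -/
theorem contextAt_refine (R : List (α × ℕ)) (t p q : ℕ)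
    (h : contextAt R (t + 1) p = contextAt R (t + 1) q) : contextAt R t p = contextAt R t q := by
  simp only [contextAt, Prod.mk.injEq] at h ⊢
  obtain ⟨h1, h2, -⟩ := h
  have e (L : List (α × ℕ)) : L.take t = (L.take (t + 1)).take t := by
    rw [List.take_take, min_eq_left (Nat.le_succ t)]
  have e' (L : List (α × ℕ)) : (L.drop t).head? = ((L.take (t + 1)).drop t).head? := by
    simp [List.head?_drop]
  refine ⟨h1, ?_, ?_⟩
  · rw [e, h2, ← e]
  · rw [e', h2, ← e']

theorem RightItem.exists_contextAt {R V : List (α × ℕ)} {c d : α} {l : ℕ} {b : Option α}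
    (h : RightItem R c V d l b) : ∃ p ∈ Finset.range R.length,
      contextAt R V.length p = (some c, V, some d) ∧
      contextAt R (V.length + 1) p = (some c, V ++ [(d, l)], b) := by
  obtain ⟨x, Z, ⟨s, rfl⟩, rfl⟩ := h
  refine ⟨s.length, by simp, ?_⟩
  simp [contextAt, List.drop_append, List.take_append]

/-- Branching continuations are branching edges of the tree of contexts. -/
theorem rightBranching_ncard_le (R : List (α × ℕ)) :
    (rightBranching R).Finite ∧ (rightBranching R).ncard ≤ 2 * R.length := by
  have h := branchingEdges_ncard_le (contextAt R) (Finset.range R.length) (contextAt_refine R)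
  let g : α × List (α × ℕ) × α × ℕ × Option α → ℕ × Option α × List (α × ℕ) × Option α :=
    fun e => (e.2.1.length, some e.1, e.2.1 ++ [(e.2.2.1, e.2.2.2.1)], e.2.2.2.2)
  have hmaps : Set.MapsTo g (rightBranching R)
      (branchingEdges (contextAt R) (Finset.range R.length)) := by
    rintro ⟨c, V, d, l, b⟩ ⟨h1, l', b', hne, h2⟩
    obtain ⟨p, hp, e1, e2⟩ := h1.exists_contextAt
    obtain ⟨q, hq, e3, e4⟩ := h2.exists_contextAt
    refine ⟨p, hp, e2, q, hq, e3.trans e1.symm, ?_⟩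
    simp only [g]
    rw [e4]
    simpa using hne
  have hinj : Set.InjOn g (rightBranching R) := by
    rintro ⟨c, V, d, l, b⟩ - ⟨c', V', d', l', b'⟩ - he
    simp only [g, Prod.mk.injEq, Option.some.injEq] at he
    obtain ⟨-, rfl, h3, rfl⟩ := he
    have := List.append_inj' h3 rfl
    simp only [List.cons.injEq, Prod.mk.injEq, and_true] at this
    obtain ⟨rfl, rfl, rfl⟩ := this
    rfl
  refine ⟨Set.Finite.of_injOn hmaps hinj h.1, ?_⟩
  have h2 := Set.ncard_le_ncard_of_injOn g hmaps hinj h.1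
  simpa using h2.trans h.2

end Counting

/-! ### Minimal absent words with a long first or last run -/

section LongEnds

variable {α : Type*}

/-- The minimal absent words that are powers `a ^ k` with `k ≥ 2`. -/
def powerMAW (R : List (α × ℕ)) : Set (List α) :=
  {w | w ∈ MAW (expandRuns R) ∧ ∃ a k, 2 ≤ k ∧ w = List.replicate k a}

/-- The minimal absent words with at least two runs whose first and last run have exponents
satisfying `p`. -/
def endsMAW (R : List (α × ℕ)) (p : ℕ → ℕ → Prop) : Set (List α) :=
  {w | w ∈ MAW (expandRuns R) ∧ ∃ a i V b l, RunList ((a, i) :: V ++ [(b, l)]) ∧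
    w = expandRuns ((a, i) :: V ++ [(b, l)]) ∧ p i l}

/-- The exponent of a long first run is determined by the rest. -/
theorem first_exp_unique {R V : List (α × ℕ)} (hR : RunList R) {a b : α} {i i' l : ℕ}
    (hV : RunList ((a, i) :: V ++ [(b, l)])) (hV' : RunList ((a, i') :: V ++ [(b, l)]))
    (h : expandRuns ((a, i) :: V ++ [(b, l)]) ∈ MAW (expandRuns R))
    (h' : expandRuns ((a, i') :: V ++ [(b, l)]) ∈ MAW (expandRuns R))
    (hi : 2 ≤ i) (hi' : 2 ≤ i') : i = i' := by
  obtain ⟨x, y, hx, hy, hxy⟩ := tail_infix_of_mem_MAW hR hV h hi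
  obtain ⟨x', y', hx', hy', hxy'⟩ := tail_infix_of_mem_MAW hR hV' h' hi'
  rcases lt_trichotomy i i' with hlt | heq | hlt
  · exact (not_infix_of_mem_MAW hR hV h (by omega) hy' hxy').elim
  · exact heq
  · exact (not_infix_of_mem_MAW hR hV' h' (by omega) hy hxy).elim

/-- A power `a ^ k` is charged to a longest run of `a`, which has the exponent `k - 1`. -/
theorem powerMAW_ncard_le {R : List (α × ℕ)} (hR : RunList R) :
    (powerMAW R).Finite ∧ (powerMAW R).ncard ≤ R.length := by
  have := ncard_le_of_rel (A := powerMAW R) (S := Finset.range R.length)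
    (fun w p => ∃ a k, 2 ≤ k ∧ w = List.replicate k a ∧ R[p]? = some (a, k - 1)) ?_ ?_
  · simpa using this
  · rintro w ⟨hw, a, k, hk, rfl⟩
    obtain ⟨h1, h2⟩ := (replicate_mem_MAW_iff hR (by omega)).1 hw
    obtain ⟨x, hx, hmem⟩ := h2 hk
    obtain rfl : x = k - 1 := by
      by_contra hne
      exact h1 ⟨x, by omega, hmem⟩
    obtain ⟨p, hp, hpx⟩ := List.getElem_of_mem hmem
    exact ⟨p, by simpa using hp, a, k, hk, rfl, by rw [List.getElem?_eq_getElem hp, hpx]⟩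
  · rintro _ - _ - p ⟨a, k, hk, rfl, h⟩ ⟨a', k', hk', rfl, h'⟩
    rw [h, Option.some.injEq, Prod.mk.injEq] at h'
    obtain ⟨rfl, h'⟩ := h'
    obtain rfl : k = k' := by omega
    rfl

/-- If both outer runs are long, then `V b ^ (l - 1)` is a branching context: one occurrence ends
with a run of exactly `l - 1` letters `b`, another one with at least `l`. -/
theorem bothLong_ncard_le {R : List (α × ℕ)} (hR : RunList R) :
    (endsMAW R fun i l => 2 ≤ i ∧ 2 ≤ l).Finite ∧
      (endsMAW R fun i l => 2 ≤ i ∧ 2 ≤ l).ncard ≤ 2 * R.length := by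
  obtain ⟨hfin, hcard⟩ := rightBranching_ncard_le R
  have := ncard_le_of_rel (A := endsMAW R fun i l => 2 ≤ i ∧ 2 ≤ l) (S := hfin.toFinset)
    (fun w e => ∃ i, 2 ≤ i ∧ 1 ≤ e.2.2.2.1 ∧
      RunList ((e.1, i) :: e.2.1 ++ [(e.2.2.1, e.2.2.2.1 + 1)]) ∧
      w = expandRuns ((e.1, i) :: e.2.1 ++ [(e.2.2.1, e.2.2.2.1 + 1)])) ?_ ?_
  · refine ⟨this.1, this.2.trans ?_⟩
    rwa [← Set.ncard_eq_toFinset_card _ hfin]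
  · rintro w ⟨hw, a, i, V, b, l, hV, rfl, hi, hl⟩
    obtain ⟨l, rfl⟩ := Nat.exists_eq_add_of_le' (show 1 ≤ l by omega)
    obtain ⟨x, y, hx, hy, hxy⟩ := tail_infix_of_mem_MAW hR hV hw hi
    obtain ⟨x', y', hx', hy', hxy'⟩ := dropLast_infix_of_mem_MAW hR hV hw hl
    obtain rfl : y' = l := by
      by_contra hne
      exact not_infix_of_mem_MAW hR hV hw hx' (by omega) hxy'
    obtain ⟨c, hc⟩ := exists_rightItem_of_infix hxy
    obtain ⟨c', hc'⟩ := exists_rightItem_of_infix hxy'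
    refine ⟨(a, V, b, y', c'), ?_, i, hi, by simp only; omega, hV, rfl⟩
    rw [Set.Finite.mem_toFinset]
    exact ⟨hc', y, c, by simp; omega, hc⟩
  · rintro w hw w' hw' ⟨a, V, b, l, c⟩ ⟨i, hi, -, hV, rfl⟩ ⟨i', hi', -, hV', rfl⟩
    obtain rfl := first_exp_unique hR hV hV' hw.1 hw'.1 hi hi'
    rfl

/-- If only the first run is long, then what precedes the last character is a branching context,
unless the word has two runs only. -/
theorem firstLong_ncard_le {R : List (α × ℕ)} (hR : RunList R) :
    (endsMAW R fun i l => 2 ≤ i ∧ l = 1).Finite ∧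
      (endsMAW R fun i l => 2 ≤ i ∧ l = 1).ncard ≤ 3 * R.length := by
  obtain ⟨hfin, hcard⟩ := rightBranching_ncard_le R
  have := ncard_le_of_rel (A := endsMAW R fun i l => 2 ≤ i ∧ l = 1)
    (S := (Finset.range R.length).disjSum hfin.toFinset)
    (fun w e => ∃ a i V b, 2 ≤ i ∧ RunList ((a, i) :: V ++ [(b, 1)]) ∧
      w = expandRuns ((a, i) :: V ++ [(b, 1)]) ∧
      match e with
      | .inl p => V = [] ∧ R[p]?.map Prod.fst = some a ∧ R[p + 1]?.map Prod.fst = some b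
      | .inr e => e.1 = a ∧ V = e.2.1 ++ [(e.2.2.1, e.2.2.2.1)] ∧ e.2.2.2.2 = some b) ?_ ?_
  · refine ⟨this.1, this.2.trans ?_⟩
    rw [Finset.card_disjSum, Finset.card_range, ← Set.ncard_eq_toFinset_card _ hfin]
    omega
  · rintro w ⟨hw, a, i, V, b, l, hV, rfl, hi, rfl⟩
    obtain ⟨x, y, hx, hy, hxy⟩ := tail_infix_of_mem_MAW hR hV hw hi
    rcases V.eq_nil_or_concat with rfl | ⟨V, ⟨d, e⟩, rfl⟩
    · obtain ⟨s, t, hst⟩ := hxy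
      refine ⟨.inl s.length, ?_, a, i, [], b, hi, hV, rfl, rfl, ?_, ?_⟩
      · simp [← hst]
      · simp [← hst]
      · simp [← hst]
    · rw [List.concat_eq_append] at *
      refine ⟨.inr (a, V, d, e, some b), ?_, a, i, _, b, hi, hV, rfl, rfl, rfl, rfl⟩
      rw [Finset.inr_mem_disjSum, Set.Finite.mem_toFinset]
      have h1 := ((mem_MAW_iff hw.1).1 hw).2.2
      have h2 : RunList ((a, i) :: V ++ [(d, e)]) :=
        hV.infix (List.IsPrefix.isInfix ⟨[(b, 1)], by simp⟩)
      rw [dropLast_expandRuns_one] at h1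
      obtain ⟨x', y', hx', hy', hxy'⟩ := (expandRuns_infix_iff hR h2).1 h1
      refine mem_rightBranching (Y := []) (x := x) (y := y) (by simpa using hxy) hxy'
        fun z hz => ?_
      have hz' : (a, x') :: (V ++ [(d, e)]) ++ [(b, z)] <:+: R := by simpa using hz
      exact not_infix_of_mem_MAW hR hV hw hx' (hR.pos_of_infix hz' (x := (b, z)) (by simp)) hz'
  · rintro w hw w' hw' e ⟨a, i, V, b, hi, hV, rfl, h⟩ ⟨a', i', V', b', hi', hV', rfl, h'⟩
    have : a = a' ∧ V = V' ∧ b = b' := by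
      cases e with
      | inl p =>
        obtain ⟨rfl, h1, h2⟩ := h
        obtain ⟨rfl, h3, h4⟩ := h'
        rw [h1] at h3
        rw [h2] at h4
        exact ⟨by simpa using h3, rfl, by simpa using h4⟩
      | inr e =>
        obtain ⟨rfl, rfl, h2⟩ := h
        obtain ⟨rfl, rfl, h4⟩ := h'
        rw [h2] at h4
        exact ⟨rfl, rfl, by simpa using h4⟩
    obtain ⟨rfl, rfl, rfl⟩ := this
    obtain rfl := first_exp_unique hR hV hV' hw.1 hw'.1 hi hi'
    rfl

/-- The mirror image of `firstLong_ncard_le`. -/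
theorem lastLong_ncard_le {R : List (α × ℕ)} (hR : RunList R) :
    (endsMAW R fun i l => i = 1 ∧ 2 ≤ l).Finite ∧
      (endsMAW R fun i l => i = 1 ∧ 2 ≤ l).ncard ≤ 3 * R.length := by
  obtain ⟨h1, h2⟩ := firstLong_ncard_le hR.reverse
  have hmaps : Set.MapsTo List.reverse (endsMAW R fun i l => i = 1 ∧ 2 ≤ l)
      (endsMAW R.reverse fun i l => 2 ≤ i ∧ l = 1) := by
    rintro w ⟨hw, a, i, V, b, l, hV, rfl, hi, hl⟩
    refine ⟨?_, b, l, V.reverse, a, i, ?_, ?_, hl, hi⟩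
    · rw [expandRuns_reverse]; exact reverse_mem_MAW hw
    · simpa using hV.reverse
    · rw [← expandRuns_reverse]; simp
  have hinj : Set.InjOn List.reverse (endsMAW R fun i l => i = 1 ∧ 2 ≤ l) :=
    List.reverse_injective.injOn
  refine ⟨Set.Finite.of_injOn hmaps hinj h1, ?_⟩
  have := Set.ncard_le_ncard_of_injOn _ hmaps hinj h1
  rw [List.length_reverse] at h2
  omega

/-- The minimal absent words whose first or last run has an exponent of at least `2`. -/
def longEndMAW (R : List (α × ℕ)) : Set (List α) :=
  powerMAW R ∪ endsMAW R fun i l => 2 ≤ i ∨ 2 ≤ l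

theorem longEndMAW_ncard_le {R : List (α × ℕ)} (hR : RunList R) :
    (longEndMAW R).Finite ∧ (longEndMAW R).ncard ≤ 9 * R.length := by
  have hsub : longEndMAW R ⊆ (powerMAW R ∪ endsMAW R fun i l => 2 ≤ i ∧ 2 ≤ l) ∪
      ((endsMAW R fun i l => 2 ≤ i ∧ l = 1) ∪ endsMAW R fun i l => i = 1 ∧ 2 ≤ l) := by
    rintro w (hw | ⟨hw, a, i, V, b, l, hV, rfl, h⟩)
    · exact Or.inl (Or.inl hw)
    · have hi : 0 < i := hV.head_pos
      have hl : 0 < l := hV.1 (b, l) (by simp)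
      by_cases h1 : 2 ≤ i
      · by_cases h2 : 2 ≤ l
        · exact Or.inl (Or.inr ⟨hw, a, i, V, b, l, hV, rfl, h1, h2⟩)
        · exact Or.inr (Or.inl ⟨hw, a, i, V, b, l, hV, rfl, h1, by omega⟩)
      · exact Or.inr (Or.inr ⟨hw, a, i, V, b, l, hV, rfl, by omega, by omega⟩)
  have h1 := powerMAW_ncard_le hR
  have h2 := bothLong_ncard_le hR
  have h3 := firstLong_ncard_le hR
  have h4 := lastLong_ncard_le hR
  have hfin := (h1.1.union h2.1).union (h3.1.union h4.1)
  refine ⟨hfin.subset hsub, ?_⟩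
  have := Set.ncard_le_ncard hsub hfin
  have := Set.ncard_union_le (powerMAW R ∪ endsMAW R fun i l => 2 ≤ i ∧ 2 ≤ l)
    ((endsMAW R fun i l => 2 ≤ i ∧ l = 1) ∪ endsMAW R fun i l => i = 1 ∧ 2 ≤ l)
  have := Set.ncard_union_le (powerMAW R) (endsMAW R fun i l => 2 ≤ i ∧ 2 ≤ l)
  have := Set.ncard_union_le (endsMAW R fun i l => 2 ≤ i ∧ l = 1)
    (endsMAW R fun i l => i = 1 ∧ 2 ≤ l)
  omega

end LongEnds

/-! ### The query program -/

/-- A record instructs the query program to store `val` in the working memory cell `dst`, and then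
to report `cnt` descriptors while walking through a linked list. Its items are addressed by `x`,
and every item is visited with the exponents `i` from `lo` up to the smaller one of `hi` and a bound
stored with the item. The remaining fields are parts of the descriptors. -/
structure Record where
  dst : ℕ
  val : ℕ
  a : ℕ
  t : ℕ
  k : ℕ
  r : ℕ
  l : ℕ
  lo : ℕ
  hi : ℕ
  x : ℕ
  i : ℕ
  cnt : ℕ

namespace Record

/-- The twelve words of a record. -/
def words (ρ : Record) : List ℕ :=
  [ρ.dst, ρ.val, ρ.a, ρ.t, ρ.k, ρ.r, ρ.l, ρ.lo, ρ.hi, ρ.x, ρ.i, ρ.cnt]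

/-- The step from one position (item and exponent) of the walk to the next one. An item at address
`x` consists of the words `D[x]`, an index into the run-length encoding, and `D[x + 1]`, the bound
for the exponents; the next item is found in the cell `x` of the working memory. Arithmetic is
modulo `M`. -/
def step (M : ℕ) (D mem : List ℕ) (ρ : Record) (s : ℕ × ℕ) : ℕ × ℕ :=
  if s.2 < ρ.hi ∧ s.2 < D.getD ((s.1 + 1) % M) 0 then (s.1, (s.2 + 1) % M)
  else (mem.getD s.1 0, ρ.lo)

/-- The six words that are reported at a position of the walk. -/
def report (M : ℕ) (D : List ℕ) (ρ : Record) (s : ℕ × ℕ) : List ℕ :=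
  [(ρ.a + (s.2 - ρ.t)) % M, ρ.k, D.getD s.1 0, ρ.r, s.2, ρ.l]

end Record

/-- The working memory after processing some records. -/
def memAfter (recs : List Record) (mem : List ℕ) : List ℕ :=
  recs.foldl (fun m ρ => m.set ρ.dst ρ.val) mem

/-- The output of processing some records. -/
def outputOf (M : ℕ) (D : List ℕ) : List ℕ → List Record → List ℕ
  | _, [] => []
  | mem, ρ :: recs =>
    (List.iterate (ρ.step M D (mem.set ρ.dst ρ.val)) (ρ.x, ρ.i) ρ.cnt).flatMap (ρ.report M D) ++
      outputOf M D (mem.set ρ.dst ρ.val) recs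

theorem outputOf_append (M : ℕ) (D : List ℕ) (R S : List Record) (mem : List ℕ) :
    outputOf M D mem (R ++ S) = outputOf M D mem R ++ outputOf M D (memAfter R mem) S := by
  induction R generalizing mem with
  | nil => rfl
  | cons ρ R ih => simp [outputOf, memAfter, ih]

@[simp] theorem length_memAfter (R : List Record) (mem : List ℕ) :
    (memAfter R mem).length = mem.length := by
  induction R generalizing mem with
  | nil => rfl
  | cons ρ R ih => simpa [memAfter] using ih (mem.set ρ.dst ρ.val)

/-- The counters of the records can be read off from the length of the output. -/
theorem length_outputOf (M : ℕ) (D : List ℕ) (R : List Record) (mem : List ℕ) :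
    (outputOf M D mem R).length = 6 * (R.map Record.cnt).sum := by
  induction R generalizing mem with
  | nil => rfl
  | cons ρ R ih =>
    simp only [outputOf, List.length_append, ih, List.map_cons, List.sum_cons,
      List.length_flatMap]
    have : List.map (fun s => (ρ.report M D s).length) (List.iterate
        (ρ.step M D (mem.set ρ.dst ρ.val)) (ρ.x, ρ.i) ρ.cnt) = List.replicate ρ.cnt 6 := by
      rw [List.eq_replicate_iff]
      simp [Record.report]
    rw [this]
    simp
    ring

namespace WordRAM

/-- The field with index `j` of the record that register `0` points to. -/
def field (j : ℕ) : Expr := .data (.add (.reg 0) (.const j))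

/-- One round of the walk: register `2` counts the remaining reports, registers `3` and `4` hold the
position. -/
def walkBody : Prog :=
  .seq (.emit (.add (field 2) (.sub (.reg 4) (field 3)))) <|
  .seq (.emit (field 4)) <|
  .seq (.emit (.data (.reg 3))) <|
  .seq (.emit (field 5)) <|
  .seq (.emit (.reg 4)) <|
  .seq (.emit (field 6)) <|
  .seq (.assign 2 (.sub (.reg 2) (.const 1))) <|
  .ite (.lt (.reg 4) (field 8))
    (.ite (.lt (.reg 4) (.data (.add (.reg 3) (.const 1))))
      (.assign 4 (.add (.reg 4) (.const 1)))
      (.seq (.assign 3 (.work (.reg 3))) (.assign 4 (field 7))))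
    (.seq (.assign 3 (.work (.reg 3))) (.assign 4 (field 7)))

/-- Processing one record. -/
def recordBody : Prog :=
  .seq (.store (field 0) (field 1)) <|
  .seq (.assign 2 (field 11)) <|
  .seq (.assign 3 (field 9)) <|
  .seq (.assign 4 (field 10)) <|
  .seq (.loop (.reg 2) walkBody) <|
  .assign 0 (.add (.reg 0) (.const 12))

/-- The query program. The run-length encoding is followed in the data structure by the addresses
of the beginning and of the end of the list of records. -/
def queryProg : Prog :=
  .seq (.assign 2 (.add (.add (.data (.const 0)) (.data (.const 0))) (.const 1))) <|
  .seq (.assign 0 (.data (.reg 2))) <|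
  .seq (.assign 1 (.data (.add (.reg 2) (.const 1)))) <|
  .loop (.lt (.reg 0) (.reg 1)) recordBody

variable {w : ℕ} {D : List ℕ}

/-- The record `ρ` is stored at the address `p`. -/
def RecordAt (D : List ℕ) (p : ℕ) (ρ : Record) : Prop := ρ.words <+: D.drop p

theorem RecordAt.getD {p : ℕ} {ρ : Record} (h : RecordAt D p ρ) {j : ℕ} (hj : j < 12) :
    D.getD (p + j) 0 = ρ.words.getD j 0 := by
  obtain ⟨t, ht⟩ := h
  have h1 : (D.drop p).getD j 0 = D.getD (p + j) 0 := by
    simp [List.getD_eq_getElem?_getD, List.getElem?_drop]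
  rw [← h1, ← ht, List.getD_append _ _ _ _ (by simpa [Record.words] using hj)]

theorem eval_field {p : ℕ} {ρ : Record} (h : RecordAt D p ρ) (hp : p + 12 < 2 ^ w) {s : State}
    (hs : s.reg 0 = p) {j : ℕ} (hj : j < 12) :
    (field j).eval w D s = ρ.words.getD j 0 := by
  rw [← h.getD hj]
  simp only [field, Expr.eval, hs]
  rw [Nat.mod_eq_of_lt (a := j) (by omega), Nat.mod_eq_of_lt (by omega)]

theorem exec_walkBody {p : ℕ} {ρ : Record} (h : RecordAt D p ρ) (hp : p + 12 < 2 ^ w)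
    {s : State} (hs : s.reg 0 = p) :
    ∃ t s', Exec w D walkBody s t s' ∧ t ≤ 70 ∧ s'.mem = s.mem ∧ s'.reg 0 = p ∧
      s'.reg 1 = s.reg 1 ∧ s'.reg 2 = s.reg 2 - 1 ∧
      (s'.reg 3, s'.reg 4) = ρ.step (2 ^ w) D s.mem (s.reg 3, s.reg 4) ∧
      s'.out = s.out ++ ρ.report (2 ^ w) D (s.reg 3, s.reg 4) := by
  have e (s : State) (hs : s.reg 0 = p) (j : ℕ) (hj : j < 12) :
    (field j).eval w D s = ρ.words.getD j 0 := eval_field h hp hs hj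
  have h1 : 1 % 2 ^ w = 1 := Nat.mod_eq_of_lt (by omega)
  have c : ∀ j, (field j).cost = 4 := fun _ => rfl
  obtain ⟨reg, mem, out⟩ := s
  simp only at hs
  let s1 : State := ⟨Function.update reg 2 (reg 2 - 1), mem,
    out ++ ρ.report (2 ^ w) D (reg 3, reg 4)⟩
  have hs1 : s1.reg 0 = p := by simp [s1, hs]
  have pre : ∀ {t s'}, Exec w D (.ite (.lt (.reg 4) (field 8))
      (.ite (.lt (.reg 4) (.data (.add (.reg 3) (.const 1))))
        (.assign 4 (.add (.reg 4) (.const 1)))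
        (.seq (.assign 3 (.work (.reg 3))) (.assign 4 (field 7))))
      (.seq (.assign 3 (.work (.reg 3))) (.assign 4 (field 7)))) s1 t s' →
      Exec w D walkBody ⟨reg, mem, out⟩ (12 + (5 + (3 + (5 + (2 + (5 + (4 + t))))))) s' := by
    intro t s' ht
    refine .seq (.emit _ _) (.seq (.emit _ _) (.seq (.emit _ _) (.seq (.emit _ _)
      (.seq (.emit _ _) (.seq (.emit _ _) (.seq (.assign _ _ _) ?_))))))
    convert ht using 1
    simp [e, hs, s1, Expr.eval, Record.report, Record.words, h1]
  by_cases hc1 : reg 4 < ρ.hi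
  · by_cases hc2 : reg 4 < D.getD ((reg 3 + 1) % 2 ^ w) 0
    · refine ⟨_, _, pre (.ite_true ?_ (.ite_true ?_ (.assign _ _ _))), ?_, ?_⟩
      · simp [Expr.eval, e _ hs1, s1, Record.words, hc1, h1]
      · simp [Expr.eval, s1, h1] at hc2 ⊢; exact hc2
      · simp [Expr.cost, c]
      · simp [Expr.eval, s1, Record.step, hc1, hs, h1] at hc2 ⊢; simp [hc2]
    · refine ⟨_, _, pre (.ite_true ?_ (.ite_false ?_ (.seq (.assign _ _ _) (.assign _ _ _)))),
        ?_, ?_⟩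
      · simp [Expr.eval, e _ hs1, s1, Record.words, hc1, h1]
      · simp [Expr.eval, s1, h1] at hc2 ⊢; exact hc2
      · simp [Expr.cost, c]
      · rw [e _ (by simpa [s1] using hs) 7 (by norm_num)]
        simp [Expr.eval, s1, Record.step, Record.words, hc1, hs] at hc2 ⊢
        intro hlt; omega
  · refine ⟨_, _, pre (.ite_false ?_ (.seq (.assign _ _ _) (.assign _ _ _))), ?_, ?_⟩
    · simp [Expr.eval, e _ hs1, s1, Record.words]; omega
    · simp [Expr.cost, c]
    · rw [e _ (by simpa [s1] using hs) 7 (by norm_num)]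
      simp [Expr.eval, s1, Record.step, Record.words, hc1, hs]

theorem exec_walk {p : ℕ} {ρ : Record} (h : RecordAt D p ρ) (hp : p + 12 < 2 ^ w) (n : ℕ)
    {s : State} (hs : s.reg 0 = p) (hn : s.reg 2 = n) :
    ∃ t s', Exec w D (.loop (.reg 2) walkBody) s t s' ∧ t ≤ 72 * n + 2 ∧ s'.mem = s.mem ∧
      s'.reg 0 = p ∧ s'.reg 1 = s.reg 1 ∧
      s'.out = s.out ++ (List.iterate (ρ.step (2 ^ w) D s.mem) (s.reg 3, s.reg 4) n).flatMap
        (ρ.report (2 ^ w) D) := by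
  induction n generalizing s with
  | zero => exact ⟨_, s, .loop_done (by simpa [Expr.eval] using hn), by simp [Expr.cost], rfl, hs,
      rfl, by simp⟩
  | succ n ih =>
    obtain ⟨t, s1, h1, h2, h3, h4, h5, h6, h7, h8⟩ := exec_walkBody h hp hs
    obtain ⟨t', s2, g1, g2, g3, g4, g5, g6⟩ := ih h4 (by omega)
    refine ⟨_, s2, .loop_step (by simp [Expr.eval, hn]) h1 g1, ?_, g3.trans h3, g4, g5.trans h5, ?_⟩
    · simp only [Expr.cost]; omega
    · rw [g6, h3, h7, h8]
      simp [List.iterate]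

theorem exec_recordBody {p : ℕ} {ρ : Record} (h : RecordAt D p ρ) (hp : p + 12 < 2 ^ w)
    {s : State} (hs : s.reg 0 = p) :
    ∃ t s', Exec w D recordBody s t s' ∧ t ≤ 72 * ρ.cnt + 30 ∧
      s'.mem = s.mem.set ρ.dst ρ.val ∧ s'.reg 0 = p + 12 ∧ s'.reg 1 = s.reg 1 ∧
      s'.out = s.out ++ (List.iterate (ρ.step (2 ^ w) D s'.mem) (ρ.x, ρ.i) ρ.cnt).flatMap
        (ρ.report (2 ^ w) D) := by
  have e (s : State) (hs : s.reg 0 = p) (j : ℕ) (hj : j < 12) :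
    (field j).eval w D s = ρ.words.getD j 0 := eval_field h hp hs hj
  have c : ∀ j, (field j).cost = 4 := fun _ => rfl
  let s1 : State := ⟨Function.update (Function.update (Function.update s.reg 2 ρ.cnt) 3 ρ.x) 4 ρ.i,
    s.mem.set ρ.dst ρ.val, s.out⟩
  obtain ⟨t, s2, h1, h2, h3, h4, h5, h6⟩ := exec_walk h hp ρ.cnt (s := s1) (by simpa [s1] using hs)
    (by simp [s1])
  have pre : Exec w D recordBody s (9 + (5 + (5 + (5 + (t + 4)))))
      { s2 with reg := Function.update s2.reg 0 (p + 12) } := by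
    refine .seq (.store _ _ _) (.seq (.assign _ _ _) (.seq (.assign _ _ _) (.seq (.assign _ _ _)
      (.seq (s' := s2) ?_ ?_))))
    · convert h1 using 1
      simp [e, hs, s1, Record.words]
    · have h12 := Exec.assign (w := w) (D := D) 0 (.add (.reg 0) (.const 12)) s2
      have ev : (Expr.add (.reg 0) (.const 12)).eval w D s2 = p + 12 := by
        simp only [Expr.eval, h4]
        rw [Nat.mod_eq_of_lt (a := 12) (by omega), Nat.mod_eq_of_lt (by omega)]
      rwa [ev] at h12
  refine ⟨_, _, pre, by omega, h3, by simp, ?_, ?_⟩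
  · simpa [s1] using h5
  · rw [h3]
    simpa [s1] using h6

theorem exec_records (recs : List Record) {p : ℕ} (hD : recs.flatMap Record.words <+: D.drop p)
    (hp : p + 12 * recs.length + 12 < 2 ^ w) {s : State} (h0 : s.reg 0 = p)
    (h1 : s.reg 1 = p + 12 * recs.length) :
    ∃ t s', Exec w D (.loop (.lt (.reg 0) (.reg 1)) recordBody) s t s' ∧
      t ≤ 72 * (recs.map Record.cnt).sum + 34 * recs.length + 4 ∧
      s'.out = s.out ++ outputOf (2 ^ w) D s.mem recs := by
  induction recs generalizing p s with
  | nil =>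
    refine ⟨_, s, .loop_done ?_, by simp [Expr.cost], by simp [outputOf]⟩
    simp at h1
    simp [Expr.eval, h0, h1]
  | cons ρ recs ih =>
    rw [List.flatMap_cons] at hD
    simp only [List.length_cons] at hp h1
    have hρ : RecordAt D p ρ := (List.prefix_append _ _).trans hD
    obtain ⟨t, s1, g1, g2, g3, g4, g5, g6⟩ := exec_recordBody (w := w) hρ (by omega) h0
    have hD' : recs.flatMap Record.words <+: D.drop (p + 12) := by
      obtain ⟨u, hu⟩ := hD
      refine ⟨u, ?_⟩
      rw [← List.drop_drop, ← hu, List.append_assoc, List.drop_left' (by simp [Record.words])]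
    obtain ⟨t', s2, k1, k2, k3⟩ := ih (p := p + 12) hD' (by omega) g4 (by rw [g5, h1]; ring)
    refine ⟨_, s2, .loop_step ?_ g1 k1, ?_, ?_⟩
    · have : 1 % 2 ^ w = 1 := Nat.mod_eq_of_lt (by omega)
      have hlt : p < p + 12 * (recs.length + 1) := by omega
      simp [Expr.eval, h0, h1, this]
    · simp only [Expr.cost, List.map_cons, List.sum_cons, List.length_cons]
      omega
    · rw [k3, g6, outputOf, g3, List.append_assoc]

/-- What the query program does on a data structure that consists of a list preceded by its length,
of the addresses of the beginning and the end of a list of records, of some further words, and of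
the records. -/
theorem exec_queryProg (body : List ℕ) (m : ℕ) (hbody : body.length = 2 * m) (items : List ℕ)
    (recs : List Record) (mem : List ℕ) (p : ℕ) (hp : p = 2 * m + 3 + items.length)
    (hw : p + 12 * recs.length + 12 < 2 ^ w) :
    let D := (m :: body) ++ [p, p + 12 * recs.length] ++ items ++ recs.flatMap Record.words
    ∃ t s', Exec w D queryProg (State.init mem) t s' ∧
      t ≤ 72 * (recs.map Record.cnt).sum + 34 * recs.length + 30 ∧
      s'.out = outputOf (2 ^ w) D mem recs := by
  intro D
  have h0 : D.getD 0 0 = m := by simp [D]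
  have h1 : D.getD (2 * m + 1) 0 = p := by
    simp [D, List.getD_eq_getElem?_getD, hbody]
  have h2 : D.getD (2 * m + 2) 0 = p + 12 * recs.length := by
    simp [D, List.getD_eq_getElem?_getD, hbody]
  have hD : recs.flatMap Record.words <+: D.drop p := by
    rw [List.drop_left' (by simp [hbody]; omega)]
  let s1 : State := ⟨Function.update (Function.update (Function.update (fun _ => 0) 2 (2 * m + 1))
    0 p) 1 (p + 12 * recs.length), mem, []⟩
  obtain ⟨t, s', g1, g2, g3⟩ := exec_records (s := s1) recs hD hw (by simp [s1]) (by simp [s1])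
  refine ⟨_, s', .seq (.assign _ _ _) (.seq (.assign _ _ _) (.seq (.assign _ _ _)
    (t' := t) ?_)), ?_, g3⟩
  · convert g1 using 1
    have e0 : 0 % 2 ^ w = 0 := Nat.zero_mod _
    have e1 : 1 % 2 ^ w = 1 := Nat.mod_eq_of_lt (by omega)
    have e2 : (m + m) % 2 ^ w = 2 * m := by rw [Nat.mod_eq_of_lt (by omega)]; omega
    have e3 : (2 * m + 1) % 2 ^ w = 2 * m + 1 := Nat.mod_eq_of_lt (by omega)
    have e4 : (2 * m + 1 + 1) % 2 ^ w = 2 * m + 2 := Nat.mod_eq_of_lt (by omega)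
    simp [Expr.eval, State.init, s1, e0, e1, e2, e3, e4, h0, h1, h2, -List.getD_eq_getElem?_getD]
  · simp only [Expr.cost]
    omega

end WordRAM

/-! ### Linked lists in the working memory -/

section LinkedLists

/-- The working memory holds, in the cell of every address in the list `c` but the last, the next
address in `c`. -/
def Linked (mem c : List ℕ) : Prop := c.IsChain fun x y => mem.getD x 0 = y

/-- Performing a sequence of writes. -/
def applyWrites (ws : List (ℕ × ℕ)) (mem : List ℕ) : List ℕ :=
  ws.foldl (fun m p => m.set p.1 p.2) mem

@[simp] theorem length_applyWrites (ws : List (ℕ × ℕ)) (mem : List ℕ) :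
    (applyWrites ws mem).length = mem.length := by
  induction ws generalizing mem with
  | nil => rfl
  | cons p ws ih => simpa [applyWrites] using ih (mem.set p.1 p.2)

theorem getD_set_of_ne {mem : List ℕ} {x y v : ℕ} (h : x ≠ y) :
    (mem.set x v).getD y 0 = mem.getD y 0 := by
  simp [List.getD_eq_getElem?_getD, List.getElem?_set_ne h]

theorem getD_set_self {mem : List ℕ} {x v : ℕ} (h : x < mem.length) :
    (mem.set x v).getD x 0 = v := by
  simp [List.getD_eq_getElem?_getD, h]

theorem getD_applyWrites {ws : List (ℕ × ℕ)} {mem : List ℕ} {y : ℕ} (h : ∀ p ∈ ws, p.1 ≠ y) :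
    (applyWrites ws mem).getD y 0 = mem.getD y 0 := by
  induction ws generalizing mem with
  | nil => rfl
  | cons p ws ih =>
    rw [List.forall_mem_cons] at h
    exact (ih h.2).trans (getD_set_of_ne h.1)

theorem Linked.set {mem c : List ℕ} (h : Linked mem c) {x v : ℕ} (hx : x ∉ c) :
    Linked (mem.set x v) c := by
  refine List.IsChain.imp_of_mem_imp (fun y z hy _ hyz => ?_) h
  rw [getD_set_of_ne (by rintro rfl; exact hx hy), hyz]

/-- Turning a linked list into a longer one takes at most two writes per new element, which are
independent of the contents of the memory. -/
theorem exists_writes {c c' : List ℕ} (h : c.Sublist c') (hnd : c'.Nodup) (N : ℕ)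
    (hN : ∀ x ∈ c', x < N) : ∃ ws : List (ℕ × ℕ), ws.length + 2 * c.length ≤ 2 * c'.length ∧
      (∀ p ∈ ws, p.1 ∈ c' ∧ p.2 ∈ c') ∧
      ∀ mem : List ℕ, N ≤ mem.length → Linked mem c → Linked (applyWrites ws mem) c' := by
  -- The bound is sharpened by one if the head changes, which pays for relinking a predecessor.
  suffices H : ∃ ws : List (ℕ × ℕ),
      ws.length + 2 * c.length + (if c.head? = c'.head? then 0 else 1) ≤ 2 * c'.length ∧
      (∀ p ∈ ws, p.1 ∈ c' ∧ p.2 ∈ c') ∧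
      ∀ mem : List ℕ, N ≤ mem.length → Linked mem c → Linked (applyWrites ws mem) c' by
    obtain ⟨ws, h1, h2⟩ := H
    exact ⟨ws, by omega, h2⟩
  -- Linking a new head to a list.
  have link : ∀ (a : ℕ) (t : List ℕ), a < N → a ∉ t → ∃ ws : List (ℕ × ℕ), ws.length ≤ 1 ∧
      (∀ p ∈ ws, p.1 = a ∧ p.2 ∈ t) ∧ ∀ mem : List ℕ, N ≤ mem.length → Linked mem t →
        Linked (applyWrites ws mem) (a :: t) := by
    intro a t ha hat
    cases t with
    | nil => exact ⟨[], by simp, by simp, fun _ _ _ => by simp [Linked]⟩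
    | cons b t =>
      refine ⟨[(a, b)], by simp, by simp, fun mem hm hl => ?_⟩
      rw [Linked, List.isChain_cons_cons]
      exact ⟨getD_set_self (by omega), hl.set hat⟩
  induction h with
  | slnil => exact ⟨[], by simp, by simp, fun _ _ _ => by simp [Linked]⟩
  | cons b h ih =>
    rename_i c t'
    rw [List.nodup_cons] at hnd
    rw [List.forall_mem_cons] at hN
    obtain ⟨ws, h1, h2, h3⟩ := ih hnd.2 hN.2
    obtain ⟨us, g1, g2, g3⟩ := link b t' hN.1 hnd.1
    refine ⟨ws ++ us, ?_, ?_, ?_⟩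
    · simp only [List.length_append, List.length_cons]
      split <;> omega
    · intro p hp
      rcases List.mem_append.1 hp with hp | hp
      · exact ⟨List.mem_cons_of_mem _ (h2 p hp).1, List.mem_cons_of_mem _ (h2 p hp).2⟩
      · exact ⟨by simp [(g2 p hp).1], List.mem_cons_of_mem _ (g2 p hp).2⟩
    · intro mem hm hl
      have := g3 (applyWrites ws mem) (by simpa using hm) (h3 mem hm hl)
      simpa [applyWrites] using this
  | cons_cons a h ih =>
    rename_i t t'
    rw [List.nodup_cons] at hnd
    rw [List.forall_mem_cons] at hN
    obtain ⟨ws, h1, h2, h3⟩ := ih hnd.2 hN.2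
    have hws : ∀ p ∈ ws, p.1 ∈ a :: t' ∧ p.2 ∈ a :: t' := fun p hp =>
      ⟨List.mem_cons_of_mem _ (h2 p hp).1, List.mem_cons_of_mem _ (h2 p hp).2⟩
    by_cases hh : t.head? = t'.head?
    · refine ⟨ws, ?_, hws, ?_⟩
      · simp only [List.length_cons, List.head?_cons, hh] at h1 ⊢
        simp at h1 ⊢
        omega
      · intro mem hm hl
        rw [Linked, List.isChain_cons] at hl ⊢
        refine ⟨fun y hy => ?_, h3 mem hm hl.2⟩
        rw [getD_applyWrites]
        · exact hl.1 y (hh ▸ hy)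
        · rintro p hp rfl
          exact hnd.1 (h2 p hp).1
    · obtain ⟨us, g1, g2, g3⟩ := link a t' hN.1 hnd.1
      refine ⟨ws ++ us, ?_, ?_, ?_⟩
      · simp only [List.length_append, List.length_cons, List.head?_cons, hh] at h1 ⊢
        simp at h1 ⊢
        omega
      · intro p hp
        rcases List.mem_append.1 hp with hp | hp
        · exact hws p hp
        · exact ⟨by simp [(g2 p hp).1], List.mem_cons_of_mem _ (g2 p hp).2⟩
      · intro mem hm hl
        have := g3 (applyWrites ws mem) (by simpa using hm) (h3 mem hm hl.tail)
        simpa [applyWrites] using this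

/-- In a sorted list the elements with a convex property are consecutive. -/
theorem filter_infix_of_convex {X Y : Type*} [LinearOrder Y] (key : X → Y) (p : X → Bool)
    (hp : ∀ x y z, key x ≤ key y → key y ≤ key z → p x → p z → p y) {c : List X}
    (hc : c.Pairwise fun x y => key x ≤ key y) : c.filter p <:+: c := by
  have aux : ∀ (x : X) (t : List X), p x → (∀ y ∈ t, key x ≤ key y) →
      (t.Pairwise fun x y => key x ≤ key y) → t.filter p <+: t := by
    intro x t hx hxt ht
    induction t with
    | nil => simp
    | cons y t ih =>
      rw [List.forall_mem_cons] at hxt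
      rw [List.pairwise_cons] at ht
      by_cases hy : p y
      · rw [List.filter_cons_of_pos hy, List.cons_prefix_cons]
        exact ⟨rfl, ih hxt.2 ht.2⟩
      · have : (y :: t).filter p = [] := by
          rw [List.filter_eq_nil_iff, List.forall_mem_cons]
          exact ⟨hy, fun z hz hpz => hy (hp x y z hxt.1 (ht.1 z hz) hx hpz)⟩
        rw [this]
        exact List.nil_prefix
  induction c with
  | nil => simp
  | cons x t ih =>
    rw [List.pairwise_cons] at hc
    by_cases hx : p x
    · rw [List.filter_cons_of_pos hx]
      exact (List.cons_prefix_cons.2 ⟨rfl, aux x t hx hc.1 hc.2⟩).isInfix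
    · rw [List.filter_cons_of_neg hx]
      exact (ih hc.2).trans (List.suffix_cons x t).isInfix

/-- A list decomposes into the elements without a property and at most one more gap than there are
such elements. -/
theorem exists_gaps {X : Type*} (p : X → Bool) (E : List X) : ∃ G : List (List X),
    (∀ g ∈ G, g ≠ [] ∧ g <:+: E) ∧ G.flatten = E.filter p ∧
      G.length ≤ (E.filter fun x => !p x).length + 1 := by
  -- The first gap is kept separate, so that it can be extended to the left.
  suffices H : ∃ (g : List X) (G : List (List X)), g <+: E ∧ (∀ g ∈ G, g ≠ [] ∧ g <:+: E) ∧
      g ++ G.flatten = E.filter p ∧ G.length ≤ (E.filter fun x => !p x).length by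
    obtain ⟨g, G, h1, h2, h3, h4⟩ := H
    by_cases hg : g = []
    · exact ⟨G, h2, by simpa [hg] using h3, by omega⟩
    · exact ⟨g :: G, by simpa using ⟨⟨hg, h1.isInfix⟩, h2⟩, by simpa using h3, by simpa using h4⟩
  induction E with
  | nil => exact ⟨[], [], by simp⟩
  | cons x E ih =>
    obtain ⟨g, G, h1, h2, h3, h4⟩ := ih
    have hG : ∀ g ∈ G, g ≠ [] ∧ g <:+: x :: E := fun g hg =>
      ⟨(h2 g hg).1, (h2 g hg).2.trans (List.suffix_cons x E).isInfix⟩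
    by_cases hx : p x
    · refine ⟨x :: g, G, List.cons_prefix_cons.2 ⟨rfl, h1⟩, hG, ?_, ?_⟩
      · rw [List.filter_cons_of_pos hx, ← h3]; rfl
      · simpa [hx] using h4
    · by_cases hg : g = []
      · refine ⟨[], G, by simp, hG, ?_, ?_⟩
        · rw [List.filter_cons_of_neg hx, ← h3, hg]
        · simp [hx]; omega
      · refine ⟨[], g :: G, by simp, ?_, ?_, ?_⟩
        · rw [List.forall_mem_cons]
          exact ⟨⟨hg, h1.isInfix.trans (List.suffix_cons x E).isInfix⟩, hG⟩
        · rw [List.filter_cons_of_neg hx, ← h3]; rfl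
        · simpa [hx] using h4

theorem iterate_of_isChain {X : Type*} (f : X → X) {x : X} {g : List X}
    (h : (x :: g).IsChain fun s s' => f s = s') : List.iterate f x (g.length + 1) = x :: g := by
  induction g generalizing x with
  | nil => rfl
  | cons y g ih =>
    rw [List.isChain_cons_cons] at h
    rw [List.length_cons, List.iterate, h.1, ih h.2]

end LinkedLists

/-! ### Reporting families of strings -/

section Families

variable {σ : ℕ}

/-- The set `S` of strings can be reported by at most `c` times `rleSize T` records and item words,
wherever the items are placed, and by at most three records per string of `S`. -/
def Reportable (T : List (Fin σ)) (c : ℕ) (S : Set (List (Fin σ))) : Prop :=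
  ∀ base, 0 < base → ∃ (items : List ℕ) (recs : List Record) (L : List (Descriptor σ))
    (W : List (List (Fin σ))),
    items.length ≤ c * rleSize T ∧ recs.length ≤ c * rleSize T ∧ recs.length ≤ 3 * W.length ∧
    (∀ v ∈ items ++ recs.flatMap Record.words,
      v ≤ 4 * (T.length + σ) + base + items.length) ∧
    L.map (Descriptor.decode (rle T)) = W.map some ∧ W.Nodup ∧ (∀ v, v ∈ W ↔ v ∈ S) ∧
    ∀ (M : ℕ) (D mem : List ℕ), 4 * (T.length + σ) + base + items.length + 1 < M →
      items <+: D.drop base → base + items.length ≤ mem.length →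
      outputOf M D mem recs = L.flatMap Descriptor.toWords

/-- The items and the records of two sets are put one after the other; what the first records leave
in the working memory does not matter. -/
theorem Reportable.union {T : List (Fin σ)} {c c' : ℕ} {S S' : Set (List (Fin σ))}
    (h : Reportable T c S) (h' : Reportable T c' S') (hd : Disjoint S S') :
    Reportable T (c + c') (S ∪ S') := by
  intro base hb
  obtain ⟨items, recs, L, W, a1, a2, a3, a4, a5, a6, a7, a8⟩ := h base hb
  obtain ⟨items', recs', L', W', b1, b2, b3, b4, b5, b6, b7, b8⟩ :=
    h' (base + items.length) (by omega)
  refine ⟨items ++ items', recs ++ recs', L ++ L', W ++ W', ?_, ?_, ?_, ?_, ?_, ?_, ?_, ?_⟩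
  · rw [List.length_append, add_mul]; omega
  · rw [List.length_append, add_mul]; omega
  · simp only [List.length_append]; omega
  · intro v hv
    have hv' : v ∈ items ++ recs.flatMap Record.words ∨
        v ∈ items' ++ recs'.flatMap Record.words := by
      simp only [List.flatMap_append, List.mem_append] at hv ⊢
      tauto
    rw [List.length_append]
    rcases hv' with hv | hv
    · have := a4 v hv; omega
    · have := b4 v hv; omega
  · rw [List.map_append, List.map_append, a5, b5]
  · refine a6.append b6 fun v hv hv' => ?_
    exact Set.disjoint_left.1 hd ((a7 v).1 hv) ((b7 v).1 hv')
  · intro v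
    rw [List.mem_append, a7, b7, Set.mem_union]
  · intro M D mem hM hD hmem
    rw [List.length_append] at hM hmem
    rw [outputOf_append, List.flatMap_append, a8 M D mem (by omega)
      ((List.prefix_append _ _).trans hD) (by omega),
      b8 M D _ (by omega) _ (by rw [length_memAfter]; omega)]
    obtain ⟨t, ht⟩ := hD
    refine ⟨t, ?_⟩
    rw [← List.drop_drop, ← ht, List.append_assoc, List.drop_left' rfl]

end Families

/-! ### Joining left and right parts -/

section DominanceFamilies

variable {σ : ℕ}

/-- A family of strings that arise by joining left parts `P : π` and right parts `Q : κ` with an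
exponent `i`. Left and right parts have to be related, the exponent ranges over the values from
`lo P` to the smaller one of `hi P` and `bound Q`, and the combinations in `exc` are excepted. The
right parts related to a left part are consecutive when sorted by `key`. Each combination is
described by words each of which depends on one of the parts or the exponent only. -/
structure Family (T : List (Fin σ)) (π κ : Type) where
  Ps : Finset π
  Qs : Finset κ
  exc : Finset (π × κ × ℕ)
  rel : π → κ → Prop
  key : κ → ℕ ×ₗ ℕ
  (a t k r l lo hi : π → ℕ)
  (p bound : κ → ℕ)
  str : π → κ → ℕ → List (Fin σ)
  convex : ∀ P x y z, key x ≤ key y → key y ≤ key z → rel P x → rel P z → rel P y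
  lo_le_hi : ∀ P ∈ Ps, lo P ≤ hi P
  left_le : ∀ P ∈ Ps, ∀ v ∈ [a P, t P, k P, r P, l P, lo P, hi P], v ≤ 4 * (T.length + σ)
  right_le : ∀ Q ∈ Qs, p Q ≤ 4 * (T.length + σ) ∧ bound Q ≤ 4 * (T.length + σ)
  total_le : ∀ P ∈ Ps, ∀ Qs' ⊆ Qs, (∀ Q ∈ Qs', rel P Q) →
    ∑ Q ∈ Qs', (min (hi P) (bound Q) + 1 - lo P) ≤ 4 * (T.length + σ)
  exists_desc : ∀ P ∈ Ps, ∀ Q ∈ Qs, ∀ i, rel P Q → lo P ≤ i → i ≤ hi P → i ≤ bound Q →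
    (P, Q, i) ∉ exc → ∃ d : Descriptor σ,
      d.toWords = [a P + (i - t P), k P, p Q, r P, i, l P] ∧
      d.decode (rle T) = some (str P Q i)

namespace Family

variable {T : List (Fin σ)} {π κ : Type}

/-- The combinations that are to be reported. -/
def Out (F : Family T π κ) (e : π × κ × ℕ) : Prop :=
  e.1 ∈ F.Ps ∧ e.2.1 ∈ F.Qs ∧ F.rel e.1 e.2.1 ∧ F.lo e.1 ≤ e.2.2 ∧ e.2.2 ≤ F.hi e.1 ∧
    e.2.2 ≤ F.bound e.2.1 ∧ e ∉ F.exc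

/-- The walk for the left part `P` along a list of right parts. -/
def walk (F : Family T π κ) (P : π) (c : List κ) : List (κ × ℕ) :=
  c.flatMap fun Q =>
    (List.range' (F.lo P) (min (F.hi P) (F.bound Q) + 1 - F.lo P)).map fun i => (Q, i)

theorem mem_walk (F : Family T π κ) {P : π} {c : List κ} {Q : κ} {i : ℕ} :
    (Q, i) ∈ F.walk P c ↔ Q ∈ c ∧ F.lo P ≤ i ∧ i ≤ F.hi P ∧ i ≤ F.bound Q := by
  simp only [walk, List.mem_flatMap, List.mem_map, List.mem_range'_1, Prod.mk.injEq]
  constructor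
  · rintro ⟨Q', h, j, hj, rfl, rfl⟩
    exact ⟨h, by omega⟩
  · rintro ⟨h, h'⟩
    exact ⟨Q, h, i, by omega, rfl, rfl⟩

theorem nodup_walk (F : Family T π κ) (P : π) {c : List κ} (hc : c.Nodup) :
    (F.walk P c).Nodup := by
  rw [walk, List.nodup_flatMap]
  refine ⟨fun Q _ => (List.nodup_range' ..).map fun i j h => by simpa using h, ?_⟩
  refine hc.imp fun hne => ?_
  rw [Function.onFun, List.disjoint_left]
  rintro ⟨Q, i⟩ h h'
  simp only [List.mem_map, Prod.mk.injEq] at h h'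
  obtain ⟨_, _, rfl, _⟩ := h
  obtain ⟨_, _, rfl, _⟩ := h'
  exact hne rfl

theorem length_walk (F : Family T π κ) (P : π) (c : List κ) : (F.walk P c).length =
    (c.map fun Q => min (F.hi P) (F.bound Q) + 1 - F.lo P).sum := by
  simp [walk, List.length_flatMap]

/-- The record for a part `g` of the walk for `P`, where `addr` tells the addresses of items.
The cell `0`, which never belongs to an item, takes the write that is not needed. -/
def gapRecord (F : Family T π κ) (addr : κ → ℕ) (P : π) (g : List (κ × ℕ)) : Record where
  dst := 0
  val := 0
  a := F.a P
  t := F.t P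
  k := F.k P
  r := F.r P
  l := F.l P
  lo := F.lo P
  hi := F.hi P
  x := (g.head?.map fun s => addr s.1).getD 0
  i := (g.head?.map Prod.snd).getD 0
  cnt := g.length

/-- The machine follows the walk along a linked list. -/
theorem isChain_walk (F : Family T π κ) {P : π} (hP : P ∈ F.Ps) {M : ℕ} {D mem : List ℕ}
    {addr : κ → ℕ} {c : List κ} (hc : ∀ Q ∈ c, F.lo P ≤ F.bound Q ∧ addr Q + 1 < M ∧
      D.getD (addr Q + 1) 0 = F.bound Q) (hM : F.hi P + 1 < M)
    (hl : Linked mem (c.map addr)) (ρ : Record) (hlo : ρ.lo = F.lo P) (hhi : ρ.hi = F.hi P) :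
    (F.walk P c).IsChain fun s s' =>
      ρ.step M D mem (addr s.1, s.2) = (addr s'.1, s'.2) := by
  induction c with
  | nil => simp [walk]
  | cons Q c ih =>
    rw [List.forall_mem_cons] at hc
    rw [List.map_cons, Linked, List.isChain_cons] at hl
    obtain ⟨⟨h1, h2, h3⟩, hc⟩ := hc
    have h4 := F.lo_le_hi P hP
    have ih := ih hc hl.2
    rw [walk, List.flatMap_cons, List.isChain_append]
    refine ⟨?_, ih, ?_⟩
    · rw [List.isChain_map]
      refine List.IsChain.imp_of_mem_imp (fun i j hi hj hij => ?_) (List.isChain_range' _ _ _)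
      rw [List.mem_range'_1] at hi hj
      have e1 : i < F.hi P := by omega
      have e2 : i < F.bound Q := by omega
      simp only [Record.step]
      rw [Nat.mod_eq_of_lt h2, h3, hhi, if_pos ⟨e1, e2⟩, Nat.mod_eq_of_lt (by omega), hij]
    · rintro ⟨x, i⟩ hx ⟨y, j⟩ hy
      obtain ⟨rfl, hi⟩ : x = Q ∧ i = min (F.hi P) (F.bound Q) := by
        rw [List.getLast?_map, List.getLast?_range', if_neg (by omega)] at hx
        simp only [Option.map_some, Option.mem_def, Option.some.injEq, Prod.mk.injEq] at hx
        exact ⟨hx.1.symm, by omega⟩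
      cases c with
      | nil => simp at hy
      | cons Q' c =>
        rw [List.forall_mem_cons] at hc
        obtain ⟨rfl, hj⟩ : y = Q' ∧ j = F.lo P := by
          have : 0 < min (F.hi P) (F.bound Q') + 1 - F.lo P := by omega
          rw [List.flatMap_cons, List.head?_append, List.head?_map, List.head?_range',
            if_neg (by omega)] at hy
          simpa [eq_comm] using hy
        simp only [Record.step]
        rw [Nat.mod_eq_of_lt h2, h3, hhi, if_neg (by omega), hlo, hj]
        rw [hl.1 (addr y) (by simp)]

/-- The record for a gap reports the elements of the gap. -/
theorem output_gapRecord (F : Family T π κ) {P : π} {M : ℕ} {D mem : List ℕ}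
    {addr : κ → ℕ} {g : List (κ × ℕ)} (hg : g ≠ [])
    (hchain : g.IsChain fun s s' => (F.gapRecord addr P g).step M D mem (addr s.1, s.2) =
      (addr s'.1, s'.2))
    (hD : ∀ s ∈ g, D.getD (addr s.1) 0 = F.p s.1 ∧ F.a P + (s.2 - F.t P) < M) :
    (List.iterate ((F.gapRecord addr P g).step M D mem)
      ((F.gapRecord addr P g).x, (F.gapRecord addr P g).i)
      (F.gapRecord addr P g).cnt).flatMap ((F.gapRecord addr P g).report M D) =
    g.flatMap fun s => [F.a P + (s.2 - F.t P), F.k P, F.p s.1, F.r P, s.2, F.l P] := by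
  set ρ := F.gapRecord addr P g with hρ
  have h1 : List.iterate (ρ.step M D mem) (ρ.x, ρ.i) ρ.cnt = g.map fun s => (addr s.1, s.2) := by
    obtain ⟨s, g, rfl⟩ := List.exists_cons_of_ne_nil hg
    have e1 : (ρ.x, ρ.i) = (addr s.1, s.2) := by simp [hρ, gapRecord]
    have e2 : ρ.cnt = (g.map fun s => (addr s.1, s.2)).length + 1 := by simp [hρ, gapRecord]
    rw [e1, e2, iterate_of_isChain]
    · rfl
    · rw [← List.map_cons (f := fun s : κ × ℕ => (addr s.1, s.2)), List.isChain_map]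
      exact hchain
  rw [h1, List.flatMap_map]
  refine List.flatMap_congr fun s hs => ?_
  obtain ⟨h2, h3⟩ := hD s hs
  simp only [Record.report]
  rw [h2]
  simp only [hρ, gapRecord]
  rw [Nat.mod_eq_of_lt h3]

/-- The record that performs a write only. -/
def writeRecord (p : ℕ × ℕ) : Record := ⟨p.1, p.2, 0, 0, 0, 0, 0, 0, 0, 0, 0, 0⟩

theorem memAfter_writeRecord (ws : List (ℕ × ℕ)) (mem : List ℕ) :
    memAfter (ws.map writeRecord) mem = applyWrites ws mem := by
  simp [memAfter, applyWrites, List.foldl_map, writeRecord]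

theorem outputOf_writeRecord (M : ℕ) (D : List ℕ) (ws : List (ℕ × ℕ)) (mem : List ℕ) :
    outputOf M D mem (ws.map writeRecord) = [] := by
  induction ws generalizing mem with
  | nil => rfl
  | cons p ws ih => simp [outputOf, ih, writeRecord, List.iterate]

/-- The words that are reported for the left part `P`, the right part `s.1` and the exponent
`s.2`. -/
def tuple (F : Family T π κ) (P : π) (s : κ × ℕ) : List ℕ :=
  [F.a P + (s.2 - F.t P), F.k P, F.p s.1, F.r P, s.2, F.l P]

theorem linked_memAfter_gapRecord (F : Family T π κ) {P : π} {mem : List ℕ}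
    {addr : κ → ℕ} (G : List (List (κ × ℕ))) {c : List ℕ} (h0 : 0 ∉ c) (hl : Linked mem c) :
    Linked (memAfter (G.map (F.gapRecord addr P)) mem) c := by
  induction G generalizing mem with
  | nil => exact hl
  | cons g G ih => exact ih (hl.set h0)

/-- The records for all gaps of a walk report what is not skipped. -/
theorem outputOf_gapRecord (F : Family T π κ) {P : π} (hP : P ∈ F.Ps) {M : ℕ} {D mem : List ℕ}
    {addr : κ → ℕ} {c : List κ} (hc : ∀ Q ∈ c, F.lo P ≤ F.bound Q ∧ addr Q + 1 < M ∧
      D.getD (addr Q + 1) 0 = F.bound Q ∧ D.getD (addr Q) 0 = F.p Q) (hM : F.hi P + 1 < M)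
    (h0 : 0 ∉ c.map addr) (hl : Linked mem (c.map addr)) (G : List (List (κ × ℕ)))
    (hG : ∀ g ∈ G, g ≠ [] ∧ g <:+: F.walk P c)
    (ha : ∀ s ∈ G.flatten, F.a P + (s.2 - F.t P) < M) :
    outputOf M D mem (G.map (F.gapRecord addr P)) = G.flatten.flatMap (F.tuple P) := by
  induction G generalizing mem with
  | nil => rfl
  | cons g G ih =>
    rw [List.forall_mem_cons] at hG
    have hl' : Linked (mem.set 0 0) (c.map addr) := hl.set h0
    rw [List.map_cons, outputOf, List.flatten_cons, List.flatMap_append]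
    have ih' := ih hl' hG.2 fun s hs => ha s (by simp [hs])
    change _ ++ outputOf M D (mem.set 0 0) _ = _
    rw [ih']
    congr 1
    refine F.output_gapRecord (mem := mem.set 0 0) hG.1.1 ?_ fun s hs =>
      ⟨?_, ha s (by simp [hs])⟩
    · exact (F.isChain_walk hP (fun Q hQ => ⟨(hc Q hQ).1, (hc Q hQ).2.1, (hc Q hQ).2.2.1⟩) hM hl'
        _ rfl rfl).infix hG.1.2
    · exact (hc s.1 (F.mem_walk.1 (hG.1.2.subset hs)).1).2.2.2

open Classical in
/-- The right parts in the list `QL` that are admissible from the exponent `θ` on. -/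
noncomputable def current (F : Family T π κ) (QL : List κ) (θ : ℕ) : List κ :=
  QL.filter fun Q => θ ≤ F.bound Q

open Classical in
/-- The walk for `P` along all related right parts in `QL`. -/
noncomputable def fullWalk (F : Family T π κ) (QL : List κ) (P : π) : List (κ × ℕ) :=
  F.walk P ((F.current QL (F.lo P)).filter fun Q => F.rel P Q)

open Classical in
/-- The items of a list of right parts are stored one after the other from the address `base`
on. -/
noncomputable def itemAddr (QL : List κ) (base : ℕ) (Q : κ) : ℕ := base + 2 * QL.idxOf Q

theorem itemAddr_lt {QL : List κ} {base : ℕ} {Q : κ} (h : Q ∈ QL) :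
    itemAddr QL base Q + 1 < base + 2 * QL.length := by
  classical
  have := List.idxOf_lt_length_iff.2 h
  rw [itemAddr]
  convert_to base + 2 * QL.idxOf Q + 1 < base + 2 * QL.length
  omega

theorem getD_item (F : Family T π κ) {QL : List κ} {base : ℕ} {D : List ℕ}
    (hD : QL.flatMap (fun Q => [F.p Q, F.bound Q]) <+: D.drop base) {Q : κ} (h : Q ∈ QL) :
    D.getD (itemAddr QL base Q) 0 = F.p Q ∧ D.getD (itemAddr QL base Q + 1) 0 = F.bound Q := by
  classical
  have key : ∀ (QL : List κ) (base : ℕ), Q ∈ QL →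
      QL.flatMap (fun Q => [F.p Q, F.bound Q]) <+: D.drop base →
      D.getD (base + 2 * QL.idxOf Q) 0 = F.p Q ∧
        D.getD (base + 2 * QL.idxOf Q + 1) 0 = F.bound Q := by
    intro QL
    induction QL with
    | nil => simp
    | cons x QL ih =>
      intro base hQ hD
      obtain ⟨t, ht⟩ := hD
      rw [List.flatMap_cons] at ht
      by_cases hx : x = Q
      · subst hx
        have h0 : D.getD base 0 = (D.drop base).getD 0 0 := by simp
        have h1 : D.getD (base + 1) 0 = (D.drop base).getD 1 0 := by simp
        rw [List.idxOf_cons_self, mul_zero, add_zero, h0, h1, ← ht]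
        exact ⟨rfl, rfl⟩
      · have h2 := ih (base + 2) (by simpa [Ne.symm hx] using hQ) ⟨t, by
          rw [← List.drop_drop, ← ht, List.append_assoc]; rfl⟩
        have e : base + 2 * (QL.idxOf Q).succ = base + 2 + 2 * QL.idxOf Q := by omega
        rwa [List.idxOf_cons_ne _ hx, e]
  have := key QL base h hD
  rw [itemAddr]
  convert this

theorem itemAddr_inj {QL : List κ} {base : ℕ} {Q Q' : κ} (h : Q ∈ QL)
    (he : itemAddr QL base Q = itemAddr QL base Q') : Q = Q' := by
  classical
  simp only [itemAddr] at he
  exact (List.idxOf_inj h).1 (by omega)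

end Family

end DominanceFamilies

/-! ### The sweep over the left parts -/

section Sweep

variable {σ : ℕ} {T : List (Fin σ)} {π κ : Type}

namespace Family

open Classical in
/-- The combinations to be reported for `P`, in the order of the walk. -/
noncomputable def outs (F : Family T π κ) (QL : List κ) (P : π) : List (κ × ℕ) :=
  (F.fullWalk QL P).filter fun s => F.Out (P, s)

open Classical in
/-- The combinations that have to be skipped for `P`. -/
noncomputable def skips (F : Family T π κ) (QL : List κ) (P : π) : List (κ × ℕ) :=
  (F.fullWalk QL P).filter fun s => !decide (F.Out (P, s))

theorem mem_fullWalk (F : Family T π κ) {QL : List κ} {P : π} {Q : κ} {i : ℕ} :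
    (Q, i) ∈ F.fullWalk QL P ↔
      Q ∈ QL ∧ F.rel P Q ∧ F.lo P ≤ i ∧ i ≤ F.hi P ∧ i ≤ F.bound Q := by
  classical
  rw [fullWalk, mem_walk, List.mem_filter, current, List.mem_filter]
  simp only [decide_eq_true_eq]
  constructor
  · rintro ⟨⟨⟨h1, h2⟩, h3⟩, h4⟩
    exact ⟨h1, h3, h4⟩
  · rintro ⟨h1, h3, h4⟩
    exact ⟨⟨⟨h1, by omega⟩, h3⟩, h4⟩

theorem nodup_fullWalk (F : Family T π κ) {QL : List κ} (h : QL.Nodup) (P : π) :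
    (F.fullWalk QL P).Nodup :=
  F.nodup_walk P ((h.filter _).filter _)

theorem length_fullWalk_le (F : Family T π κ) {QL : List κ} (h : QL.Nodup)
    (hQL : ∀ Q ∈ QL, Q ∈ F.Qs) {P : π} (hP : P ∈ F.Ps) :
    (F.fullWalk QL P).length ≤ 4 * (T.length + σ) := by
  classical
  have hnd : ((F.current QL (F.lo P)).filter fun Q => F.rel P Q).Nodup := (h.filter _).filter _
  rw [fullWalk, length_walk, ← List.sum_toFinset _ hnd]
  refine F.total_le P hP _ (fun Q hQ => ?_) fun Q hQ => ?_
  · rw [List.mem_toFinset, List.mem_filter, current, List.mem_filter] at hQ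
    exact hQL Q hQ.1.1
  · rw [List.mem_toFinset, List.mem_filter] at hQ
    simpa using hQ.2

theorem add_sub_lt_of_out (F : Family T π κ) {P : π} {s : κ × ℕ} (h : F.Out (P, s)) :
    F.a P + (s.2 - F.t P) < σ := by
  obtain ⟨h1, h2, h3, h4, h5, h6, h7⟩ := h
  obtain ⟨d, hd, -⟩ := F.exists_desc P h1 s.1 h2 s.2 h3 h4 h5 h6 h7
  have := congrArg (fun l => l.getD 0 0) hd
  simp only [Descriptor.toWords, List.getD_cons_zero] at this
  rw [← this]
  exact d.a.isLt

/-- The left parts are processed in the order of decreasing `lo`, so that the right parts that are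
admissible for them are only ever inserted into the linked list. -/
theorem exists_records (F : Family T π κ) {QL : List κ} (hnd : QL.Nodup)
    (hQL : ∀ Q ∈ QL, Q ∈ F.Qs) (hsort : QL.Pairwise fun x y => F.key x ≤ F.key y) (base : ℕ)
    (hbase : 0 < base) (PL : List π) (hPL : ∀ P ∈ PL, P ∈ F.Ps)
    (hdec : PL.Pairwise fun P P' => F.lo P' ≤ F.lo P) (c : List κ) (hcQL : c.Sublist QL)
    (hc : ∀ P ∈ PL, c.Sublist (F.current QL (F.lo P))) :
    ∃ recs : List Record,
      recs.length + 2 * c.length ≤ 2 * QL.length +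
        (PL.map fun P => 1 + (F.skips QL P).length).sum ∧
      recs.length + 2 * c.length ≤ 2 * QL.length + (PL.map fun P => (F.outs QL P).length).sum ∧
      (∀ v ∈ recs.flatMap Record.words, v ≤ 4 * (T.length + σ) + base + 2 * QL.length) ∧
      ∀ (M : ℕ) (D mem : List ℕ), 4 * (T.length + σ) + base + 2 * QL.length + 1 < M →
        QL.flatMap (fun Q => [F.p Q, F.bound Q]) <+: D.drop base →
        base + 2 * QL.length ≤ mem.length → Linked mem (c.map (itemAddr QL base)) →
        outputOf M D mem recs = PL.flatMap fun P => (F.outs QL P).flatMap (F.tuple P) := by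
  classical
  induction PL generalizing c with
  | nil =>
    refine ⟨[], ?_, ?_, by simp, fun _ _ _ _ _ _ _ => rfl⟩
    all_goals
      have := hcQL.length_le
      simp
      omega
  | cons P PL ih =>
    rw [List.forall_mem_cons] at hPL hc
    rw [List.pairwise_cons] at hdec
    set cur := F.current QL (F.lo P) with hcur
    have hcurQL : cur.Sublist QL := List.filter_sublist
    have hcur' : ∀ P' ∈ PL, cur.Sublist (F.current QL (F.lo P')) := fun P' hP' => by
      refine List.monotone_filter_right QL fun Q hQ => ?_
      have := hdec.1 P' hP'
      simp only [decide_eq_true_eq] at hQ ⊢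
      omega
    have haddr : ∀ Q ∈ cur, itemAddr QL base Q + 1 < base + 2 * QL.length := fun Q hQ =>
      itemAddr_lt (hcurQL.subset hQ)
    obtain ⟨recs, a1, a2, a3, a4⟩ := ih hPL.2 hdec.2 cur hcurQL hcur'
    have hnd' : (cur.map (itemAddr QL base)).Nodup :=
      (hnd.sublist hcurQL).map_on fun Q hQ Q' _ h => itemAddr_inj (hcurQL.subset hQ) h
    have hlt : ∀ x ∈ cur.map (itemAddr QL base), x < base + 2 * QL.length := by
      intro x hx
      obtain ⟨Q, hQ, rfl⟩ := List.mem_map.1 hx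
      have := haddr Q hQ
      omega
    obtain ⟨ws, b1, b2, b3⟩ := exists_writes (hc.1.map (itemAddr QL base)) hnd' _ hlt
    obtain ⟨G, g1, g2, g3⟩ := exists_gaps (fun s => decide (F.Out (P, s))) (F.fullWalk QL P)
    have hGout : G.flatten = F.outs QL P := g2
    have hGle : G.length ≤ (F.outs QL P).length := by
      rw [← hGout, List.length_flatten]
      calc G.length = (G.map fun _ => 1).sum := by simp
        _ ≤ (G.map List.length).sum :=
          List.sum_le_sum fun g hg => List.length_pos_iff.2 (g1 g hg).1
    rw [List.length_map, List.length_map] at b1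
    change G.length ≤ (F.skips QL P).length + 1 at g3
    have hlow : F.lo P ≤ F.hi P := F.lo_le_hi P hPL.1
    have hleft := F.left_le P hPL.1
    simp only [List.forall_mem_cons] at hleft
    refine ⟨ws.map writeRecord ++ (G.map (F.gapRecord (itemAddr QL base) P) ++ recs),
      ?_, ?_, ?_, ?_⟩
    · simp only [List.length_append, List.length_map, List.map_cons, List.sum_cons]
      omega
    · simp only [List.length_append, List.length_map, List.map_cons, List.sum_cons]
      omega
    · intro v hv
      simp only [List.flatMap_append, List.mem_append, List.flatMap_map, List.mem_flatMap] at hv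
      rcases hv with ⟨p, hp, hv⟩ | ⟨g, hg, hv⟩ | ⟨ρ, hρ, hv⟩
      · have h1 := hlt _ (b2 p hp).1
        have h2 := hlt _ (b2 p hp).2
        simp [Record.words, writeRecord] at hv
        omega
      · obtain ⟨hne, hinf⟩ := g1 g hg
        have hlen := hinf.length_le.trans (F.length_fullWalk_le hnd hQL hPL.1)
        obtain ⟨s, g, rfl⟩ := List.exists_cons_of_ne_nil hne
        obtain ⟨Q, i⟩ := s
        obtain ⟨h1, h2, h3, h4, h5⟩ := F.mem_fullWalk.1 (hinf.subset (List.mem_cons_self ..))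
        have h6 := itemAddr_lt (base := base) h1
        simp [Record.words, gapRecord] at hv
        simp only [List.length_cons] at hlen
        omega
      · exact a3 v (List.mem_flatMap.2 ⟨ρ, hρ, hv⟩)
    · intro M D mem hM hD hmem hl
      have hl1 := b3 mem hmem hl
      have h0 : 0 ∉ cur.map (itemAddr QL base) := by
        rw [List.mem_map]
        rintro ⟨Q, -, h⟩
        simp only [itemAddr] at h
        omega
      set sub := cur.filter fun Q => F.rel P Q with hsub
      have hinf : sub <:+: cur := by
        refine filter_infix_of_convex F.key _ (fun x y z h1 h2 h3 h4 => ?_)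
          (hsort.sublist hcurQL)
        simp only [decide_eq_true_eq] at h3 h4 ⊢
        exact F.convex P x y z h1 h2 h3 h4
      have hl2 : Linked (applyWrites ws mem) (sub.map (itemAddr QL base)) :=
        List.IsChain.infix hl1 (hinf.map _)
      rw [outputOf_append, outputOf_writeRecord, memAfter_writeRecord, List.nil_append,
        outputOf_append, List.flatMap_cons]
      rw [F.outputOf_gapRecord hPL.1 (c := sub) _ (by omega) _ hl2 G g1, hGout]
      · rw [a4 M D _ hM hD (by simpa using hmem)
          (F.linked_memAfter_gapRecord G h0 hl1)]
      · intro s hs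
        rw [hGout, outs, List.mem_filter] at hs
        have := F.add_sub_lt_of_out (by simpa using hs.2)
        omega
      · intro Q hQ
        have hQ' := hinf.subset hQ
        have h1 := haddr Q hQ'
        have h2 := F.getD_item hD (hcurQL.subset hQ')
        refine ⟨?_, by omega, h2.2, h2.1⟩
        rw [hcur, current, List.mem_filter] at hQ'
        simpa using hQ'.2
      · exact fun h => h0 ((hinf.map _).subset h)

/-- A family is reportable, provided that its combinations describe the strings of `S`, each of
them once. Only right parts that take part in a combination to be reported are stored. -/
theorem reportable (F : Family T π κ) {S : Set (List (Fin σ))}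
    (hS : ∀ v, v ∈ S ↔ ∃ e, F.Out e ∧ F.str e.1 e.2.1 e.2.2 = v)
    (hinj : ∀ e e', F.Out e → F.Out e' →
      F.str e.1 e.2.1 e.2.2 = F.str e'.1 e'.2.1 e'.2.2 → e = e')
    {c : ℕ} (hc : 2 * F.Qs.card + F.Ps.card + F.exc.card ≤ c * rleSize T) : Reportable T c S := by
  classical
  intro base hbase
  let Qs' := F.Qs.filter fun Q => ∃ P i, F.Out (P, Q, i)
  let QL := Qs'.toList.insertionSort fun x y => F.key x ≤ F.key y
  let PL := F.Ps.toList.insertionSort fun P P' => F.lo P' ≤ F.lo P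
  have hQLperm : QL.Perm Qs'.toList := List.perm_insertionSort _ _
  have hPLperm : PL.Perm F.Ps.toList := List.perm_insertionSort _ _
  have hQLnd : QL.Nodup := hQLperm.nodup_iff.2 Qs'.nodup_toList
  have hPLnd : PL.Nodup := hPLperm.nodup_iff.2 F.Ps.nodup_toList
  have hQLmem : ∀ Q, Q ∈ QL ↔ Q ∈ Qs' := fun Q => by rw [hQLperm.mem_iff, Finset.mem_toList]
  have hPLmem : ∀ P, P ∈ PL ↔ P ∈ F.Ps := fun P => by rw [hPLperm.mem_iff, Finset.mem_toList]
  have hQL : ∀ Q ∈ QL, Q ∈ F.Qs := fun Q hQ => (Finset.mem_filter.1 ((hQLmem Q).1 hQ)).1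
  have hQLlen : QL.length ≤ F.Qs.card := by
    rw [hQLperm.length_eq, Finset.length_toList]
    exact Finset.card_filter_le _ _
  have hPLlen : PL.length = F.Ps.card := by rw [hPLperm.length_eq, Finset.length_toList]
  have : Std.Total fun x y : κ => F.key x ≤ F.key y := ⟨fun x y => le_total _ _⟩
  have : IsTrans κ fun x y : κ => F.key x ≤ F.key y := ⟨fun x y z h h' => h.trans h'⟩
  have : Std.Total fun P P' : π => F.lo P' ≤ F.lo P := ⟨fun x y => le_total _ _⟩
  have : IsTrans π fun P P' : π => F.lo P' ≤ F.lo P := ⟨fun x y z h h' => h'.trans h⟩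
  obtain ⟨recs, h1, h2, h3, h4⟩ := F.exists_records hQLnd hQL (List.pairwise_insertionSort _ _)
    base hbase PL (fun P hP => (hPLmem P).1 hP) (List.pairwise_insertionSort _ _) []
    (List.nil_sublist _) fun _ _ => List.nil_sublist _
  simp only [List.length_nil, mul_zero, add_zero] at h1 h2
  -- All combinations to be reported, in the order of the output.
  let O : List (π × κ × ℕ) := PL.flatMap fun P => (F.outs QL P).map fun s => (P, s)
  have nodup_pairs : ∀ f : π → List (κ × ℕ), (∀ P, (f P).Nodup) →
      (PL.flatMap fun P => (f P).map fun s => (P, s)).Nodup := by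
    intro f hf
    rw [List.nodup_flatMap]
    refine ⟨fun P _ => (hf P).map fun s s' h => by simpa using h, hPLnd.imp fun hne => ?_⟩
    rw [Function.onFun, List.disjoint_left]
    rintro ⟨P, s⟩ h h'
    simp only [List.mem_map, Prod.mk.injEq] at h h'
    obtain ⟨_, _, rfl, _⟩ := h
    obtain ⟨_, _, rfl, _⟩ := h'
    exact hne rfl
  have hOnd : O.Nodup := nodup_pairs _ fun P => (F.nodup_fullWalk hQLnd P).filter _
  have hOmem : ∀ e, e ∈ O ↔ F.Out e := by
    rintro ⟨P, Q, i⟩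
    simp only [O, List.mem_flatMap, List.mem_map, outs, List.mem_filter, decide_eq_true_eq,
      Prod.mk.injEq, hPLmem]
    constructor
    · rintro ⟨P, -, s, ⟨-, h⟩, rfl, rfl⟩
      exact h
    · intro h
      refine ⟨P, h.1, (Q, i), ⟨F.mem_fullWalk.2 ⟨?_, h.2.2.1, h.2.2.2.1, h.2.2.2.2.1,
        h.2.2.2.2.2.1⟩, h⟩, rfl, rfl⟩
      rw [hQLmem, Finset.mem_filter]
      exact ⟨h.2.1, P, i, h⟩
  have hOlen : O.length = (PL.map fun P => (F.outs QL P).length).sum := by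
    simp [O, List.length_flatMap]
  have hskip : (PL.map fun P => (F.skips QL P).length).sum ≤ F.exc.card := by
    have hnd := nodup_pairs (F.skips QL) fun P => (F.nodup_fullWalk hQLnd P).filter _
    have : (PL.map fun P => (F.skips QL P).length).sum =
        (PL.flatMap fun P => (F.skips QL P).map fun s => (P, s)).length := by
      simp [List.length_flatMap]
    rw [this, ← List.toFinset_card_of_nodup hnd]
    refine Finset.card_le_card fun e he => ?_
    obtain ⟨P, Q, i⟩ := e
    simp only [List.mem_toFinset, List.mem_flatMap, List.mem_map, skips, List.mem_filter,
      Prod.mk.injEq, hPLmem] at he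
    obtain ⟨P, hP, _, ⟨hw, hout⟩, rfl, rfl⟩ := he
    rw [F.mem_fullWalk] at hw
    by_contra hne
    have : F.Out (P, Q, i) := ⟨hP, hQL Q hw.1, hw.2.1, hw.2.2.1, hw.2.2.2.1, hw.2.2.2.2, hne⟩
    simp [this] at hout
  have hQLle : QL.length ≤ O.length := by
    have hsub : QL ⊆ O.map fun e => e.2.1 := by
      intro Q hQ
      obtain ⟨-, P, i, h⟩ := Finset.mem_filter.1 ((hQLmem Q).1 hQ)
      exact List.mem_map.2 ⟨(P, Q, i), (hOmem _).2 h, rfl⟩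
    have := (hQLnd.subperm hsub).length_le
    simpa using this
  have hdesc : ∀ e, F.Out e → ∃ d : Descriptor σ, d.toWords = F.tuple e.1 e.2 ∧
      d.decode (rle T) = some (F.str e.1 e.2.1 e.2.2) := fun e h =>
    F.exists_desc e.1 h.1 e.2.1 h.2.1 e.2.2 h.2.2.1 h.2.2.2.1 h.2.2.2.2.1 h.2.2.2.2.2.1
      h.2.2.2.2.2.2
  have hL : ∃ L : List (Descriptor σ), L.flatMap Descriptor.toWords =
      O.flatMap (fun e => F.tuple e.1 e.2) ∧ L.map (Descriptor.decode (rle T)) =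
      O.map fun e => some (F.str e.1 e.2.1 e.2.2) := by
    have hO : ∀ e ∈ O, F.Out e := fun e => (hOmem e).1
    clear_value O
    clear hOnd hOmem hOlen hQLle
    induction O with
    | nil => exact ⟨[], rfl, rfl⟩
    | cons e O ih =>
      rw [List.forall_mem_cons] at hO
      obtain ⟨L, k1, k2⟩ := ih hO.2
      obtain ⟨d, k3, k4⟩ := hdesc e hO.1
      exact ⟨d :: L, by simp [k1, k3], by simp [k2, k4]⟩
  obtain ⟨L, hL1, hL2⟩ := hL
  have hitems : (QL.flatMap fun Q => [F.p Q, F.bound Q]).length = 2 * QL.length := by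
    simp [List.length_flatMap, mul_comm]
  refine ⟨QL.flatMap fun Q => [F.p Q, F.bound Q], recs, L,
    O.map fun e => F.str e.1 e.2.1 e.2.2, ?_, ?_, ?_, ?_, ?_, ?_, ?_, ?_⟩
  · omega
  · rw [List.sum_map_add] at h1
    simp only [List.map_const', List.sum_replicate, smul_eq_mul, mul_one] at h1
    omega
  · rw [List.length_map]
    omega
  · intro v hv
    rw [hitems]
    rcases List.mem_append.1 hv with hv | hv
    · obtain ⟨Q, hQ, hv⟩ := List.mem_flatMap.1 hv
      have := F.right_le Q (hQL Q hQ)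
      simp at hv
      omega
    · exact h3 v hv
  · rw [hL2, List.map_map]; rfl
  · exact hOnd.map_on fun e he e' he' h => hinj e e' ((hOmem e).1 he) ((hOmem e').1 he') h
  · intro v
    rw [hS, List.mem_map]
    simp only [hOmem]
  · intro M D mem hM hD hmem
    rw [hitems] at hM hmem
    rw [h4 M D mem hM hD hmem (by simp [Linked]), hL1]
    simp only [O, List.flatMap_assoc, List.flatMap_map]

end Family

end Sweep

/-! ### Long ends and absent characters -/

section Positions

variable {α : Type*}

theorem exists_drop_of_infix {R S : List α} (h : S <:+: R) : ∃ p, S <+: R.drop p := by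
  obtain ⟨s, t, rfl⟩ := h
  exact ⟨s.length, t, by rw [List.append_assoc, List.drop_left]⟩

theorem getElem?_of_prefix_drop {R S : List α} {p : ℕ} (h : S <+: R.drop p) {j : ℕ}
    (hj : j < S.length) : R[p + j]? = S[j]? := by
  obtain ⟨t, ht⟩ := h
  rw [← List.getElem?_drop, ← ht, List.getElem?_append_left hj]

theorem lt_length_of_prefix_drop {R S : List α} {p : ℕ} (h : S <+: R.drop p) (hS : S ≠ []) :
    p + S.length ≤ R.length := by
  have h1 := h.length_le
  have h2 := List.length_pos_iff.2 hS
  rw [List.length_drop] at h1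
  omega

theorem take_of_prefix_drop {R S V : List α} {p : ℕ} {x : α}
    (h : x :: V ++ S <+: R.drop p) : (R.drop (p + 1)).take V.length = V := by
  obtain ⟨t, ht⟩ := h
  rw [← List.drop_drop, ← ht]
  simp

theorem RunList.glue {U Z : List (α × ℕ)} {d : α} {l : ℕ} (h : RunList (U ++ [(d, l)]))
    (h' : RunList ((d, l) :: Z)) : RunList (U ++ (d, l) :: Z) := by
  refine ⟨fun x hx => ?_, List.isChain_split.2 ⟨h.2, h'.2⟩⟩
  rcases List.mem_append.1 hx with hx | hx
  · exact h.1 x (by simp [hx])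
  · exact h'.1 x hx

theorem sSup_spec {s : Set ℕ} {N : ℕ} (hs : s.Nonempty) (hN : ∀ x ∈ s, x ≤ N) :
    sSup s ∈ s ∧ ∀ k, k ≤ sSup s ↔ ∃ x, k ≤ x ∧ x ∈ s := by
  have h1 := Nat.sSup_mem hs ⟨N, hN⟩
  refine ⟨h1, fun k => ⟨fun h => ⟨_, h, h1⟩, ?_⟩⟩
  rintro ⟨x, hk, hx⟩
  exact hk.trans (le_csSup ⟨N, hN⟩ hx)

theorem exp_le_of_infix {R S : List (α × ℕ)} (h : S <:+: R) {x : α × ℕ} (hx : x ∈ S) :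
    x.2 ≤ (expandRuns R).length :=
  exp_le_length (h.subset hx)

end Positions

section Classes

variable {σ : ℕ} {T : List (Fin σ)}

theorem rleSize_le (T : List (Fin σ)) : rleSize T ≤ T.length := by
  have := length_le_expandRuns (runList_rle T)
  rwa [expandRuns_rle] at this

theorem rleSize_pos (hT : T ≠ []) : 0 < rleSize T := by
  rw [rleSize, List.length_pos_iff]
  intro h
  have := expandRuns_rle T
  rw [h] at this
  exact hT this.symm

/-- A set of few strings that have descriptors is reportable: each of them is a left part, a right
part and a string to be reported. -/
theorem reportable_of_ncard {S : Set (List (Fin σ))} {s : ℕ} (hfin : S.Finite)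
    (hcard : S.ncard ≤ s * rleSize T) (hT : T ≠ [])
    (hdesc : ∀ v ∈ S, ∃ d : Descriptor σ, d.decode (rle T) = some v ∧
      ∀ x ∈ d.toWords, x ≤ 4 * (T.length + σ)) : Reportable T (3 * s) S := by
  classical
  have hpos : 0 < T.length := List.length_pos_iff.2 hT
  have : Nonempty (Descriptor σ) := ⟨T.head hT, 0, 0, 0, 0, 0⟩
  choose! d hd1 hd2 using hdesc
  let F : Family T (List (Fin σ)) (List (Fin σ)) :=
    { Ps := hfin.toFinset
      Qs := hfin.toFinset
      exc := ∅
      rel := fun P Q => P = Q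
      key := fun Q => toLex (Encodable.encode Q, 0)
      a := fun P => (d P).a
      t := fun P => (d P).i
      k := fun P => (d P).k
      r := fun P => (d P).r
      l := fun P => (d P).l
      lo := fun P => (d P).i
      hi := fun P => (d P).i
      p := fun Q => (d Q).p
      bound := fun Q => (d Q).i
      str := fun P _ _ => P
      convex := by
        rintro P x y z h1 h2 rfl rfl
        simpa using le_antisymm h1 h2
      lo_le_hi := fun _ _ => le_rfl
      left_le := by
        intro P hP v hv
        have := hd2 P (hfin.mem_toFinset.1 hP)
        simp only [Descriptor.toWords, List.forall_mem_cons] at this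
        simp at hv
        omega
      right_le := by
        intro Q hQ
        have := hd2 Q (hfin.mem_toFinset.1 hQ)
        simp only [Descriptor.toWords, List.forall_mem_cons] at this
        omega
      total_le := by
        intro P _ Qs' _ hrel
        have hsub : Qs' ⊆ {P} := fun Q hQ => by simp [hrel Q hQ]
        refine (Finset.sum_le_sum_of_subset hsub).trans ?_
        simp
        omega
      exists_desc := by
        rintro P hP Q - i rfl h1 h2 - -
        obtain rfl := le_antisymm h2 h1
        exact ⟨d P, by simp [Descriptor.toWords], hd1 P (hfin.mem_toFinset.1 hP)⟩ }
  refine F.reportable ?_ ?_ ?_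
  · intro v
    constructor
    · intro hv
      have hv' := hfin.mem_toFinset.2 hv
      exact ⟨(v, v, (d v).i), ⟨hv', hv', rfl, le_rfl, le_rfl, le_rfl, by simp [F]⟩, rfl⟩
    · rintro ⟨⟨P, Q, i⟩, h, rfl⟩
      exact hfin.mem_toFinset.1 h.1
  · rintro ⟨P, Q, i⟩ ⟨P', Q', i'⟩ ⟨-, -, hr, h1, h2, -⟩ ⟨-, -, hr', h1', h2', -⟩ h
    have hr : P = Q := hr
    have hr' : P' = Q' := hr'
    have h : P = P' := h
    subst h hr hr'
    have h1 : (d P).i ≤ i := h1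
    have h2 : i ≤ (d P).i := h2
    have h1' : (d P).i ≤ i' := h1'
    have h2' : i' ≤ (d P).i := h2'
    rw [show i = i' by omega]
  · have : hfin.toFinset.card ≤ s * rleSize T := by
      rwa [← Set.ncard_eq_toFinset_card _ hfin]
    simp only [F, Finset.card_empty]
    nlinarith

theorem exists_descriptor_of_mem_longEndMAW (hT : T ≠ []) {w : List (Fin σ)}
    (hw : w ∈ longEndMAW (rle T)) : ∃ d : Descriptor σ, d.decode (rle T) = some w ∧
      ∀ x ∈ d.toWords, x ≤ 4 * (T.length + σ) := by
  have hpos : 0 < T.length := List.length_pos_iff.2 hT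
  have hm := rleSize_le T
  rw [rleSize] at hm
  have hR := runList_rle T
  have hlen : w ∈ MAW (expandRuns (rle T)) → w.length ≤ T.length + 1 := fun h => by
    have := length_le_of_mem_MAW h
    rwa [expandRuns_rle] at this
  rcases hw with ⟨hw, a, k, hk, rfl⟩ | ⟨hw, a, i, V, b, l, hV, rfl, -⟩
  · have := hlen hw
    have := a.isLt
    refine ⟨⟨a, k, 0, 0, 0, 0⟩, rfl, ?_⟩
    simp [Descriptor.toWords] at *
    omega
  · have h1 := hlen hw
    have h2 := inner_infix_of_mem_MAW hV hw
    have ha := a.isLt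
    cases V with
    | nil =>
      have hl : 0 < l := hV.1 (b, l) (by simp)
      simp only [List.nil_append, expandRuns_cons, expandRuns_nil, List.append_nil] at h2
      obtain ⟨y, -, hy⟩ := (replicate_infix_iff hR hl).1 h2
      obtain ⟨p, hp, hpy⟩ := List.getElem_of_mem hy
      refine ⟨⟨a, i, p, 1, l, 0⟩, ?_, ?_⟩
      · simp [Descriptor.decode, List.getElem?_eq_getElem hp, hpy]
      · simp [Descriptor.toWords] at *
        omega
    | cons z V =>
      obtain ⟨c, e⟩ := z
      obtain ⟨x, y, -, -, hxy⟩ := (expandRuns_infix_iff hR hV.tail).1 h2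
      obtain ⟨p, hp⟩ := exists_drop_of_infix hxy
      have e1 := getElem?_of_prefix_drop hp (j := 0) (by simp)
      have e2 := getElem?_of_prefix_drop hp (j := V.length + 1) (by simp)
      have e3 := take_of_prefix_drop hp
      have e4 := lt_length_of_prefix_drop hp (by simp)
      refine ⟨⟨a, i, p, V.length + 2, e, l⟩, ?_, ?_⟩
      · simp only [add_zero, List.cons_append, List.getElem?_cons_zero] at e1
        simp only [List.cons_append, List.getElem?_cons_succ, List.getElem?_concat_length,
          ← add_assoc] at e2
        simp [Descriptor.decode, e1, e2, e3]
      · simp [Descriptor.toWords] at *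
        omega

theorem reportable_longEndMAW (hT : T ≠ []) : Reportable T 27 (longEndMAW (rle T)) := by
  have h := longEndMAW_ncard_le (runList_rle T)
  exact reportable_of_ncard (s := 9) h.1 h.2 hT fun w hw =>
    exists_descriptor_of_mem_longEndMAW hT hw

/-- The characters that do not occur. -/
def absentChars (T : List (Fin σ)) : Set (List (Fin σ)) := {w | w ∈ MAW T ∧ ∃ a, w = [a]}

theorem singleton_mem_MAW_iff {a : Fin σ} : [a] ∈ MAW T ↔ ∀ x, (a, x) ∉ rle T := by
  have := replicate_mem_MAW_iff (runList_rle T) (a := a) one_pos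
  rw [expandRuns_rle] at this
  simp only [List.replicate_one] at this
  rw [this]
  simp only [Nat.not_ofNat_le_one, IsEmpty.forall_iff, and_true, not_exists, not_and]
  refine forall_congr' fun x => ⟨fun h hx => ?_, fun h _ => h⟩
  exact h ((runList_rle T).1 _ hx) hx

/-- Characters that do not occur are found by running through the alphabet, except for the
characters of the runs. -/
theorem reportable_absentChars (hT : T ≠ []) : Reportable T 4 (absentChars T) := by
  classical
  have hσ : 0 < σ := Fin.pos (T.head hT)
  let exc : Finset (Unit × Unit × ℕ) := (rle T).toFinset.image fun x => ((), (), x.1.val)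
  let F : Family T Unit Unit :=
    { Ps := {()}
      Qs := {()}
      exc := exc
      rel := fun _ _ => True
      key := fun _ => toLex (0, 0)
      a := fun _ => 0
      t := fun _ => 0
      k := fun _ => 1
      r := fun _ => 0
      l := fun _ => 0
      lo := fun _ => 0
      hi := fun _ => σ - 1
      p := fun _ => 0
      bound := fun _ => σ - 1
      str := fun _ _ i => if h : i < σ then [⟨i, h⟩] else []
      convex := fun _ _ _ _ _ _ _ _ => trivial
      lo_le_hi := fun _ _ => Nat.zero_le _
      left_le := by
        intro P _ v hv
        simp at hv
        omega
      right_le := by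
        intro Q _
        omega
      total_le := by
        intro P _ Qs' hsub _
        refine (Finset.sum_le_sum_of_subset hsub).trans ?_
        simp
        omega
      exists_desc := by
        intro P _ Q _ i _ _ h _ _
        have hi : i < σ := by omega
        exact ⟨⟨⟨i, hi⟩, 1, 0, 0, i, 0⟩, by simp [Descriptor.toWords],
          by simp [Descriptor.decode, hi]⟩ }
  have hout : ∀ e, F.Out e ↔ ∃ h : e.2.2 < σ, [(⟨e.2.2, h⟩ : Fin σ)] ∈ MAW T := by
    rintro ⟨⟨⟩, ⟨⟩, i⟩
    have hF : F.Out ((), (), i) ↔ i < σ ∧ ((), (), i) ∉ exc := by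
      simp only [Family.Out, F, Finset.mem_singleton, true_and, zero_le]
      rw [← and_assoc, and_self]
      exact and_congr_left fun _ => by omega
    rw [hF, ← exists_prop]
    refine exists_congr fun h => ?_
    rw [singleton_mem_MAW_iff]
    simp only [exc, Finset.mem_image, List.mem_toFinset, Prod.mk.injEq, true_and, not_exists,
      not_and]
    constructor
    · intro h1 x hx
      exact h1 (⟨i, h⟩, x) hx rfl
    · rintro h1 ⟨a, x⟩ hx rfl
      exact h1 x hx
  refine F.reportable ?_ ?_ ?_
  · intro v
    constructor
    · rintro ⟨hv, a, rfl⟩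
      exact ⟨((), (), a), (hout _).2 ⟨a.isLt, hv⟩, by simp [F]⟩
    · rintro ⟨e, he, rfl⟩
      obtain ⟨h, hm⟩ := (hout e).1 he
      simp only [F, h, dite_true]
      exact ⟨hm, _, rfl⟩
  · rintro ⟨⟨⟩, ⟨⟩, i⟩ ⟨⟨⟩, ⟨⟩, i'⟩ h h' heq
    obtain ⟨h, -⟩ := (hout _).1 h
    obtain ⟨h', -⟩ := (hout _).1 h'
    simp only at h h'
    simpa [F, h, h'] using heq
  · have h1 : exc.card ≤ rleSize T := Finset.card_image_le.trans (List.toFinset_card_le _)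
    have h2 := rleSize_pos hT
    simp only [F, Finset.card_singleton]
    omega

end Classes

/-! ### Words of two runs -/

section Pairs

variable {σ : ℕ} {T : List (Fin σ)}

/-- The minimal absent words that consist of two different characters. -/
def pairMAW (T : List (Fin σ)) : Set (List (Fin σ)) :=
  {w | w ∈ MAW T ∧ ∃ a b, a ≠ b ∧ w = expandRuns [(a, 1), (b, 1)]}

theorem pair_mem_MAW_iff' {a b : Fin σ} (hab : a ≠ b) :
    expandRuns [(a, 1), (b, 1)] ∈ MAW T ↔ (¬ ∃ x y, [(a, x), (b, y)] <:+: rle T) ∧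
      (∃ y, (b, y) ∈ rle T) ∧ ∃ x, (a, x) ∈ rle T := by
  have := pair_mem_MAW_iff (runList_rle T) hab
  rwa [expandRuns_rle] at this

theorem mem_range_of_getElem? {α : Type*} {R : List α} {p : ℕ} {x : α} (h : R[p]? = some x) :
    p ∈ Finset.range R.length := by
  rw [Finset.mem_range]
  exact (List.getElem?_eq_some_iff.1 h).1

/-- The words `a b` that do not occur: for each character `a` of the text, the list of all
characters of the text is traversed, skipping `a` and the characters that follow a run of `a`. -/
theorem reportable_pairMAW (hT : T ≠ []) : Reportable T 5 (pairMAW T) := by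
  classical
  have hpos : 0 < T.length := List.length_pos_iff.2 hT
  have hm : (rle T).length ≤ T.length := rleSize_le T
  have hchars := ncard_le_of_rel (A := {a : Fin σ | ∃ x, (a, x) ∈ rle T})
    (S := Finset.range (rle T).length) (fun a p => ∃ x, (rle T)[p]? = some (a, x))
    (by
      rintro a ⟨x, hx⟩
      obtain ⟨p, hp, h⟩ := List.getElem_of_mem hx
      exact ⟨p, by simpa using hp, x, by rw [List.getElem?_eq_getElem hp, h]⟩)
    (by
      rintro a - a' - p ⟨x, h⟩ ⟨x', h'⟩
      rw [h] at h'
      simp only [Option.some.injEq, Prod.mk.injEq] at h'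
      exact h'.1)
  have hexc := ncard_le_of_rel (A := {e : Fin σ × Fin σ × ℕ | e.2.2 = 1 ∧
      ((∃ x, (e.1, x) ∈ rle T) ∧ e.1 = e.2.1 ∨ ∃ x y, [(e.1, x), (e.2.1, y)] <:+: rle T)})
    (S := (Finset.range (rle T).length).disjSum (Finset.range (rle T).length))
    (fun e q => e.2.2 = 1 ∧ match q with
      | .inl p => e.1 = e.2.1 ∧ ∃ x, (rle T)[p]? = some (e.1, x)
      | .inr p => (∃ x, (rle T)[p]? = some (e.1, x)) ∧ ∃ y, (rle T)[p + 1]? = some (e.2.1, y))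
    (by
      rintro ⟨a, b, i⟩ ⟨rfl, ⟨⟨x, hx⟩, hab⟩ | ⟨x, y, hxy⟩⟩
      · obtain rfl : a = b := hab
        obtain ⟨p, hp, h⟩ := List.getElem_of_mem hx
        exact ⟨.inl p, by simpa using hp, rfl, rfl, x, by rw [List.getElem?_eq_getElem hp, h]⟩
      · obtain ⟨p, hp⟩ := exists_drop_of_infix hxy
        have e1 := getElem?_of_prefix_drop hp (j := 0) (by simp)
        have e2 := getElem?_of_prefix_drop hp (j := 1) (by simp)
        simp only [add_zero, List.getElem?_cons_zero, List.getElem?_cons_succ] at e1 e2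
        refine ⟨.inr p, ?_, rfl, ⟨x, e1⟩, y, e2⟩
        rw [Finset.inr_mem_disjSum]
        exact mem_range_of_getElem? e1)
    (by
      rintro ⟨a, b, i⟩ - ⟨a', b', i'⟩ - q ⟨h1, h⟩ ⟨h1', h'⟩
      simp only at h1 h1'
      subst h1 h1'
      cases q with
      | inl p =>
        obtain ⟨hab, x, h⟩ := h
        obtain ⟨hab', x', h'⟩ := h'
        obtain rfl : a = b := hab
        obtain rfl : a' = b' := hab'
        rw [h] at h'
        simp only [Option.some.injEq, Prod.mk.injEq] at h'
        simp [h'.1]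
      | inr p =>
        obtain ⟨⟨x, h⟩, y, h2⟩ := h
        obtain ⟨⟨x', h'⟩, y', h2'⟩ := h'
        rw [h] at h'
        rw [h2] at h2'
        simp only [Option.some.injEq, Prod.mk.injEq] at h' h2'
        simp [h'.1, h2'.1])
  rw [Finset.card_range] at hchars
  rw [Finset.card_disjSum, Finset.card_range, Set.ncard_eq_toFinset_card _ hexc.1] at hexc
  have hcard : hchars.1.toFinset.card ≤ (rle T).length := by
    rw [← Set.ncard_eq_toFinset_card _ hchars.1]
    exact hchars.2
  have hpos' : ∀ b ∈ hchars.1.toFinset, ∃ (p x : ℕ), (rle T)[p]? = some (b, x) := by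
    intro b hb
    obtain ⟨x, hx⟩ := hchars.1.mem_toFinset.1 hb
    obtain ⟨p, hp, h⟩ := List.getElem_of_mem hx
    exact ⟨p, x, by rw [List.getElem?_eq_getElem hp, h]⟩
  choose! pos x hpx using hpos'
  let F : Family T (Fin σ) (Fin σ) :=
    { Ps := hchars.1.toFinset
      Qs := hchars.1.toFinset
      exc := hexc.1.toFinset
      rel := fun _ _ => True
      key := fun _ => toLex (0, 0)
      a := fun a => a
      t := fun _ => 1
      k := fun _ => 1
      r := fun _ => 1
      l := fun _ => 0
      lo := fun _ => 1
      hi := fun _ => 1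
      p := pos
      bound := fun _ => 1
      str := fun a b _ => expandRuns [(a, 1), (b, 1)]
      convex := fun _ _ _ _ _ _ _ _ => trivial
      lo_le_hi := fun _ _ => le_rfl
      left_le := by
        intro a _ v hv
        have := a.isLt
        simp at hv
        omega
      right_le := by
        intro b hb
        have := Finset.mem_range.1 (mem_range_of_getElem? (hpx b hb))
        omega
      total_le := by
        intro P _ Qs' hsub _
        have := Finset.card_le_card hsub
        simp
        omega
      exists_desc := by
        intro a _ b hb i _ h1 h2 _ _
        obtain rfl := le_antisymm h2 h1
        exact ⟨⟨a, 1, pos b, 1, 1, 0⟩, by simp [Descriptor.toWords],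
          by simp [Descriptor.decode, hpx b hb]⟩ }
  have hout : ∀ a b i, F.Out (a, b, i) ↔
      i = 1 ∧ a ≠ b ∧ expandRuns [(a, 1), (b, 1)] ∈ MAW T := by
    intro a b i
    have hF : F.Out (a, b, i) ↔ (∃ x, (a, x) ∈ rle T) ∧ (∃ x, (b, x) ∈ rle T) ∧ i = 1 ∧
        ¬ (i = 1 ∧ ((∃ x, (a, x) ∈ rle T) ∧ a = b ∨ ∃ x y, [(a, x), (b, y)] <:+: rle T)) := by
      simp only [Family.Out, F, Set.Finite.mem_toFinset, Set.mem_ofPred_eq, true_and]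
      constructor
      · rintro ⟨h1, h2, h3, h4, -, h5⟩
        exact ⟨h1, h2, by omega, h5⟩
      · rintro ⟨h1, h2, rfl, h5⟩
        exact ⟨h1, h2, le_rfl, le_rfl, le_rfl, h5⟩
    rw [hF]
    constructor
    · rintro ⟨h1, h2, rfl, h3⟩
      push Not at h3
      obtain ⟨h3, h4⟩ := h3 rfl
      refine ⟨rfl, h3 h1, (pair_mem_MAW_iff' (h3 h1)).2 ⟨?_, h2, h1⟩⟩
      rintro ⟨x, y, h⟩
      exact h4 x y h
    · rintro ⟨rfl, hne, h⟩
      obtain ⟨h1, h2, h3⟩ := (pair_mem_MAW_iff' hne).1 h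
      refine ⟨h3, h2, rfl, ?_⟩
      rintro ⟨-, ⟨-, h⟩ | h⟩
      exacts [hne h, h1 h]
  refine F.reportable ?_ ?_ ?_
  · intro v
    constructor
    · rintro ⟨hv, a, b, hab, rfl⟩
      exact ⟨(a, b, 1), (hout _ _ _).2 ⟨rfl, hab, hv⟩, rfl⟩
    · rintro ⟨⟨a, b, i⟩, he, rfl⟩
      obtain ⟨-, hab, h⟩ := (hout _ _ _).1 he
      exact ⟨h, a, b, hab, rfl⟩
  · rintro ⟨a, b, i⟩ ⟨a', b', i'⟩ h h' heq
    obtain ⟨rfl, -⟩ := (hout _ _ _).1 h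
    obtain ⟨rfl, -⟩ := (hout _ _ _).1 h'
    have heq : expandRuns [(a, 1), (b, 1)] = expandRuns [(a', 1), (b', 1)] := heq
    simp at heq
    simp [heq]
  · simp only [F, rleSize]
    omega

end Pairs

/-! ### Words of three runs -/

section Triples

variable {σ : ℕ} {T : List (Fin σ)}

/-- The minimal absent words with three runs that begin and end with a single character. -/
def tripleMAW (T : List (Fin σ)) : Set (List (Fin σ)) :=
  {w | w ∈ MAW T ∧ ∃ a c k b, a ≠ c ∧ c ≠ b ∧ 0 < k ∧ w = expandRuns [(a, 1), (c, k), (b, 1)]}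

theorem triple_mem_MAW_iff' {a b c : Fin σ} {k : ℕ} (hk : 0 < k) (hac : a ≠ c) (hcb : c ≠ b) :
    expandRuns [(a, 1), (c, k), (b, 1)] ∈ MAW T ↔
      (¬ ∃ x y, [(a, x), (c, k), (b, y)] <:+: rle T) ∧
        (∃ x, k ≤ x ∧ ∃ y, [(c, x), (b, y)] <:+: rle T) ∧
        ∃ x, k ≤ x ∧ ∃ y, [(a, y), (c, x)] <:+: rle T := by
  have := triple_mem_MAW_iff (runList_rle T) hk hac hcb
  rwa [expandRuns_rle] at this

theorem sum_exp_le {α : Type*} (R : List (α × ℕ)) :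
    ∑ p ∈ Finset.range R.length, (R[p]?.map Prod.snd).getD 0 = (expandRuns R).length := by
  induction R with
  | nil => simp
  | cons x R ih =>
    rw [List.length_cons, Finset.sum_range_succ']
    simp [ih, add_comm]

theorem ne_of_infix {a c : Fin σ} {x y : ℕ} (h : [(a, x), (c, y)] <:+: rle T) : a ≠ c :=
  (runList_cons_cons.1 ((runList_rle T).infix h)).2.1

/-- The words `a c ^ k b`: for each character `a` before a run of `c`, the characters `b` after runs
of `c` are traversed, and for each of them the exponents `k` up to the bounds given by the longest
run of `c` after `a` and the longest run of `c` before `b`. There may be far more of these words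
than runs, but at most as many exceptions. -/
theorem reportable_tripleMAW (hT : T ≠ []) : Reportable T 4 (tripleMAW T) := by
  classical
  have hpos : 0 < T.length := List.length_pos_iff.2 hT
  have hm : (rle T).length ≤ T.length := rleSize_le T
  have hexp : ∀ {S : List (Fin σ × ℕ)}, S <:+: rle T → ∀ x ∈ S, x.2 ≤ T.length := by
    intro S hS x hx
    have := exp_le_of_infix hS hx
    rwa [expandRuns_rle] at this
  -- A left part `(c, a)` stands for `a` before a run of `c`, a right part `(c, b)` for `b` after it.
  let L : Fin σ × Fin σ → Set ℕ := fun P => {x | ∃ y, [(P.2, y), (P.1, x)] <:+: rle T}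
  let R : Fin σ × Fin σ → Set ℕ := fun Q => {x | ∃ y, [(Q.1, x), (Q.2, y)] <:+: rle T}
  let X : Set ((Fin σ × Fin σ) × (Fin σ × Fin σ) × ℕ) := {e | e.1.1 = e.2.1.1 ∧
    ∃ x y, [(e.1.2, x), (e.1.1, e.2.2), (e.2.1.2, y)] <:+: rle T}
  have two : ∀ {a b : Fin σ} {x y : ℕ}, [(a, x), (b, y)] <:+: rle T →
      ∃ p ∈ Finset.range (rle T).length, (rle T)[p]? = some (a, x) ∧
        (rle T)[p + 1]? = some (b, y) := by
    intro a b x y h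
    obtain ⟨p, hp⟩ := exists_drop_of_infix h
    have e1 := getElem?_of_prefix_drop hp (j := 0) (by simp)
    have e2 := getElem?_of_prefix_drop hp (j := 1) (by simp)
    simp only [add_zero, List.getElem?_cons_zero, List.getElem?_cons_succ] at e1 e2
    exact ⟨p, mem_range_of_getElem? e1, e1, e2⟩
  have hL := ncard_le_of_rel (A := {P | (L P).Nonempty}) (S := Finset.range (rle T).length)
    (fun P p => ∃ y x, (rle T)[p]? = some (P.2, y) ∧ (rle T)[p + 1]? = some (P.1, x))
    (by
      rintro P ⟨x, y, h⟩
      obtain ⟨p, hp, h⟩ := two h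
      exact ⟨p, hp, y, x, h⟩)
    (by
      rintro ⟨c, a⟩ - ⟨c', a'⟩ - p ⟨y, x, h1, h2⟩ ⟨y', x', h1', h2'⟩
      rw [h1] at h1'
      rw [h2] at h2'
      simp only [Option.some.injEq, Prod.mk.injEq] at h1' h2'
      rw [h1'.1, h2'.1])
  have hR := ncard_le_of_rel (A := {Q | (R Q).Nonempty}) (S := Finset.range (rle T).length)
    (fun Q p => ∃ x y, (rle T)[p]? = some (Q.1, x) ∧ (rle T)[p + 1]? = some (Q.2, y))
    (by
      rintro Q ⟨x, y, h⟩
      obtain ⟨p, hp, h⟩ := two h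
      exact ⟨p, hp, x, y, h⟩)
    (by
      rintro ⟨c, a⟩ - ⟨c', a'⟩ - p ⟨y, x, h1, h2⟩ ⟨y', x', h1', h2'⟩
      rw [h1] at h1'
      rw [h2] at h2'
      simp only [Option.some.injEq, Prod.mk.injEq] at h1' h2'
      rw [h1'.1, h2'.1])
  have hX := ncard_le_of_rel (A := X) (S := Finset.range (rle T).length)
    (fun e p => e.1.1 = e.2.1.1 ∧ ∃ x y, [(e.1.2, x), (e.1.1, e.2.2), (e.2.1.2, y)] <+:
      (rle T).drop p)
    (by
      rintro e ⟨he, x, y, h⟩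
      obtain ⟨p, hp⟩ := exists_drop_of_infix h
      refine ⟨p, ?_, he, x, y, hp⟩
      have := lt_length_of_prefix_drop hp (by simp)
      simp at this ⊢
      omega)
    (by
      rintro ⟨⟨c, a⟩, ⟨c', b⟩, i⟩ - ⟨⟨e, a'⟩, ⟨e', b'⟩, i'⟩ - p ⟨h1, x, y, h⟩ ⟨h1', x', y', h'⟩
      simp only at h1 h1' h h'
      have := List.prefix_of_prefix_length_le h h' (by simp)
      simp at this
      obtain ⟨⟨rfl, -⟩, ⟨rfl, rfl⟩, rfl, -⟩ := this
      subst h1 h1'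
      rfl)
  rw [Finset.card_range, Set.ncard_eq_toFinset_card _ hL.1] at hL
  rw [Finset.card_range, Set.ncard_eq_toFinset_card _ hR.1] at hR
  rw [Finset.card_range, Set.ncard_eq_toFinset_card _ hX.1] at hX
  have hLle : ∀ P, ∀ x ∈ L P, x ≤ T.length := by
    rintro P x ⟨y, h⟩
    exact hexp h (P.1, x) (by simp)
  have hRle : ∀ Q, ∀ x ∈ R Q, x ≤ T.length := by
    rintro Q x ⟨y, h⟩
    exact hexp h (Q.1, x) (by simp)
  have hLpos : ∀ P, ∀ x ∈ L P, 0 < x := by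
    rintro P x ⟨y, h⟩
    exact (runList_rle T).pos_of_infix h (x := (P.1, x)) (by simp)
  have hpos' : ∀ Q ∈ hR.1.toFinset, ∃ p ∈ Finset.range (rle T).length,
      (rle T)[p]? = some (Q.1, sSup (R Q)) ∧ ∃ y, (rle T)[p + 1]? = some (Q.2, y) := by
    intro Q hQ
    obtain ⟨y, h⟩ := (sSup_spec (hR.1.mem_toFinset.1 hQ) (hRle Q)).1
    obtain ⟨p, hp, h1, h2⟩ := two h
    exact ⟨p, hp, h1, y, h2⟩
  choose! pos hp1 hp2 y hp3 using hpos'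
  let F : Family T (Fin σ × Fin σ) (Fin σ × Fin σ) :=
    { Ps := hL.1.toFinset
      Qs := hR.1.toFinset
      exc := hX.1.toFinset
      rel := fun P Q => P.1 = Q.1
      key := fun Q => toLex (Q.1.val, 0)
      a := fun P => P.2
      t := fun P => sSup (L P)
      k := fun _ => 1
      r := fun _ => 2
      l := fun _ => 1
      lo := fun _ => 1
      hi := fun P => sSup (L P)
      p := pos
      bound := fun Q => sSup (R Q)
      str := fun P Q i => expandRuns [(P.2, 1), (P.1, i), (Q.2, 1)]
      convex := by
        rintro P x y z h1 h2 h3 h4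
        have e1 : x.1.val ≤ y.1.val := by
          rw [Prod.Lex.toLex_le_toLex] at h1; omega
        have e2 : y.1.val ≤ z.1.val := by
          rw [Prod.Lex.toLex_le_toLex] at h2; omega
        rw [h3]
        rw [← h4, h3] at e2
        exact Fin.ext (le_antisymm e1 e2)
      lo_le_hi := fun P hP => hLpos P _ (sSup_spec (hL.1.mem_toFinset.1 hP) (hLle P)).1
      left_le := by
        intro P hP v hv
        have := P.2.isLt
        have := hLle P _ (sSup_spec (hL.1.mem_toFinset.1 hP) (hLle P)).1
        simp at hv
        omega
      right_le := by
        intro Q hQ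
        have := Finset.mem_range.1 (hp1 Q hQ)
        have := hRle Q _ (sSup_spec (hR.1.mem_toFinset.1 hQ) (hRle Q)).1
        omega
      total_le := by
        -- The runs of `c` chosen for different `b` are different runs of the text.
        intro P _ Qs' hsub hrel
        have hinj : Set.InjOn pos Qs' := by
          intro Q hQ Q' hQ' h
          have h1 := hp3 Q (hsub hQ)
          rw [h, hp3 Q' (hsub hQ')] at h1
          simp only [Option.some.injEq, Prod.mk.injEq] at h1
          exact Prod.ext ((hrel Q hQ).symm.trans (hrel Q' hQ')) h1.1.symm
        calc ∑ Q ∈ Qs', (min (sSup (L P)) (sSup (R Q)) + 1 - 1)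
            ≤ ∑ Q ∈ Qs', ((rle T)[pos Q]?.map Prod.snd).getD 0 := by
              refine Finset.sum_le_sum fun Q hQ => ?_
              rw [hp2 Q (hsub hQ)]
              simp
          _ = ∑ p ∈ Qs'.image pos, ((rle T)[p]?.map Prod.snd).getD 0 := by
              rw [Finset.sum_image hinj]
          _ ≤ ∑ p ∈ Finset.range (rle T).length, ((rle T)[p]?.map Prod.snd).getD 0 := by
              refine Finset.sum_le_sum_of_subset fun p hp => ?_
              obtain ⟨Q, hQ, rfl⟩ := Finset.mem_image.1 hp
              exact hp1 Q (hsub hQ)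
          _ ≤ 4 * (T.length + σ) := by
              rw [sum_exp_le, expandRuns_rle]
              omega
      exists_desc := by
        intro P hP Q hQ i hrel h1 h2 h3 _
        refine ⟨⟨P.2, 1, pos Q, 2, i, 1⟩, ?_, ?_⟩
        · simp [Descriptor.toWords]
          omega
        · have hrel : P.1 = Q.1 := hrel
          simp [Descriptor.decode, hp2 Q hQ, hp3 Q hQ, hrel] }
  have hout : ∀ c a c' b i, F.Out ((c, a), (c', b), i) ↔ c = c' ∧ 0 < i ∧ a ≠ c ∧ c ≠ b ∧
      expandRuns [(a, 1), (c, i), (b, 1)] ∈ MAW T := by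
    intro c a c' b i
    simp only [Family.Out, F, Set.Finite.mem_toFinset, Set.mem_ofPred_eq]
    constructor
    · rintro ⟨h1, h2, rfl, h3, h4, h5, h6⟩
      rw [(sSup_spec h1 (hLle _)).2] at h4
      rw [(sSup_spec h2 (hRle _)).2] at h5
      obtain ⟨x, hx, y, h⟩ := h4
      obtain ⟨x', hx', y', h'⟩ := h5
      have hac := ne_of_infix h
      have hcb := ne_of_infix h'
      refine ⟨rfl, h3, hac, hcb, (triple_mem_MAW_iff' h3 hac hcb).2
        ⟨?_, ⟨x', hx', y', h'⟩, x, hx, y, h⟩⟩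
      rintro ⟨u, v, huv⟩
      exact h6 ⟨rfl, u, v, huv⟩
    · rintro ⟨rfl, h1, hac, hcb, h⟩
      obtain ⟨h2, ⟨x', hx', h'⟩, x, hx, h⟩ := (triple_mem_MAW_iff' h1 hac hcb).1 h
      have n1 : (L (c, a)).Nonempty := ⟨x, h⟩
      have n2 : (R (c, b)).Nonempty := ⟨x', h'⟩
      refine ⟨n1, n2, rfl, h1, ((sSup_spec n1 (hLle _)).2 i).2 ⟨x, hx, h⟩,
        ((sSup_spec n2 (hRle _)).2 i).2 ⟨x', hx', h'⟩, ?_⟩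
      rintro ⟨-, huv⟩
      exact h2 huv
  refine F.reportable ?_ ?_ ?_
  · intro v
    constructor
    · rintro ⟨hv, a, c, k, b, hac, hcb, hk, rfl⟩
      exact ⟨((c, a), (c, b), k), (hout _ _ _ _ _).2 ⟨rfl, hk, hac, hcb, hv⟩, rfl⟩
    · rintro ⟨⟨⟨c, a⟩, ⟨c', b⟩, i⟩, he, rfl⟩
      obtain ⟨-, hi, hac, hcb, h⟩ := (hout _ _ _ _ _).1 he
      exact ⟨h, a, c, i, b, hac, hcb, hi, rfl⟩
  · rintro ⟨⟨c, a⟩, ⟨c', b⟩, i⟩ ⟨⟨e, a'⟩, ⟨e', b'⟩, i'⟩ h h' heq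
    obtain ⟨rfl, hi, hac, hcb, -⟩ := (hout _ _ _ _ _).1 h
    obtain ⟨rfl, hi', hac', hcb', -⟩ := (hout _ _ _ _ _).1 h'
    have := expandRuns_injOn (by simp [runList_cons_cons, runList_singleton, hac, hcb, hi])
      (by simp [runList_cons_cons, runList_singleton, hac', hcb', hi']) heq
    simp at this
    obtain ⟨rfl, ⟨rfl, rfl⟩, rfl⟩ := this
    rfl
  · simp only [F, rleSize]
    omega

end Triples

/-! ### Words of at least four runs -/

section LongWords

variable {σ : ℕ} {T : List (Fin σ)}

/-- The minimal absent words with at least four runs that begin and end with a single character. -/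
def longMAW (T : List (Fin σ)) : Set (List (Fin σ)) :=
  {w | w ∈ MAW T ∧ ∃ a c i V d l b, RunList ((a, 1) :: (c, i) :: V ++ [(d, l), (b, 1)]) ∧
    w = expandRuns ((a, 1) :: (c, i) :: V ++ [(d, l), (b, 1)])}

/-- A context: complete runs between a run of a known character on either side. -/
abbrev Context (σ : ℕ) : Type := Fin σ × List (Fin σ × ℕ) × Fin σ

/-- The text has a run of the character `P.2.1`, a run of exponent `P.2.2` that begins the context
`P.1`, and a run of exponent `y` at the end of this context. -/
def LeftOcc (T : List (Fin σ)) (P : Context σ × Fin σ × ℕ) (y : ℕ) : Prop :=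
  ∃ x, (P.2.1, x) :: (P.1.1, P.2.2) :: P.1.2.1 ++ [(P.1.2.2, y)] <:+: rle T

/-- The text has a run of exponent `x` at the beginning of the context `Q.1`, a run of exponent
`Q.2.1` at its end, and then a run of the character `Q.2.2`. -/
def RightOcc (T : List (Fin σ)) (Q : Context σ × ℕ × Fin σ) (x : ℕ) : Prop :=
  ∃ y, (Q.1.1, x) :: Q.1.2.1 ++ [(Q.1.2.2, Q.2.1), (Q.2.2, y)] <:+: rle T

/-- The two parts occur together. -/
def JointOcc (T : List (Fin σ)) (P : Context σ × Fin σ × ℕ) (Q : Context σ × ℕ × Fin σ) : Prop :=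
  P.1 = Q.1 ∧ ∃ x y, (P.2.1, x) :: (P.1.1, P.2.2) :: P.1.2.1 ++
    [(P.1.2.2, Q.2.1), (Q.2.2, y)] <:+: rle T

/-- The runs of the string composed of the two parts. -/
def joinParts (P : Context σ × Fin σ × ℕ) (Q : Context σ × ℕ × Fin σ) : List (Fin σ × ℕ) :=
  (P.2.1, 1) :: (P.1.1, P.2.2) :: P.1.2.1 ++ [(P.1.2.2, Q.2.1), (Q.2.2, 1)]

/-- The two parts compose to a minimal absent word. -/
def JoinAbsent (T : List (Fin σ)) (P : Context σ × Fin σ × ℕ) (Q : Context σ × ℕ × Fin σ) :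
    Prop :=
  P.1 = Q.1 ∧ (∃ y, Q.2.1 ≤ y ∧ LeftOcc T P y) ∧ (∃ x, P.2.2 ≤ x ∧ RightOcc T Q x) ∧
    ¬ JointOcc T P Q

theorem runList_joinParts {P : Context σ × Fin σ × ℕ} {Q : Context σ × ℕ × Fin σ} (h : P.1 = Q.1)
    {x y : ℕ} (hP : LeftOcc T P y) (hQ : RightOcc T Q x) : RunList (joinParts P Q) := by
  obtain ⟨⟨c, V, d⟩, a, i⟩ := P
  obtain ⟨g, l, b⟩ := Q
  obtain rfl : (c, V, d) = g := h
  obtain ⟨u, hP⟩ := hP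
  obtain ⟨v, hQ⟩ := hQ
  simp only at hP hQ
  have h1 := (runList_rle T).infix hP
  have h2 : RunList ((c, x) :: V ++ [(d, l), (b, v)]) := (runList_rle T).infix hQ
  have h3 : RunList [(d, l), (b, v)] := h2.infix (List.suffix_append ((c, x) :: V) _).isInfix
  have h4 : RunList [(d, l), (b, 1)] := RunList.change_last (R := [(d, l)]) h3 one_pos
  have h5 : RunList (((a, u) :: (c, i) :: V) ++ [(d, l)]) := RunList.change_last h1 h3.head_pos
  exact (RunList.glue h5 h4).change_head one_pos

theorem joinParts_mem_MAW_iff {P : Context σ × Fin σ × ℕ} {Q : Context σ × ℕ × Fin σ}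
    (h : P.1 = Q.1) (hV : RunList (joinParts P Q)) :
    expandRuns (joinParts P Q) ∈ MAW T ↔ JoinAbsent T P Q := by
  have := long_mem_MAW_iff (runList_rle T) hV
  rw [expandRuns_rle] at this
  rw [joinParts, this]
  simp only [JoinAbsent, LeftOcc, RightOcc, JointOcc, h, true_and]
  tauto

theorem joinParts_inj {P P' : Context σ × Fin σ × ℕ} {Q Q' : Context σ × ℕ × Fin σ}
    (h : P.1 = Q.1) (h' : P'.1 = Q'.1) (heq : joinParts P Q = joinParts P' Q') :
    P = P' ∧ Q = Q' := by
  obtain ⟨⟨c, V, d⟩, a, i⟩ := P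
  obtain ⟨g, l, b⟩ := Q
  obtain ⟨⟨c', V', d'⟩, a', i'⟩ := P'
  obtain ⟨g', l', b'⟩ := Q'
  obtain rfl : (c, V, d) = g := h
  obtain rfl : (c', V', d') = g' := h'
  simp only [joinParts] at heq
  have := List.append_inj' heq rfl
  simp only [List.cons.injEq, Prod.mk.injEq, and_true] at this
  obtain ⟨⟨rfl, ⟨rfl, rfl⟩, rfl⟩, ⟨rfl, rfl⟩, rfl⟩ := this
  exact ⟨rfl, rfl⟩

/-- A right part of a minimal absent word is a branching continuation of its context: the context
also occurs after the left part. -/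
theorem rightParts_ncard_le (T : List (Fin σ)) :
    {Q | ∃ P, JoinAbsent T P Q}.Finite ∧ {Q | ∃ P, JoinAbsent T P Q}.ncard ≤ 2 * rleSize T := by
  obtain ⟨hfin, hcard⟩ := rightBranching_ncard_le (rle T)
  rw [Set.ncard_eq_toFinset_card _ hfin] at hcard
  have := ncard_le_of_rel (A := {Q | ∃ P, JoinAbsent T P Q}) (S := hfin.toFinset)
    (fun Q e => e = (Q.1.1, Q.1.2.1, Q.1.2.2, Q.2.1, some Q.2.2))
    (by
      rintro ⟨g, l, b⟩ ⟨⟨⟨c, V, d⟩, a, i⟩, h, ⟨y, -, u, hu⟩, ⟨x, -, v, hv⟩, h1⟩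
      obtain rfl : (c, V, d) = g := h
      refine ⟨_, hfin.mem_toFinset.2 ?_, rfl⟩
      refine mem_rightBranching (Y := [(a, u)]) hv hu fun z hz => h1 ⟨rfl, u, z, hz⟩)
    (by
      rintro ⟨⟨c, V, d⟩, l, b⟩ - ⟨⟨c', V', d'⟩, l', b'⟩ - e rfl h
      simpa [and_assoc] using h)
  exact ⟨this.1, this.2.trans hcard⟩

/-- The mirror image of `rightParts_ncard_le`. -/
theorem leftParts_ncard_le (T : List (Fin σ)) :
    {P | ∃ Q, JoinAbsent T P Q}.Finite ∧ {P | ∃ Q, JoinAbsent T P Q}.ncard ≤ 2 * rleSize T := by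
  obtain ⟨hfin, hcard⟩ := rightBranching_ncard_le (rle T).reverse
  rw [Set.ncard_eq_toFinset_card _ hfin, List.length_reverse] at hcard
  have := ncard_le_of_rel (A := {P | ∃ Q, JoinAbsent T P Q}) (S := hfin.toFinset)
    (fun P e => e = (P.1.2.2, P.1.2.1.reverse, P.1.1, P.2.2, some P.2.1))
    (by
      rintro ⟨⟨c, V, d⟩, a, i⟩ ⟨⟨g, l, b⟩, h, ⟨y, -, u, hu⟩, ⟨x, -, v, hv⟩, h1⟩
      obtain rfl : (c, V, d) = g := h
      refine ⟨_, hfin.mem_toFinset.2 ?_, rfl⟩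
      simp only at hu hv ⊢
      refine mem_rightBranching (Y := [(b, v)]) (x := y) (y := u) (x' := l) (y' := x)
        ?_ ?_ fun z hz => h1 ⟨rfl, z, v, ?_⟩
      · rw [← List.reverse_infix]; simpa using hu
      · rw [← List.reverse_infix]; simpa using hv
      · rw [← List.reverse_infix] at hz; simpa using hz)
    (by
      rintro ⟨⟨c, V, d⟩, a, i⟩ - ⟨⟨c', V', d'⟩, a', i'⟩ - e rfl h
      simp only [Prod.mk.injEq, List.reverse_inj, Option.some.injEq] at h
      obtain ⟨rfl, rfl, rfl, rfl, rfl⟩ := h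
      rfl)
  exact ⟨this.1, this.2.trans hcard⟩

/-- The joint occurrences that involve a left part of a minimal absent word. -/
def jointParts (T : List (Fin σ)) : Set ((Context σ × Fin σ × ℕ) × (Context σ × ℕ × Fin σ) × ℕ) :=
  {e | (∃ Q, JoinAbsent T e.1 Q) ∧ e.2.2 = e.1.2.2 ∧ JointOcc T e.1 e.2.1}

/-- A left part that has a single continuation in the text is charged itself; the continuations of
the other left parts are branching. -/
theorem jointParts_ncard_le (T : List (Fin σ)) :
    (jointParts T).Finite ∧ (jointParts T).ncard ≤ 4 * rleSize T := by
  classical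
  obtain ⟨hfin, hcard⟩ := rightBranching_ncard_le (rle T)
  rw [Set.ncard_eq_toFinset_card _ hfin] at hcard
  obtain ⟨hfin', hcard'⟩ := leftParts_ncard_le T
  rw [Set.ncard_eq_toFinset_card _ hfin'] at hcard'
  have item : ∀ {P Q}, JointOcc T P Q → P.1 = Q.1 ∧ RightItem (rle T) P.2.1
      ((P.1.1, P.2.2) :: P.1.2.1) P.1.2.2 Q.2.1 (some Q.2.2) := by
    rintro P Q ⟨h, x, y, hxy⟩
    exact ⟨h, rightItem_of_infix hxy⟩
  have := ncard_le_of_rel (A := jointParts T) (S := hfin'.toFinset.disjSum hfin.toFinset)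
    (fun e q => match q with
      | .inl P => P = e.1 ∧ ∀ l b, RightItem (rle T) P.2.1 ((P.1.1, P.2.2) :: P.1.2.1) P.1.2.2 l b →
          (l, b) = (e.2.1.2.1, some e.2.1.2.2)
      | .inr q => q = (e.1.2.1, (e.1.1.1, e.1.2.2) :: e.1.1.2.1, e.1.1.2.2, e.2.1.2.1,
          some e.2.1.2.2))
    (by
      rintro ⟨P, Q, i⟩ ⟨h1, -, h2⟩
      by_cases h : ∀ l b, RightItem (rle T) P.2.1 ((P.1.1, P.2.2) :: P.1.2.1) P.1.2.2 l b →
          (l, b) = (Q.2.1, some Q.2.2)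
      · exact ⟨.inl P, by simpa using h1, rfl, h⟩
      · push Not at h
        obtain ⟨l, b, h3, h4⟩ := h
        refine ⟨.inr _, ?_, rfl⟩
        rw [Finset.inr_mem_disjSum, hfin.mem_toFinset]
        exact ⟨(item h2).2, l, b, h4, h3⟩)
    (by
      rintro ⟨P, Q, i⟩ ⟨-, hi, h⟩ ⟨P', Q', i'⟩ ⟨-, hi', h'⟩ q hq hq'
      simp only at hi hi' h h'
      have key : P = P' ∧ Q.2 = Q'.2 := by
        cases q with
        | inl q =>
          obtain ⟨rfl, hq⟩ := hq
          obtain ⟨rfl, hq'⟩ := hq'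
          have := hq' _ _ (item h).2
          simp only [Prod.mk.injEq, Option.some.injEq] at this
          exact ⟨rfl, Prod.ext this.1 this.2⟩
        | inr q =>
          simp only at hq hq'
          rw [hq] at hq'
          simp only [Prod.mk.injEq, List.cons.injEq, Option.some.injEq] at hq'
          obtain ⟨h1, ⟨⟨h2, h3⟩, h4⟩, h5, h6, h7⟩ := hq'
          exact ⟨Prod.ext (Prod.ext h2 (Prod.ext h4 h5)) (Prod.ext h1 h3), Prod.ext h6 h7⟩
      obtain ⟨rfl, hQ⟩ := key
      have : Q = Q' := Prod.ext ((item h).1.symm.trans (item h').1) hQ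
      rw [this, hi, hi'])
  rw [Finset.card_disjSum] at this
  rw [rleSize] at *
  exact ⟨this.1, by omega⟩

/-- The words `a U b` for strings `U` of at least two runs: the left part consists of `a` and the
exponent of the first run of `U`, the right part of the exponent of the last run of `U` and `b`. The
word occurs up to its last character if the last run is not too long for the left part, and from its
second character on if the first run is not too long for the right part. -/
theorem reportable_longMAW (hT : T ≠ []) : Reportable T 10 (longMAW T) := by
  classical
  have hpos : 0 < T.length := List.length_pos_iff.2 hT
  have hm : (rle T).length ≤ T.length := rleSize_le T
  have hexp : ∀ {S : List (Fin σ × ℕ)}, S <:+: rle T → ∀ x ∈ S, x.2 ≤ T.length := by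
    intro S hS x hx
    have := exp_le_of_infix hS hx
    rwa [expandRuns_rle] at this
  obtain ⟨hL, hLcard⟩ := leftParts_ncard_le T
  obtain ⟨hR, hRcard⟩ := rightParts_ncard_le T
  obtain ⟨hX, hXcard⟩ := jointParts_ncard_le T
  rw [Set.ncard_eq_toFinset_card _ hL] at hLcard
  rw [Set.ncard_eq_toFinset_card _ hR] at hRcard
  rw [Set.ncard_eq_toFinset_card _ hX] at hXcard
  have hLle : ∀ P y, LeftOcc T P y → y ≤ T.length := by
    rintro P y ⟨x, h⟩
    exact hexp h (P.1.2.2, y) (by simp)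
  have hRle : ∀ Q x, RightOcc T Q x → x ≤ T.length := by
    rintro Q x ⟨y, h⟩
    exact hexp h (Q.1.1, x) (by simp)
  have hLspec : ∀ P ∈ hL.toFinset, LeftOcc T P (sSup {y | LeftOcc T P y}) ∧
      ∀ k, k ≤ sSup {y | LeftOcc T P y} ↔ ∃ y, k ≤ y ∧ LeftOcc T P y := by
    intro P hP
    obtain ⟨Q, -, ⟨y, -, hy⟩, -⟩ := hL.mem_toFinset.1 hP
    exact sSup_spec ⟨y, hy⟩ (hLle P)
  have hRspec : ∀ Q ∈ hR.toFinset, RightOcc T Q (sSup {x | RightOcc T Q x}) ∧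
      ∀ k, k ≤ sSup {x | RightOcc T Q x} ↔ ∃ x, k ≤ x ∧ RightOcc T Q x := by
    intro Q hQ
    obtain ⟨P, -, -, ⟨x, -, hx⟩, -⟩ := hR.mem_toFinset.1 hQ
    exact sSup_spec ⟨x, hx⟩ (hRle Q)
  have hpos' : ∀ Q ∈ hR.toFinset, ∃ p y, (Q.1.1, sSup {x | RightOcc T Q x}) :: Q.1.2.1 ++
      [(Q.1.2.2, Q.2.1), (Q.2.2, y)] <+: (rle T).drop p := by
    intro Q hQ
    obtain ⟨y, h⟩ := (hRspec Q hQ).1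
    obtain ⟨p, hp⟩ := exists_drop_of_infix h
    exact ⟨p, y, hp⟩
  choose! pos y hp using hpos'
  let F : Family T (Context σ × Fin σ × ℕ) (Context σ × ℕ × Fin σ) :=
    { Ps := hL.toFinset
      Qs := hR.toFinset
      exc := hX.toFinset
      rel := fun P Q => P.1 = Q.1 ∧ Q.2.1 ≤ sSup {y | LeftOcc T P y}
      key := fun Q => toLex (Encodable.encode Q.1, Q.2.1)
      a := fun P => P.2.1
      t := fun P => P.2.2
      k := fun _ => 1
      r := fun P => P.1.2.1.length + 3
      l := fun _ => 1
      lo := fun P => P.2.2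
      hi := fun P => P.2.2
      p := pos
      bound := fun Q => sSup {x | RightOcc T Q x}
      str := fun P Q _ => expandRuns (joinParts P Q)
      convex := by
        rintro P x y z h1 h2 ⟨h3, h4⟩ ⟨h5, h6⟩
        rw [Prod.Lex.toLex_le_toLex] at h1 h2
        simp only at h1 h2
        rw [← h3] at h1
        rw [← h5] at h2
        have e : Encodable.encode P.1 = Encodable.encode y.1 := by omega
        exact ⟨Encodable.encode_injective e, by omega⟩
      lo_le_hi := fun _ _ => le_rfl
      left_le := by
        intro P hP v hv
        have h1 := P.2.1.isLt
        obtain ⟨x, h⟩ := (hLspec P hP).1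
        have h2 := hexp h (P.1.1, P.2.2) (by simp)
        have h3 := h.length_le
        simp at h3 hv
        simp only at h2
        omega
      right_le := by
        intro Q hQ
        have h1 := lt_length_of_prefix_drop (hp Q hQ) (by simp)
        have h2 := hRle Q _ (hRspec Q hQ).1
        omega
      total_le := by
        intro P _ Qs' hsub _
        have h1 := Finset.card_le_card hsub
        calc ∑ Q ∈ Qs', (min P.2.2 (sSup {x | RightOcc T Q x}) + 1 - P.2.2)
            ≤ ∑ Q ∈ Qs', 1 := Finset.sum_le_sum fun Q _ => by omega
          _ ≤ 4 * (T.length + σ) := by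
              rw [rleSize] at hRcard
              simp
              omega
      exists_desc := by
        rintro ⟨⟨c, V, d⟩, a, i'⟩ hP ⟨g, l, b⟩ hQ i ⟨hrel, -⟩ h1 h2 h3 _
        obtain rfl : (c, V, d) = g := hrel
        obtain rfl : i = i' := le_antisymm h2 h1
        have h := hp _ hQ
        have e1 := getElem?_of_prefix_drop h (j := 0) (by simp)
        have e2 := getElem?_of_prefix_drop h (j := V.length + 2) (by simp)
        have h' : (c, sSup {x | RightOcc T ((c, V, d), l, b) x}) :: (V ++ [(d, l)]) ++
            [(b, y ((c, V, d), l, b))] <+: (rle T).drop (pos ((c, V, d), l, b)) := by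
          simpa using h
        have e3 := take_of_prefix_drop h'
        refine ⟨⟨a, 1, pos ((c, V, d), l, b), V.length + 3, i, 1⟩, ?_, ?_⟩
        · simp [Descriptor.toWords]
        · simp only [add_zero, List.cons_append, List.getElem?_cons_zero] at e1
          have e2 : (rle T)[pos ((c, V, d), l, b) + (V.length + 1) + 1]? =
              some (b, y ((c, V, d), l, b)) := by
            rw [show pos ((c, V, d), l, b) + (V.length + 1) + 1 =
              pos ((c, V, d), l, b) + (V.length + 2) by omega, e2]
            simp
          simp only [List.length_append, List.length_singleton] at e3
          simp [Descriptor.decode, e1, e2, e3, joinParts] }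
  have hout : ∀ P Q i, F.Out (P, Q, i) ↔ i = P.2.2 ∧ JoinAbsent T P Q := by
    intro P Q i
    constructor
    · rintro ⟨h1, h2, ⟨h3, h4⟩, h5, h6, h7, h8⟩
      obtain rfl : i = P.2.2 := le_antisymm h6 h5
      refine ⟨rfl, h3, ((hLspec P h1).2 _).1 h4, ((hRspec Q h2).2 _).1 h7, fun hj => h8 ?_⟩
      exact hX.mem_toFinset.2 ⟨hL.mem_toFinset.1 h1, rfl, hj⟩
    · rintro ⟨rfl, h⟩
      have h1 : P ∈ hL.toFinset := hL.mem_toFinset.2 ⟨Q, h⟩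
      have h2 : Q ∈ hR.toFinset := hR.mem_toFinset.2 ⟨P, h⟩
      refine ⟨h1, h2, ⟨h.1, ((hLspec P h1).2 _).2 h.2.1⟩, le_rfl, le_rfl,
        ((hRspec Q h2).2 _).2 h.2.2.1, fun hj => ?_⟩
      exact h.2.2.2 (hX.mem_toFinset.1 hj).2.2
  have hvalid : ∀ {P Q}, JoinAbsent T P Q → RunList (joinParts P Q) := by
    rintro P Q ⟨h, ⟨y, -, hy⟩, ⟨x, -, hx⟩, -⟩
    exact runList_joinParts h hy hx
  refine F.reportable ?_ ?_ ?_
  · intro v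
    constructor
    · rintro ⟨hv, a, c, i, V, d, l, b, hV, rfl⟩
      exact ⟨(((c, V, d), a, i), ((c, V, d), l, b), i), (hout _ _ _).2 ⟨rfl,
        (joinParts_mem_MAW_iff (P := ((c, V, d), a, i)) (Q := ((c, V, d), l, b)) rfl hV).1 hv⟩,
        rfl⟩
    · rintro ⟨⟨P, Q, i⟩, he, rfl⟩
      obtain ⟨-, h⟩ := (hout _ _ _).1 he
      exact ⟨(joinParts_mem_MAW_iff h.1 (hvalid h)).2 h, _, _, _, _, _, _, _, hvalid h, rfl⟩
  · rintro ⟨P, Q, i⟩ ⟨P', Q', i'⟩ h h' heq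
    obtain ⟨rfl, hj⟩ := (hout _ _ _).1 h
    obtain ⟨rfl, hj'⟩ := (hout _ _ _).1 h'
    obtain ⟨rfl, rfl⟩ := joinParts_inj hj.1 hj'.1 (expandRuns_injOn (hvalid hj) (hvalid hj') heq)
    rfl
  · simp only [F]
    omega

end LongWords

/-! ### All minimal absent words -/

section Assembly

variable {σ : ℕ} {T : List (Fin σ)}

/-- The first and the last run have exponent `1`. -/
def UnitEnds {α : Type*} (L : List (α × ℕ)) : Prop :=
  (∀ x ∈ L.head?, x.2 = 1) ∧ ∀ x ∈ L.getLast?, x.2 = 1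

theorem rle_of_mem_absentChars {w : List (Fin σ)} (h : w ∈ absentChars T) :
    UnitEnds (rle w) ∧ (rle w).length = 1 := by
  obtain ⟨-, a, rfl⟩ := h
  simp [rle, UnitEnds]

theorem rle_of_mem_pairMAW {w : List (Fin σ)} (h : w ∈ pairMAW T) :
    UnitEnds (rle w) ∧ (rle w).length = 2 := by
  obtain ⟨-, a, b, hab, rfl⟩ := h
  rw [rle_expandRuns (by simp [runList_cons_cons, runList_singleton, hab])]
  simp [UnitEnds]

theorem rle_of_mem_tripleMAW {w : List (Fin σ)} (h : w ∈ tripleMAW T) :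
    UnitEnds (rle w) ∧ (rle w).length = 3 := by
  obtain ⟨-, a, c, k, b, hac, hcb, hk, rfl⟩ := h
  rw [rle_expandRuns (by simp [runList_cons_cons, runList_singleton, hac, hcb, hk])]
  simp [UnitEnds]

theorem rle_of_mem_longMAW {w : List (Fin σ)} (h : w ∈ longMAW T) :
    UnitEnds (rle w) ∧ 4 ≤ (rle w).length := by
  obtain ⟨-, a, c, i, V, d, l, b, hV, rfl⟩ := h
  rw [rle_expandRuns hV]
  constructor
  · simp [UnitEnds, List.getLast?_append, List.getLast?_cons]
  · simp

theorem rle_of_mem_longEndMAW {w : List (Fin σ)} (h : w ∈ longEndMAW (rle T)) :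
    ¬ UnitEnds (rle w) := by
  rcases h with ⟨-, a, k, hk, rfl⟩ | ⟨-, a, i, V, b, l, hV, rfl, h⟩
  · have : rle (List.replicate k a) = [(a, k)] := by
      have := rle_expandRuns (R := [(a, k)]) (runList_singleton.2 (by simp only; omega))
      simpa using this
    rw [this]
    simp [UnitEnds]
    omega
  · rw [rle_expandRuns hV]
    simp [UnitEnds, List.getLast?_append, List.getLast?_cons]
    omega

/-- The classification of the minimal absent words by their runs. -/
theorem MAW_eq_union (T : List (Fin σ)) : MAW T =
    longEndMAW (rle T) ∪ (absentChars T ∪ (pairMAW T ∪ (tripleMAW T ∪ longMAW T))) := by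
  ext w
  constructor
  · intro hw
    have hw' : w ∈ MAW (expandRuns (rle T)) := by rwa [expandRuns_rle]
    have hV := runList_rle w
    obtain ⟨L, hL⟩ : ∃ L, L = rle w := ⟨_, rfl⟩
    have hwL : w = expandRuns L := by rw [hL, expandRuns_rle]
    rw [← hL] at hV
    clear hL
    subst hwL
    rcases L with _ | ⟨⟨a, i⟩, L⟩
    · exact absurd rfl hw.1
    · have hi : 0 < i := hV.head_pos
      rcases L.eq_nil_or_concat with rfl | ⟨V, ⟨b, l⟩, rfl⟩
      · by_cases h : 2 ≤ i
        · exact Or.inl (Or.inl ⟨hw', a, i, h, by simp⟩)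
        · obtain rfl : i = 1 := by omega
          exact Or.inr (Or.inl ⟨hw, a, by simp⟩)
      · rw [List.concat_eq_append] at *
        have hl : 0 < l := hV.1 (b, l) (by simp)
        by_cases h : 2 ≤ i ∨ 2 ≤ l
        · exact Or.inl (Or.inr ⟨hw', a, i, V, b, l, hV, rfl, h⟩)
        · obtain rfl : i = 1 := by omega
          obtain rfl : l = 1 := by omega
          refine Or.inr (Or.inr ?_)
          rcases V with _ | ⟨⟨c, k⟩, V⟩
          · exact Or.inl ⟨hw, a, b, (runList_cons_cons.1 hV).2.1, rfl⟩
          · rcases V.eq_nil_or_concat with rfl | ⟨V, ⟨d, e⟩, rfl⟩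
            · have h1 := runList_cons_cons.1 hV
              have h2 := runList_cons_cons.1 h1.2.2
              exact Or.inr (Or.inl ⟨hw, a, c, k, b, h1.2.1, h2.2.1, h2.1, rfl⟩)
            · refine Or.inr (Or.inr ⟨hw, a, c, k, V, d, e, b, ?_, ?_⟩)
              · simpa using hV
              · simp
  · rintro (h | h | h | h | h)
    · have : w ∈ MAW (expandRuns (rle T)) := by
        rcases h with h | h <;> exact h.1
      rwa [expandRuns_rle] at this
    all_goals exact h.1

theorem reportable_MAW (hT : T ≠ []) : Reportable T 50 (MAW T) := by
  rw [MAW_eq_union]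
  refine (reportable_longEndMAW hT).union ((reportable_absentChars hT).union
    ((reportable_pairMAW hT).union ((reportable_tripleMAW hT).union (reportable_longMAW hT)
    ?_) ?_) ?_) ?_
  all_goals
    rw [Set.disjoint_left]
    intro w h h'
  · have := (rle_of_mem_tripleMAW h).2
    have := (rle_of_mem_longMAW h').2
    omega
  · have := (rle_of_mem_pairMAW h).2
    rcases h' with h' | h'
    · have := (rle_of_mem_tripleMAW h').2
      omega
    · have := (rle_of_mem_longMAW h').2
      omega
  · have := (rle_of_mem_absentChars h).2
    rcases h' with h' | h' | h'
    · have := (rle_of_mem_pairMAW h').2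
      omega
    · have := (rle_of_mem_tripleMAW h').2
      omega
    · have := (rle_of_mem_longMAW h').2
      omega
  · refine rle_of_mem_longEndMAW h ?_
    rcases h' with h' | h' | h' | h'
    · exact (rle_of_mem_absentChars h').1
    · exact (rle_of_mem_pairMAW h').1
    · exact (rle_of_mem_tripleMAW h').1
    · exact (rle_of_mem_longMAW h').1

/-- Every character has a power that is a minimal absent word. -/
theorem MAW_nonempty (hT : T ≠ []) : (MAW T).Nonempty := by
  classical
  let a := T.head hT
  have hex : ∃ k, ¬ List.replicate k a <:+: T := by
    refine ⟨T.length + 1, fun h => ?_⟩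
    have := h.length_le
    simp at this
  have h1 := Nat.find_spec hex
  have h0 : Nat.find hex ≠ 0 := by
    intro h
    rw [h] at h1
    simp at h1
  have h2 : List.replicate (Nat.find hex - 1) a <:+: T := by
    have := Nat.find_min hex (m := Nat.find hex - 1) (by omega)
    simpa using this
  refine ⟨List.replicate (Nat.find hex) a, (mem_MAW_iff (by simp)).2 ⟨h1, ?_⟩⟩
  simpa using h2

theorem length_flatMap_toWords (L : List (Descriptor σ)) :
    (L.flatMap Descriptor.toWords).length = 6 * L.length := by
  simp [List.length_flatMap, Descriptor.toWords, mul_comm]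

theorem length_flatMap_words (L : List Record) :
    (L.flatMap Record.words).length = 12 * L.length := by
  simp [List.length_flatMap, Record.words, mul_comm]

end Assembly

/-- There are one constant `C` and one query program such that every nonempty string `T` over
`{0, …, σ - 1}`, with run-length encoding of size `m`, has a data structure `D` of at most `C * m`
words, beginning with the run-length encoding itself, on which the program reports every minimal
absent word of `T` exactly once, within `C * |MAW T|` steps and with `C * m` words of
(uninitialized) working memory. This holds for every word size that is large enough for words to
hold the numbers below `C * (|T| + σ)`. -/
theorem theorem1 :
    ∃ (C : ℕ) (query : WordRAM.Prog),
      ∀ (σ : ℕ) (T : List (Fin σ)), T ≠ [] →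
        ∃ D : List ℕ,
          rleWords T <+: D ∧
          D.length ≤ C * rleSize T ∧
          ∀ w : ℕ, C * (T.length + σ) ≤ 2 ^ w →
            (∀ d ∈ D, d < 2 ^ w) ∧
            ∀ mem : List ℕ, mem.length = C * rleSize T → (∀ d ∈ mem, d < 2 ^ w) →
              ∃ (t : ℕ) (s : WordRAM.State),
                WordRAM.Exec w D query (WordRAM.State.init mem) t s ∧
                t ≤ C * (MAW T).ncard ∧
                ReportsMAW T s.out := by
  refine ⟨700, WordRAM.queryProg, fun σ T hT => ?_⟩
  have hm := rleSize_pos hT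
  have hn := rleSize_le T
  obtain ⟨items, recs, L, W, h1, h2, h3, h4, h5, h6, h7, h8⟩ :=
    reportable_MAW hT (2 * rleSize T + 3) (by omega)
  set m := rleSize T with hmdef
  set body := (rle T).flatMap fun x => [x.1.val, x.2] with hbodydef
  have hbody : body.length = 2 * m := by
    simp [hbodydef, List.length_flatMap, hmdef, rleSize, mul_comm]
  set p := 2 * m + 3 + items.length with hp
  have hrecs := length_flatMap_words recs
  set D := (m :: body) ++ [p, p + 12 * recs.length] ++ items ++ recs.flatMap Record.words with hD
  refine ⟨D, ⟨[p, p + 12 * recs.length] ++ items ++ recs.flatMap Record.words, ?_⟩, ?_,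
    fun w hw => ⟨?_, fun mem hmem _ => ?_⟩⟩
  · simp [hD, rleWords, hbodydef, hmdef]
  · simp only [hD, List.length_append, List.length_cons, List.length_nil, hbody, hrecs]
    omega
  · intro d hd
    have hd' : d = m ∨ d ∈ body ∨ d = p ∨ d = p + 12 * recs.length ∨
        d ∈ items ++ recs.flatMap Record.words := by
      simp only [hD, List.mem_append, List.mem_cons, List.not_mem_nil, or_false] at hd ⊢
      tauto
    rcases hd' with rfl | hd | rfl | rfl | hd
    · omega
    · obtain ⟨x, hx, hd⟩ := List.mem_flatMap.1 hd
      have e1 := x.1.isLt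
      have e2 := exp_le_length hx
      rw [expandRuns_rle] at e2
      simp at hd
      omega
    · omega
    · omega
    · have := h4 d hd
      omega
  · obtain ⟨t, s, e1, e2, e3⟩ := WordRAM.exec_queryProg (w := w) body m hbody items recs mem p hp
      (by omega)
    have hout : outputOf (2 ^ w) D mem recs = L.flatMap Descriptor.toWords := by
      refine h8 (2 ^ w) D mem (by omega) ?_ (by omega)
      refine ⟨recs.flatMap Record.words, ?_⟩
      rw [hD, List.append_assoc, List.drop_left' (by simp [hbody])]
    have hLW : L.length = W.length := by
      have := congrArg List.length h5
      simpa using this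
    have hcnt : (recs.map Record.cnt).sum = W.length := by
      have := congrArg List.length hout
      rw [length_outputOf, length_flatMap_toWords] at this
      omega
    have hncard : (MAW T).ncard = W.length := by
      have : MAW T = (W.toFinset : Set (List (Fin σ))) := by
        ext v
        simp [h7]
      rw [this, Set.ncard_coe_finset, List.toFinset_card_of_nodup h6]
    have hWpos : 0 < W.length := by
      obtain ⟨v, hv⟩ := MAW_nonempty hT
      exact List.length_pos_of_mem ((h7 v).2 hv)
    refine ⟨t, s, e1, ?_, L, W, e3.trans hout, h5, h6, h7⟩
    rw [hncard]
    omega
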